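/- **Setting and notation.** Let $n\ge 2$. Hyperbolic space $\mathbb H^n$ is the unit ball $\{|x|<1\}\subset\mathbb R^n$ with $b=\rho^{-2}\delta$, $\rho=\frac{1-|x|^2}{2}$; $B_r(x)$ denotes geodesic balls, and $B_R=B_R(0)$. For covariant tensors $T$ on $\mathbb H^n\setminus\overline{B_R}$ we write $T\in C^{k,\alpha}_\tau$ if $\sup_{x\notin \overline{B_{R+1}}}\rho(x)^{-\tau}\|T\|_{C^{k,\alpha}(B_1(x))}<\infty$. Let $M$ be a smooth $n$-manifold, possibly with boundary. A *chart at infinity* of $M$ is a diffeomorphism $\Psi:M\setminus K_0\to\mathbb H^n\setminus\overline{B_{R_0}}$, with $K_0$ compact and $R_0>0$, such that $M\setminus\Psi^{-1}(\mathbb H^n\setminus\overline{B_R})$ is compact for all $R\ge R_0$. Let $U\subset M$ be open with $M\setminus U$ compact. A Riemannian metric $h\in C^{k,\alpha}_{\rm loc}(U)$ makes $(U,h)$ a *$C^{k,\alpha}_\tau$ asymptotically hyperbolic manifold* if there is a chart at infinity $\Psi$ with $M\setminus K_0\subset U$ and $\Psi_*h-b\in C^{k,\alpha}_\tau$ (for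 $U=M$ this is the usual notion). We transplant $\rho$ to $M\setminus K_0$ by $\Psi$ and put $\rho:=1$ on $K_0$. Let $\mathcal N=\operatorname{span}\{V_0=\frac{1-\rho}{\rho},\,V_i=\frac{x^i}{\rho}\ (1\le i\le n)\}$. With $e=\Psi_*h-b$, $c_n^{-1}=2(n-1)\omega_{n-1}$, $\omega_{n-1}$ the area of the unit sphere $S^{n-1}$, and $\nu$ the outward $b$-unit normal, the *mass functional* of $(U,h)$ (in the chart $\Psi$) is *well defined* if the limit $$\mathcal M_h(V)=c_n\lim_{r\to1^-}\int_{\{|x|=r\}}\big[V(\operatorname{div}^b e-d\operatorname{tr}_b e)-e(\nabla^bV,\cdot)+(\operatorname{tr}_be)\,dV\big](\nu)\,d\mu^b$$ exists for all $V\in\mathcal N$ and is linear in $V$. **Theorem (Mass change and Jang reduction).** Let $\alpha\in(0,1)$ and $\tau>n/2$. Let $(M,g,K)$ be a $C^{2,\alpha}_\tau$ asymptotically anti-de Sitter initial data set: $(M,g)$ is $C^{2,\alpha}_\tau$ asymptotically hyperbolic with chart at infinity $\Psi$, and $K\in C^{1,\alpha}_{\rm loc}(M)$ is a symmetric $2$-tensor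 with $\Psi_*K\in C^{1,\alpha}_\tau$. Assume $\rho^{-1}(\mathrm{Scal}^g+n(n-1))\in L^1(M,g)$. Let $u\in C^{2,\alpha}_{\rm loc}(M)$ be positive with $u\circ\Psi^{-1}-\rho^{-1}\in C^{2,\alpha}_0$. Let $U\subset M$ be open with $M\setminus U$ compact, and let $f\in C^{3,\alpha}_{\tau+1}(U)$, that is, $f\in C^{3,\alpha}_{\rm loc}(U)$ and $f\circ\Psi^{-1}\in C^{3,\alpha}_{\tau+1}$ on $\mathbb H^n\setminus\overline{B_R}$ for some $R\ge R_0$ with $\Psi^{-1}(\mathbb H^n\setminus\overline{B_R})\subset U$. Suppose that $f$ solves the generalized Jang equation on $U$: $$\Big(g^{ij}-\frac{u^2f^if^j}{1+u^2|df|_g^2}\Big)\Big(\frac{u\,\mathrm{Hess}_{ij}f+u_if_j+f_iu_j}{\sqrt{1+u^2|df|_g^2}}-K_{ij}\Big)=0 .$$ Let $\overline g=g+u^2df^2$ be the induced metric on the graph $\Gamma(f)\subset (M\times\mathbb R,\,g+u^2dt^2)$, identified with $U$ by $x\mapsto(x,f(x))$. Then: 1. $(\Gamma(f),\overline g)$ is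 a $C^{2,\alpha}_\tau$ asymptotically hyperbolic manifold, whose chart at infinity is a restriction of $\Psi$. 2. $\rho^{-1}(\mathrm{Scal}^{\overline g}+n(n-1))$ is integrable with respect to the volume of $\overline g$ on every $W\subset U$ that is closed in $M$; in particular near infinity, and on all of $\Gamma(f)$ if $U=M$. If $f$ is of class $C^{3,\alpha}$ up to $\partial U$, then $\overline g$ is of class $C^{2,\alpha}$ up to $\partial U$ and $\rho^{-1}(\mathrm{Scal}^{\overline g}+n(n-1))\in L^1(\Gamma(f),\overline g)$. 3. The mass functionals of $(M,g)$ and of $(\Gamma(f),\overline g)$ are well defined, and they coincide on $\mathcal N$. -/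

import Mathlib

open Set Filter Topology MeasureTheory
open scoped Manifold ContDiff

namespace AHJang

noncomputable section

/-! ### Hyperbolic space in the Poincaré ball model -/

/-- Euclidean space `ℝⁿ`; hyperbolic space is its open unit ball. -/
abbrev Euc (n : ℕ) : Type := EuclideanSpace ℝ (Fin n)

/-- The boundary defining function `ρ = (1 - |x|²) / 2` of the ball. -/
def rho {n : ℕ} (x : Euc n) : ℝ := (1 - ‖x‖ ^ 2) / 2

/-- The Euclidean metric as a bilinear form. -/
def euclideanForm (n : ℕ) : Euc n →L[ℝ] Euc n →L[ℝ] ℝ := innerSL ℝ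

/-- The hyperbolic metric `b = ρ⁻² δ = 4 (1 - |x|²)⁻² δ`. -/
def hypMetric (n : ℕ) (x : Euc n) : Euc n →L[ℝ] Euc n →L[ℝ] ℝ :=
  (rho x ^ 2)⁻¹ • euclideanForm n

/-- The hyperbolic distance of two points of the unit ball. -/
def hypDist {n : ℕ} (x y : Euc n) : ℝ :=
  2 * Real.arsinh (‖x - y‖ / Real.sqrt ((1 - ‖x‖ ^ 2) * (1 - ‖y‖ ^ 2)))

/-- The geodesic ball `B_r(x)` of hyperbolic space. -/
def hypBall {n : ℕ} (x : Euc n) (r : ℝ) : Set (Euc n) :=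
  {y | ‖y‖ < 1 ∧ hypDist x y < r}

/-- The complement in hyperbolic space of the closed geodesic ball of radius `R` about the
origin. -/
def hypExterior (n : ℕ) (R : ℝ) : Set (Euc n) :=
  {x | ‖x‖ < 1 ∧ R < hypDist 0 x}

/-! ### Hölder norms -/

/-- `‖F‖_{C^{k,α}(S)} ≤ C`: the derivatives of order at most `k` are bounded by `C`, and Hölder
continuous of exponent `α` with constant `C`. On bounded convex sets the Hölder condition on the
derivatives of order less than `k` is implied, up to the size of `C`, by the other conditions. -/
def HolderNormLE {E G : Type*} [NormedAddCommGroup E] [NormedSpace ℝ E]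
    [NormedAddCommGroup G] [NormedSpace ℝ G]
    (k : ℕ) (α : ℝ) (S : Set E) (F : E → G) (C : ℝ) : Prop :=
  ContDiffOn ℝ k F S ∧ ∀ j ≤ k,
    (∀ z ∈ S, ‖iteratedFDerivWithin ℝ j F S z‖ ≤ C) ∧
    (∀ z ∈ S, ∀ z' ∈ S,
      ‖iteratedFDerivWithin ℝ j F S z - iteratedFDerivWithin ℝ j F S z'‖ ≤ C * ‖z - z'‖ ^ α)

/-- The weighted Hölder space `C^{k,α}_τ` outside the closed ball of radius `R`, for covariant
`m`-tensors `T` (functions for `m = 0`) given by their components in the ball model: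
`sup_x ρ(x)^{-τ} ‖T‖_{C^{k,α}(B_1(x))} < ∞` over the `x` outside the closed ball of radius `R + 1`,
where `B_1(x)` is the hyperbolic ball. The norm over `B_1(x)` is taken in the
coordinate `z` with `y = x + ρ(x) z`, in which `T` has the components
`ρ(x)^m T(x + ρ(x) z)`. In these coordinates `b = (ρ(x) / ρ(y))² δ` is bounded, together with all
its derivatives and its inverse, uniformly in `x`. -/
def WeightedHolder {n : ℕ} {G : Type*} [NormedAddCommGroup G] [NormedSpace ℝ G]
    (m k : ℕ) (α τ R : ℝ) (T : Euc n → G) : Prop :=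
  ∃ C : ℝ, ∀ x ∈ hypExterior n (R + 1),
    HolderNormLE k α {z : Euc n | x + rho x • z ∈ hypBall x 1}
      (fun z => rho x ^ m • T (x + rho x • z)) (C * rho x ^ τ)

/-! ### Riemannian geometry in coordinates

`G` is a field of bilinear forms on a subset `S` of `ℝⁿ`; all derivatives are taken within `S`,
which allows for boundary points. -/

/-- Partial derivative `∂_i F`. -/
def pd {n : ℕ} (S : Set (Euc n)) (i : Fin n) (F : Euc n → ℝ) (y : Euc n) : ℝ :=
  fderivWithin ℝ F S y (EuclideanSpace.single i 1)

/-- Components `G_ij`. -/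
def comp {n : ℕ} (G : Euc n → Euc n →L[ℝ] Euc n →L[ℝ] ℝ) (y : Euc n) :
    Matrix (Fin n) (Fin n) ℝ :=
  Matrix.of fun i j => G y (EuclideanSpace.single i 1) (EuclideanSpace.single j 1)

/-- Components `G^ij` of the inverse metric. -/
def compInv {n : ℕ} (G : Euc n → Euc n →L[ℝ] Euc n →L[ℝ] ℝ) (y : Euc n) :
    Matrix (Fin n) (Fin n) ℝ :=
  (comp G y)⁻¹

/-- Christoffel symbols `Γ^k_ij`. -/
def christoffel {n : ℕ} (S : Set (Euc n)) (G : Euc n → Euc n →L[ℝ] Euc n →L[ℝ] ℝ)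
    (k i j : Fin n) (y : Euc n) : ℝ :=
  (1 / 2) * ∑ l, compInv G y k l *
    (pd S i (fun z => comp G z j l) y + pd S j (fun z => comp G z i l) y
      - pd S l (fun z => comp G z i j) y)

/-- Ricci curvature
`R_ij = ∂_k Γ^k_ij - ∂_j Γ^k_ik + Γ^k_kl Γ^l_ij - Γ^k_jl Γ^l_ik`. -/
def coordRicci {n : ℕ} (S : Set (Euc n)) (G : Euc n → Euc n →L[ℝ] Euc n →L[ℝ] ℝ)
    (i j : Fin n) (y : Euc n) : ℝ :=
  ∑ k, (pd S k (christoffel S G k i j) y - pd S j (christoffel S G k i k) y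
    + ∑ l, (christoffel S G k k l y * christoffel S G l i j y
      - christoffel S G k j l y * christoffel S G l i k y))

/-- Scalar curvature `G^ij R_ij`. -/
def coordScal {n : ℕ} (S : Set (Euc n)) (G : Euc n → Euc n →L[ℝ] Euc n →L[ℝ] ℝ)
    (y : Euc n) : ℝ :=
  ∑ i, ∑ j, compInv G y i j * coordRicci S G i j y

/-- Hessian `∂_i ∂_j F - Γ^k_ij ∂_k F`. -/
def coordHess {n : ℕ} (S : Set (Euc n)) (G : Euc n → Euc n →L[ℝ] Euc n →L[ℝ] ℝ)
    (F : Euc n → ℝ) (i j : Fin n) (y : Euc n) : ℝ :=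
  pd S i (pd S j F) y - ∑ k, christoffel S G k i j y * pd S k F y

/-- Raised derivative `F^i = G^ij ∂_j F`. -/
def gradUp {n : ℕ} (S : Set (Euc n)) (G : Euc n → Euc n →L[ℝ] Euc n →L[ℝ] ℝ)
    (F : Euc n → ℝ) (i : Fin n) (y : Euc n) : ℝ :=
  ∑ j, compInv G y i j * pd S j F y

/-- `|dF|²_G = G^ij ∂_i F ∂_j F`. -/
def gradSq {n : ℕ} (S : Set (Euc n)) (G : Euc n → Euc n →L[ℝ] Euc n →L[ℝ] ℝ)
    (F : Euc n → ℝ) (y : Euc n) : ℝ :=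
  ∑ i, gradUp S G F i y * pd S i F y

/-- The generalized Jang operator
`(g^ij - u² f^i f^j / (1 + u²|df|²)) ((u Hess_ij f + u_i f_j + f_i u_j) / √(1 + u²|df|²) - K_ij)`.
-/
def coordJang {n : ℕ} (S : Set (Euc n)) (G K : Euc n → Euc n →L[ℝ] Euc n →L[ℝ] ℝ)
    (u f : Euc n → ℝ) (y : Euc n) : ℝ :=
  ∑ i, ∑ j,
    (compInv G y i j
      - u y ^ 2 * gradUp S G f i y * gradUp S G f j y / (1 + u y ^ 2 * gradSq S G f y)) *
    ((u y * coordHess S G f i j y + pd S i u y * pd S j f y + pd S i f y * pd S j u y)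
        / Real.sqrt (1 + u y ^ 2 * gradSq S G f y)
      - comp K y i j)

/-- Trace `G^ij T_ij`. -/
def coordTrace {n : ℕ} (G T : Euc n → Euc n →L[ℝ] Euc n →L[ℝ] ℝ) (y : Euc n) : ℝ :=
  ∑ i, ∑ j, compInv G y i j * comp T y i j

/-- Divergence `(div T)_j = G^ik ∇_i T_kj`. -/
def coordDiv {n : ℕ} (S : Set (Euc n)) (G T : Euc n → Euc n →L[ℝ] Euc n →L[ℝ] ℝ)
    (j : Fin n) (y : Euc n) : ℝ :=
  ∑ i, ∑ k, compInv G y i k *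
    (pd S i (fun z => comp T z k j) y
      - ∑ l, christoffel S G l i k y * comp T y l j
      - ∑ l, christoffel S G l i j y * comp T y k l)

/-! ### Tensors on manifolds

`M` is an `n`-dimensional smooth manifold, possibly with boundary. -/

section Manifold

variable {n : ℕ} {H : Type*} [TopologicalSpace H] (I : ModelWithCorners ℝ (Euc n) H)
  {M : Type*} [TopologicalSpace M] [ChartedSpace H M]

/-- Covariant 2-tensor fields, without any regularity. -/
abbrev Tensor2 (M : Type*) [TopologicalSpace M] [ChartedSpace H M] : Type _ :=
  ∀ p : M, TangentSpace I p →L[ℝ] TangentSpace I p →L[ℝ] ℝ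

/-- The pullback `σ^* T` by a map `σ : ℝⁿ ⊇ S → M`; for the inverse `σ` of a chart these are the
components of `T` in that chart. -/
def pullTensor (σ : Euc n → M) (S : Set (Euc n)) (T : Tensor2 I M) (y : Euc n) :
    Euc n →L[ℝ] Euc n →L[ℝ] ℝ :=
  let A : Euc n →L[ℝ] Euc n := mfderivWithin 𝓘(ℝ, Euc n) I σ S y
  let B : Euc n →L[ℝ] Euc n →L[ℝ] ℝ := T (σ y)
  B.bilinearComp A A

/-- The components of `T` in the chart at `p`. -/
def chartTensor (T : Tensor2 I M) (p : M) : Euc n → Euc n →L[ℝ] Euc n →L[ℝ] ℝ :=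
  pullTensor I (extChartAt I p).symm (extChartAt I p).target T

/-- The piece of a set `U` seen in the chart at `p` within distance `r` of `p`. -/
def chartPiece (U : Set M) (p : M) (r : ℝ) : Set (Euc n) :=
  (extChartAt I p).target ∩ (extChartAt I p).symm ⁻¹' U ∩ Metric.ball (extChartAt I p p) r

/-- The function `f` on the open set `U` is of class `C^{k,α}` near each point of `A`, where `A` is
a subset of the closure of `U`. For `A = U` this is `f ∈ C^{k,α}_loc(U)`; for `A = closure U` it is
`C^{k,α}` regularity up to the boundary of `U`. -/
def LocHolderFun (k : ℕ) (α : ℝ) (U A : Set M) (f : M → ℝ) : Prop :=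
  ∀ p ∈ A, ∃ r > 0, ∃ C : ℝ,
    HolderNormLE k α (chartPiece I U p r) (f ∘ (extChartAt I p).symm) C

/-- The analogue of `LocHolderFun` for 2-tensors. -/
def LocHolderTensor (k : ℕ) (α : ℝ) (U A : Set M) (T : Tensor2 I M) : Prop :=
  ∀ p ∈ A, ∃ r > 0, ∃ C : ℝ, HolderNormLE k α (chartPiece I U p r) (chartTensor I T p) C

/-- `T` is symmetric on `U`. -/
def IsSymmOn (U : Set M) (T : Tensor2 I M) : Prop :=
  ∀ p ∈ U, ∀ v w : TangentSpace I p, T p v w = T p w v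

/-- `T` is positive definite on `U`. -/
def IsPosDefOn (U : Set M) (T : Tensor2 I M) : Prop :=
  ∀ p ∈ U, ∀ v : TangentSpace I p, v ≠ 0 → 0 < T p v v

/-- Scalar curvature at a point, computed in the chart at this point. -/
def scal (g : Tensor2 I M) (p : M) : ℝ :=
  coordScal (extChartAt I p).target (chartTensor I g p) (extChartAt I p p)

/-- The Riemannian volume measure. In the domain of each chart it is `√(det g_ij) dx`: the
measures of the charts agree on overlaps, and the Riemannian measure is their supremum. -/
def riemVol [MeasurableSpace M] (g : Tensor2 I M) : Measure M :=
  ⨆ p : M, Measure.map (extChartAt I p).symm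
    ((volume.restrict (extChartAt I p).target).withDensity
      fun y => ENNReal.ofReal (Real.sqrt (comp (chartTensor I g p) y).det))

/-- The generalized Jang operator `𝒥(f)` at a point, computed in the chart at this point. -/
def jang (g K : Tensor2 I M) (u f : M → ℝ) (p : M) : ℝ :=
  coordJang (extChartAt I p).target (chartTensor I g p) (chartTensor I K p)
    (u ∘ (extChartAt I p).symm) (f ∘ (extChartAt I p).symm) (extChartAt I p p)

/-- The differential of a real function. -/
def diff (f : M → ℝ) (p : M) : TangentSpace I p →L[ℝ] ℝ := mfderiv I 𝓘(ℝ, ℝ) f p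

/-- The metric `g + u² df ⊗ df` induced on the graph `Γ(f) = {(x, f x)}` in
`(M × ℝ, g + u² dt²)`, the graph being parametrized by `x ↦ (x, f x)`. -/
def graphMetric (g : Tensor2 I M) (u f : M → ℝ) : Tensor2 I M :=
  fun p => g p + (u p ^ 2) • (diff I f p).smulRight (diff I f p)

/-! ### Asymptotically hyperbolic manifolds -/

/-- A chart at infinity: a diffeomorphism of the complement of a compact set `K₀` onto the
complement of the closed ball of radius `R₀` in hyperbolic space. Here `K₀` is the complement of
the source. The set left after removing the region outside any larger ball is again
compact, which says that `M` has no missing points or further ends at the inner side of the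
end. -/
structure ChartAtInfinity (M : Type*) [TopologicalSpace M] [ChartedSpace H M] where
  /-- the diffeomorphism -/
  Psi : OpenPartialHomeomorph M (Euc n)
  /-- the inner radius -/
  R₀ : ℝ
  R₀_pos : 0 < R₀
  target_eq : Psi.target = hypExterior n R₀
  smooth : ContMDiffOn I 𝓘(ℝ, Euc n) ∞ Psi Psi.source
  smooth_symm : ContMDiffOn 𝓘(ℝ, Euc n) I ∞ Psi.symm Psi.target
  isCompact_core : ∀ R, R₀ ≤ R → IsCompact {p | p ∈ Psi.source ∧ R < hypDist 0 (Psi p)}ᶜ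

variable {I}

/-- The components of a tensor in the ball model, `Ψ_* T`. -/
def ChartAtInfinity.push (Φ : ChartAtInfinity I M) (T : Tensor2 I M) :
    Euc n → Euc n →L[ℝ] Euc n →L[ℝ] ℝ :=
  pullTensor I Φ.Psi.symm Φ.Psi.target T

/-- The function `ρ`, transplanted to the end of `M` by the chart at infinity, and extended by `1`
to the compact core. -/
def ChartAtInfinity.weight (Φ : ChartAtInfinity I M) (p : M) : ℝ :=
  open Classical in if p ∈ Φ.Psi.source then rho (Φ.Psi p) else 1

/-- The function `(Scal + n(n-1)) / ρ`. -/
def ChartAtInfinity.scalDefect (Φ : ChartAtInfinity I M) (g : Tensor2 I M) (p : M) : ℝ :=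
  (scal I g p + n * (n - 1)) / Φ.weight p

/-- `(U, g)` is a `C^{k,α}_τ` asymptotically hyperbolic manifold with chart at infinity `Φ`; here
`U` is an open subset of `M` with compact complement, and `U = M` is the case of `M` itself. -/
structure ChartAtInfinity.IsAsympHyp (Φ : ChartAtInfinity I M) (U : Set M) (g : Tensor2 I M)
    (k : ℕ) (α τ : ℝ) : Prop where
  source_subset : Φ.Psi.source ⊆ U
  symm : IsSymmOn I U g
  posDef : IsPosDefOn I U g
  regular : LocHolderTensor I k α U U g
  decay : WeightedHolder 2 k α τ Φ.R₀ (fun x => Φ.push g x - hypMetric n x)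

/-- `(M, g, K)` is a `C^{k,α}_τ` asymptotically anti-de Sitter initial data set. -/
structure ChartAtInfinity.IsAsympAdS (Φ : ChartAtInfinity I M) (g K : Tensor2 I M)
    (k : ℕ) (α τ : ℝ) : Prop where
  metric : Φ.IsAsympHyp univ g k α τ
  symm : IsSymmOn I univ K
  regular : LocHolderTensor I (k - 1) α univ univ K
  decay : WeightedHolder 2 (k - 1) α τ Φ.R₀ (Φ.push K)

/-- `u` is a positive function on `M` with `u - ρ⁻¹ ∈ C^{k,α}_0(M)`. -/
structure ChartAtInfinity.IsWarpingFactor (Φ : ChartAtInfinity I M) (u : M → ℝ)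
    (k : ℕ) (α : ℝ) : Prop where
  pos : ∀ p, 0 < u p
  regular : LocHolderFun I k α univ univ u
  decay : WeightedHolder 0 k α 0 Φ.R₀ (fun x => u (Φ.Psi.symm x) - (rho x)⁻¹)

/-- `f ∈ C^{k,α}_τ(U)` for an open set `U` with compact complement: `f` is `C^{k,α}_loc` in
`U`, and has finite `C^{k,α}_τ` norm in a neighbourhood of infinity. Nothing is required at the
boundary of `U`, where `f` may blow up. -/
structure ChartAtInfinity.IsWeightedFun (Φ : ChartAtInfinity I M) (U : Set M) (f : M → ℝ)
    (k : ℕ) (α τ : ℝ) : Prop where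
  regular : LocHolderFun I k α U U f
  decay : ∃ R, Φ.R₀ ≤ R ∧ (∀ p ∈ Φ.Psi.source, R < hypDist 0 (Φ.Psi p) → p ∈ U) ∧
    WeightedHolder 0 k α τ R (f ∘ Φ.Psi.symm)

end Manifold

/-! ### The mass functional -/

/-- The function `V₀ = (1 - ρ) / ρ`. -/
def kernelZero (n : ℕ) (x : Euc n) : ℝ := (1 - rho x) / rho x

/-- The functions `V_i = x^i / ρ`. -/
def kernelCoord {n : ℕ} (i : Fin n) (x : Euc n) : ℝ := x i / rho x

/-- The space `𝒩` spanned by `V₀, V₁, …, V_n`. -/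
def kernelSpace (n : ℕ) : Submodule ℝ (Euc n → ℝ) :=
  Submodule.span ℝ (insert (kernelZero n) (range kernelCoord))

/-- The one-form `V (div e - d tr e) - e(∇V, ·) + (tr e) dV`, with all operations taken with respect
to the hyperbolic metric. -/
def massForm {n : ℕ} (V : Euc n → ℝ) (e : Euc n → Euc n →L[ℝ] Euc n →L[ℝ] ℝ)
    (j : Fin n) (x : Euc n) : ℝ :=
  V x * (coordDiv univ (hypMetric n) e j x - pd univ j (coordTrace (hypMetric n) e) x)
    - ∑ i, gradUp univ (hypMetric n) V i x * comp e x i j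
    + coordTrace (hypMetric n) e x * pd univ j V x

/-- The flux `c_n ∫_{|x| = r} massForm(ν) dμ^b`, `c_n⁻¹ = 2 (n - 1) ω_{n-1}`. With respect to `b`
the unit normal of the sphere is `ν = ρ x / |x|` and its area element is `ρ^{-(n-1)}` times
the Euclidean one, which is `r^{n-1}` times the area element of the unit sphere. -/
def massFlux {n : ℕ} (V : Euc n → ℝ) (e : Euc n → Euc n →L[ℝ] Euc n →L[ℝ] ℝ) (r : ℝ) : ℝ :=
  (2 * (volume : Measure (Euc n)).toSphere.real univ * ((n : ℝ) - 1))⁻¹ *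
    ∫ θ : Metric.sphere (0 : Euc n) 1,
      (∑ j, massForm V e j (r • (θ : Euc n)) * (rho (r • (θ : Euc n)) * (θ : Euc n) j)) *
        (r / rho (r • (θ : Euc n))) ^ (n - 1)
      ∂(volume : Measure (Euc n)).toSphere

/-- The mass functional of the metric `g` in the chart at infinity `Φ` is well defined, and it is
the linear map `m` on `𝒩`: the fluxes of `e = Ψ_* g - b` through the spheres `|x| = r` converge as
`r → 1`, that is as `ρ → 0`. -/
def ChartAtInfinity.HasMass {n : ℕ} {H : Type*} [TopologicalSpace H]
    {I : ModelWithCorners ℝ (Euc n) H} {M : Type*} [TopologicalSpace M] [ChartedSpace H M]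
    (Φ : ChartAtInfinity I M) (g : Tensor2 I M) (m : kernelSpace n →ₗ[ℝ] ℝ) : Prop :=
  ∀ V : kernelSpace n,
    Tendsto (massFlux (V : Euc n → ℝ) (fun x => Φ.push g x - hypMetric n x)) (𝓝[<] 1) (𝓝 (m V))

end

end AHJang

namespace AHJang

noncomputable section

/-! ### Calculus of Hölder norms -/

section Holder

variable {E F G W : Type} [NormedAddCommGroup E] [NormedSpace ℝ E]
  [NormedAddCommGroup F] [NormedSpace ℝ F] [NormedAddCommGroup G] [NormedSpace ℝ G]
  [NormedAddCommGroup W] [NormedSpace ℝ W] {k : ℕ} {α : ℝ} {S : Set E}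

/-! The graph metric differs from `g` by `u² df ⊗ df`. Since `u` has order `ρ⁻¹` and `df`, measured
in `b`, has order `ρ^{τ+1}`, this perturbation has order `ρ^{2τ}` together with two derivatives
(`ChartAtInfinity.asy_push_graphMetric`). The order `τ` is preserved a fortiori, which gives
asymptotic hyperbolicity. Because `2τ > n`, the perturbation also lies beyond the threshold `ρ^n` at
which the mass and the weighted integral of the scalar curvature react.

Scalar curvature. For `G = b + e` with `e` of order `ρ^τ`, the difference of the Christoffel symbols
of `G` and `b` is linear in the covariant derivative of `e` up to the inverse metric. Expanding the
Ricci tensor around `Ric = -(n-1) b` gives `Scal + n(n-1) = linScal e + O(ρ^{2τ})`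
(`AsyHyp.asy_scal`). Comparing `g` with the graph metric, the two scalar curvatures differ by
`O(ρ^{2τ})` (`AsyHyp.asy_scal_sub`). Against `ρ⁻¹ dμ ~ ρ^{-n-1} dx` this leaves `ρ^{2τ-n-1}`, whose
exponent exceeds `-1`, so it is integrable up to the unit sphere. On the compact remainder the
integrand is locally bounded wherever `f` is regular, and compactness finishes.

Mass. Functions in `𝒩` satisfy `Hess V = V b`, so they lie in the kernel of the adjoint of the
linearized scalar curvature, and `V linScal e` is the divergence of the mass form (`div_massVec`).
The derivative in `r` of the flux through `|x| = r` is therefore `V (Scal + n(n-1))` plus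
`O(ρ^{2τ-1})`, integrated over spheres with hyperbolic volume. Its integrability makes the flux
converge (`exists_tendsto_flux`, `AsyHyp.exists_tendsto_sphFlux`). The flux is linear in `e`, and
the share of `u² df²` is of order `ρ^{2τ-n}`, hence tends to zero (`AsyHyp.tendsto_massFlux_congr`).

Two devices carry the bookkeeping. The classes `Asy` record the order in `ρ` of Euclidean components
in rescaled unit balls: a covariant `m`-tensor of order `s` in `b` has components of order `s - m`,
a product adds orders, and a partial derivative costs one power of `ρ`. Further, `scal` is computed
at each point in the chart centred there, and `riemVol` is a supremum over charts. Estimates in a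
fixed chart or in the ball thus rest on coordinate invariance of both (`coordScal_pullback`,
`IsParam.riemVol_restrict`). -/

theorem holderNormLE_zero {f : E → F} {C : ℝ} :
    HolderNormLE 0 α S f C ↔ ContinuousOn f S ∧ (∀ z ∈ S, ‖f z‖ ≤ C) ∧
      ∀ z ∈ S, ∀ z' ∈ S, ‖f z - f z'‖ ≤ C * ‖z - z'‖ ^ α := by
  have hsub : ∀ z z' : E, ‖iteratedFDerivWithin ℝ 0 f S z - iteratedFDerivWithin ℝ 0 f S z'‖
      = ‖f z - f z'‖ := by
    intro z z'
    rw [iteratedFDerivWithin_zero_eq_comp]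
    simp only [Function.comp_apply]
    rw [← map_sub, LinearIsometryEquiv.norm_map]
  constructor
  · rintro ⟨h1, h2⟩
    obtain ⟨h3, h4⟩ := h2 0 le_rfl
    refine ⟨h1.continuousOn, fun z hz => ?_, fun z hz z' hz' => ?_⟩
    · simpa using h3 z hz
    · simpa only [hsub] using h4 z hz z' hz'
  · rintro ⟨h1, h2, h3⟩
    refine ⟨by rw [Nat.cast_zero]; exact contDiffOn_zero.2 h1, fun j hj => ?_⟩
    obtain rfl : j = 0 := by omega
    exact ⟨fun z hz => by simpa using h2 z hz, fun z hz z' hz' => by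
      simpa only [hsub] using h3 z hz z' hz'⟩

/-- Currying is a linear isometry, so passing from derivatives of `f` to those of its differential
changes neither norms nor norms of differences. The same `C` on both sides makes this the induction
step for all Hölder estimates below. -/
theorem holderNormLE_succ (hS : UniqueDiffOn ℝ S) {f : E → F} {C : ℝ} :
    HolderNormLE (k + 1) α S f C ↔ HolderNormLE 0 α S f C ∧ DifferentiableOn ℝ f S ∧
      HolderNormLE k α S (fderivWithin ℝ f S) C := by
  have key : ∀ j : ℕ, ∀ z ∈ S, ‖iteratedFDerivWithin ℝ (j + 1) f S z‖
      = ‖iteratedFDerivWithin ℝ j (fderivWithin ℝ f S) S z‖ := fun j z hz => by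
    rw [norm_iteratedFDerivWithin_fderivWithin hS hz]
  have key2 : ∀ j : ℕ, ∀ z ∈ S, ∀ z' ∈ S,
      ‖iteratedFDerivWithin ℝ (j + 1) f S z - iteratedFDerivWithin ℝ (j + 1) f S z'‖
      = ‖iteratedFDerivWithin ℝ j (fderivWithin ℝ f S) S z -
        iteratedFDerivWithin ℝ j (fderivWithin ℝ f S) S z'‖ := fun j z hz z' hz' => by
    rw [iteratedFDerivWithin_succ_eq_comp_right hS hz,
      iteratedFDerivWithin_succ_eq_comp_right hS hz']
    have := (continuousMultilinearCurryRightEquiv' ℝ j E F).symm.isometry.dist_eq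
      (iteratedFDerivWithin ℝ j (fderivWithin ℝ f S) S z)
      (iteratedFDerivWithin ℝ j (fderivWithin ℝ f S) S z')
    rw [dist_eq_norm, dist_eq_norm] at this
    exact this
  have hcd : ContDiffOn ℝ ((k + 1 : ℕ) : WithTop ℕ∞) f S ↔
      DifferentiableOn ℝ f S ∧ ContDiffOn ℝ k (fderivWithin ℝ f S) S := by
    rw [Nat.cast_succ, contDiffOn_succ_iff_fderivWithin hS]
    simp
  constructor
  · rintro ⟨h1, h2⟩
    refine ⟨⟨h1.of_le (by simp), fun j hj => h2 j (by omega)⟩, (hcd.1 h1).1, (hcd.1 h1).2,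
      fun j hj => ⟨fun z hz => ?_, fun z hz z' hz' => ?_⟩⟩
    · rw [← key j z hz]; exact (h2 (j + 1) (by omega)).1 z hz
    · rw [← key2 j z hz z' hz']; exact (h2 (j + 1) (by omega)).2 z hz z' hz'
  · rintro ⟨h0, h1, h2⟩
    refine ⟨hcd.2 ⟨h1, h2.1⟩, fun j hj => ?_⟩
    rcases j with _ | j
    · exact h0.2 0 le_rfl
    · refine ⟨fun z hz => ?_, fun z hz z' hz' => ?_⟩
      · rw [key j z hz]; exact (h2.2 j (by omega)).1 z hz
      · rw [key2 j z hz z' hz']; exact (h2.2 j (by omega)).2 z hz z' hz'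

theorem HolderNormLE.of_le {f : E → F} {C : ℝ} {l : ℕ} (h : HolderNormLE k α S f C) (hl : l ≤ k) :
    HolderNormLE l α S f C :=
  ⟨h.1.of_le (by exact_mod_cast hl), fun j hj => h.2 j (hj.trans hl)⟩

theorem HolderNormLE.mono_const {f : E → F} {C C' : ℝ} (h : HolderNormLE k α S f C) (hC : C ≤ C') :
    HolderNormLE k α S f C' :=
  ⟨h.1, fun j hj => ⟨fun z hz => ((h.2 j hj).1 z hz).trans hC, fun z hz z' hz' =>
    ((h.2 j hj).2 z hz z' hz').trans (by gcongr)⟩⟩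

theorem HolderNormLE.congr {f g : E → F} {C : ℝ} (h : HolderNormLE k α S f C)
    (hfg : EqOn g f S) : HolderNormLE k α S g C := by
  refine ⟨h.1.congr hfg, fun j hj => ⟨fun z hz => ?_, fun z hz z' hz' => ?_⟩⟩
  · rw [iteratedFDerivWithin_congr hfg hz]; exact (h.2 j hj).1 z hz
  · rw [iteratedFDerivWithin_congr hfg hz, iteratedFDerivWithin_congr hfg hz']
    exact (h.2 j hj).2 z hz z' hz'

theorem HolderNormLE.mono_set {f : E → F} {C : ℝ} {S' : Set E} (h : HolderNormLE k α S f C)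
    (hS' : S' ⊆ S) (h1 : UniqueDiffOn ℝ S') (h2 : UniqueDiffOn ℝ S) :
    HolderNormLE k α S' f C := by
  have key : ∀ j ≤ k, ∀ z ∈ S', iteratedFDerivWithin ℝ j f S' z = iteratedFDerivWithin ℝ j f S z :=
    fun j hj z hz => iteratedFDerivWithin_subset hS' h1 h2 (h.1.of_le (by exact_mod_cast hj)) hz
  refine ⟨h.1.mono hS', fun j hj => ⟨fun z hz => ?_, fun z hz z' hz' => ?_⟩⟩
  · rw [key j hj z hz]; exact (h.2 j hj).1 z (hS' hz)
  · rw [key j hj z hz, key j hj z' hz']; exact (h.2 j hj).2 z (hS' hz) z' (hS' hz')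

theorem HolderNormLE.fderivWithin {f : E → F} {C : ℝ} (h : HolderNormLE (k + 1) α S f C)
    (hS : UniqueDiffOn ℝ S) : HolderNormLE k α S (fderivWithin ℝ f S) C :=
  ((holderNormLE_succ hS).1 h).2.2

theorem HolderNormLE.add {f g : E → F} {C D : ℝ} (hf : HolderNormLE k α S f C)
    (hg : HolderNormLE k α S g D) (hS : UniqueDiffOn ℝ S) :
    HolderNormLE k α S (fun z => f z + g z) (C + D) := by
  have key : ∀ j ≤ k, ∀ z ∈ S, iteratedFDerivWithin ℝ j (fun z => f z + g z) S z
      = iteratedFDerivWithin ℝ j f S z + iteratedFDerivWithin ℝ j g S z := fun j hj z hz =>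
    fun_iteratedFDerivWithin_add_apply ((hf.1.of_le (by exact_mod_cast hj)) z hz)
      ((hg.1.of_le (by exact_mod_cast hj)) z hz) hS hz
  refine ⟨hf.1.add hg.1, fun j hj => ⟨fun z hz => ?_, fun z hz z' hz' => ?_⟩⟩
  · rw [key j hj z hz]
    exact (norm_add_le _ _).trans (add_le_add ((hf.2 j hj).1 z hz) ((hg.2 j hj).1 z hz))
  · rw [key j hj z hz, key j hj z' hz', add_sub_add_comm, add_mul]
    exact (norm_add_le _ _).trans
      (add_le_add ((hf.2 j hj).2 z hz z' hz') ((hg.2 j hj).2 z hz z' hz'))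

theorem HolderNormLE.const (c : F) (hS : UniqueDiffOn ℝ S) :
    HolderNormLE k α S (fun _ => c) ‖c‖ := by
  induction k generalizing F with
  | zero =>
    refine holderNormLE_zero.2 ⟨continuousOn_const, fun _ _ => le_rfl, fun z _ z' _ => ?_⟩
    simp; positivity
  | succ k ih =>
    refine (holderNormLE_succ hS).2 ⟨holderNormLE_zero.2 ⟨continuousOn_const, fun _ _ => le_rfl,
      fun z _ z' _ => ?_⟩, differentiableOn_const c, ?_⟩
    · simp; positivity
    · have h := (ih (0 : E →L[ℝ] F)).mono_const (C' := ‖c‖) (by simp)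
      exact h.congr fun z hz => by simp

/-- Leibniz rule by induction on `k`: the differential of `B(f, g)` is a sum of two bilinear
expressions with forms `B.precompR` and `B.precompL`, so `B` and its spaces must vary in the
induction. `K` depends on `B` and `k` only; uniformity in `S` allows the sets to be the rescaled
balls about points running to infinity. -/
theorem HolderNormLE.bilin (B : F →L[ℝ] G →L[ℝ] W) (k : ℕ) :
    ∃ K : ℝ, 0 ≤ K ∧ ∀ (S : Set E) (_ : UniqueDiffOn ℝ S) (α : ℝ) (f : E → F) (g : E → G) (C D : ℝ),
      0 ≤ C → 0 ≤ D → HolderNormLE k α S f C → HolderNormLE k α S g D →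
      HolderNormLE k α S (fun z => B (f z) (g z)) (K * (C * D)) := by
  have zero : ∀ {F G W : Type} [NormedAddCommGroup F] [NormedSpace ℝ F] [NormedAddCommGroup G]
      [NormedSpace ℝ G] [NormedAddCommGroup W] [NormedSpace ℝ W] (B : F →L[ℝ] G →L[ℝ] W)
      (S : Set E) (α : ℝ) (f : E → F) (g : E → G) (C D : ℝ),
      0 ≤ C → 0 ≤ D → HolderNormLE 0 α S f C → HolderNormLE 0 α S g D →
      HolderNormLE 0 α S (fun z => B (f z) (g z)) (2 * ‖B‖ * (C * D)) := by
    intro F G W _ _ _ _ _ _ B S α f g C D hC hD hf hg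
    obtain ⟨f1, f2, f3⟩ := holderNormLE_zero.1 hf
    obtain ⟨g1, g2, g3⟩ := holderNormLE_zero.1 hg
    refine holderNormLE_zero.2 ⟨(B.continuous.comp_continuousOn f1).clm_apply g1,
      fun z hz => ?_, fun z hz z' hz' => ?_⟩
    · calc ‖B (f z) (g z)‖ ≤ ‖B‖ * ‖f z‖ * ‖g z‖ := B.le_opNorm₂ _ _
        _ ≤ ‖B‖ * C * D := by gcongr; exacts [f2 z hz, g2 z hz]
        _ ≤ 2 * ‖B‖ * (C * D) := by nlinarith [mul_nonneg (norm_nonneg B) (mul_nonneg hC hD)]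
    · have e : B (f z) (g z) - B (f z') (g z') = B (f z - f z') (g z) + B (f z') (g z - g z') := by
        simp
      rw [e]
      set t := ‖z - z'‖ ^ α with ht
      have htn : 0 ≤ t := by positivity
      calc _ ≤ ‖B (f z - f z') (g z)‖ + ‖B (f z') (g z - g z')‖ := norm_add_le _ _
        _ ≤ ‖B‖ * ‖f z - f z'‖ * ‖g z‖ + ‖B‖ * ‖f z'‖ * ‖g z - g z'‖ :=
          add_le_add (B.le_opNorm₂ _ _) (B.le_opNorm₂ _ _)
        _ ≤ ‖B‖ * (C * t) * D + ‖B‖ * C * (D * t) := by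
          gcongr
          exacts [f3 z hz z' hz', g2 z hz, f2 z' hz', g3 z hz z' hz']
        _ = _ := by ring
  induction k generalizing F G W with
  | zero => exact ⟨2 * ‖B‖, by positivity, fun S _ α f g C D hC hD hf hg => zero B S α f g C D hC hD hf hg⟩
  | succ k ih =>
    obtain ⟨K1, hK1, h1⟩ := ih (B.precompR E)
    obtain ⟨K2, hK2, h2⟩ := ih (B.precompL E)
    refine ⟨2 * ‖B‖ + (K1 + K2), by positivity, fun S hS α f g C D hC hD hf hg => ?_⟩
    have hCD := mul_nonneg hC hD
    have hdf := ((holderNormLE_succ hS).1 hf).2.1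
    have hdg := ((holderNormLE_succ hS).1 hg).2.1
    refine (holderNormLE_succ hS).2 ⟨?_, fun z hz => ?_, ?_⟩
    · refine (zero B S α f g C D hC hD (hf.of_le (by omega)) (hg.of_le (by omega))).mono_const ?_
      nlinarith [mul_nonneg hK1 hCD, mul_nonneg hK2 hCD]
    · exact (B.hasFDerivWithinAt_of_bilinear (hdf z hz).hasFDerivWithinAt
        (hdg z hz).hasFDerivWithinAt).differentiableWithinAt
    · have h3 := (h1 S hS α f _ C D hC hD (hf.of_le (by omega)) (hg.fderivWithin hS)).add
        (h2 S hS α _ g C D hC hD (hf.fderivWithin hS) (hg.of_le (by omega))) hS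
      refine (h3.congr fun z hz => ?_).mono_const ?_
      · exact B.fderivWithin_of_bilinear (hdf z hz) (hdg z hz) (hS z hz)
      · nlinarith [norm_nonneg B, mul_nonneg (norm_nonneg B) hCD]

theorem HolderNormLE.clm_comp (L : F →L[ℝ] G) {f : E → F} {C : ℝ} (hf : HolderNormLE k α S f C)
    (hS : UniqueDiffOn ℝ S) : HolderNormLE k α S (fun z => L (f z)) (‖L‖ * C) := by
  have key : ∀ j ≤ k, ∀ z ∈ S, iteratedFDerivWithin ℝ j (fun z => L (f z)) S z
      = L.compContinuousMultilinearMap (iteratedFDerivWithin ℝ j f S z) := fun j hj z hz =>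
    L.iteratedFDerivWithin_comp_left (hf.1 z hz) hS hz (by exact_mod_cast hj)
  refine ⟨L.contDiff.comp_contDiffOn hf.1, fun j hj => ⟨fun z hz => ?_, fun z hz z' hz' => ?_⟩⟩
  · rw [key j hj z hz]
    exact (L.norm_compContinuousMultilinearMap_le _).trans (by gcongr; exact (hf.2 j hj).1 z hz)
  · rw [key j hj z hz, key j hj z' hz']
    have : L.compContinuousMultilinearMap (iteratedFDerivWithin ℝ j f S z) -
        L.compContinuousMultilinearMap (iteratedFDerivWithin ℝ j f S z') =
        L.compContinuousMultilinearMap (iteratedFDerivWithin ℝ j f S z -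
          iteratedFDerivWithin ℝ j f S z') := by
      ext; simp
    rw [this, mul_assoc]
    exact (L.norm_compContinuousMultilinearMap_le _).trans
      (by gcongr; exact (hf.2 j hj).2 z hz z' hz')

/-- Induction on `k` through `d(1/f) = -f⁻² df`. As in `HolderNormLE.bilin`, the constant is
independent of `S`. -/
theorem HolderNormLE.inv (k : ℕ) {C c : ℝ} (hC : 0 ≤ C) (hc : 0 < c) :
    ∃ K : ℝ, 0 ≤ K ∧ ∀ (S : Set E) (_ : UniqueDiffOn ℝ S) (α : ℝ) (f : E → ℝ),
      (∀ z ∈ S, c ≤ |f z|) → HolderNormLE k α S f C →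
      HolderNormLE k α S (fun z => (f z)⁻¹) K := by
  have zero : ∀ (S : Set E) (α : ℝ) (f : E → ℝ),
      (∀ z ∈ S, c ≤ |f z|) → HolderNormLE 0 α S f C →
      HolderNormLE 0 α S (fun z => (f z)⁻¹) (c⁻¹ + c⁻¹ * C * c⁻¹) := by
    intro S α f hl hf
    obtain ⟨f1, f2, f3⟩ := holderNormLE_zero.1 hf
    have hne : ∀ z ∈ S, f z ≠ 0 := fun z hz h0 => by
      have := hl z hz; rw [h0, abs_zero] at this; linarith
    have hb : ∀ z ∈ S, |(f z)⁻¹| ≤ c⁻¹ := fun z hz => by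
      rw [abs_inv]; exact inv_anti₀ hc (hl z hz)
    refine holderNormLE_zero.2 ⟨f1.inv₀ hne, fun z hz => ?_, fun z hz z' hz' => ?_⟩
    · exact (hb z hz).trans (le_add_of_nonneg_right (by positivity))
    · have e : (f z)⁻¹ - (f z')⁻¹ = (f z)⁻¹ * (f z' - f z) * (f z')⁻¹ := by
        field_simp [hne z hz, hne z' hz']
      rw [e, Real.norm_eq_abs, abs_mul, abs_mul]
      have h3 : |f z' - f z| ≤ C * ‖z - z'‖ ^ α := by
        rw [abs_sub_comm]; exact f3 z hz z' hz'
      calc _ ≤ c⁻¹ * (C * ‖z - z'‖ ^ α) * c⁻¹ := by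
            gcongr
            exacts [hb z hz, hb z' hz']
        _ = (c⁻¹ * C * c⁻¹) * ‖z - z'‖ ^ α := by ring
        _ ≤ _ := by gcongr; exact le_add_of_nonneg_left (by positivity)
  induction k with
  | zero => exact ⟨_, by positivity, fun S _ => zero S⟩
  | succ k ih =>
    obtain ⟨K, hK, h⟩ := ih
    obtain ⟨K1, hK1, h1⟩ := HolderNormLE.bilin (E := E) (ContinuousLinearMap.mul ℝ ℝ) k
    obtain ⟨K2, hK2, h2⟩ := HolderNormLE.bilin (E := E)
      (ContinuousLinearMap.lsmul ℝ ℝ : ℝ →L[ℝ] (E →L[ℝ] ℝ) →L[ℝ] _) k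
    have hK3 : 0 ≤ K2 * (K1 * (K * K) * C) := by positivity
    refine ⟨(c⁻¹ + c⁻¹ * C * c⁻¹) + ‖-ContinuousLinearMap.id ℝ (E →L[ℝ] ℝ)‖ *
      (K2 * (K1 * (K * K) * C)), by positivity, fun S hS α f hl hf => ?_⟩
    have hne : ∀ z ∈ S, f z ≠ 0 := fun z hz h0 => by
      have := hl z hz; rw [h0, abs_zero] at this; linarith
    have hdf := ((holderNormLE_succ hS).1 hf).2.1
    refine (holderNormLE_succ hS).2 ⟨?_, hdf.inv hne, ?_⟩
    · exact (zero S α f hl (hf.of_le (by omega))).mono_const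
        (le_add_of_nonneg_right (by positivity))
    · have hi := h S hS α f hl (hf.of_le (by omega))
      have h3 := h2 S hS α _ _ _ _ (by positivity) hC (h1 S hS α _ _ K K hK hK hi hi)
        (hf.fderivWithin hS)
      refine ((h3.clm_comp (-ContinuousLinearMap.id ℝ (E →L[ℝ] ℝ)) hS).congr fun z hz => ?_).mono_const
        (le_add_of_nonneg_left (by positivity))
      have := (((hasDerivAt_inv (hne z hz)).comp_hasFDerivWithinAt z
        (hdf z hz).hasFDerivWithinAt)).fderivWithin (hS z hz)
      simp only [Function.comp_def] at this
      rw [this]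
      ext v
      simp only [map_smul, ContinuousLinearMap.mul_apply', ContinuousLinearMap.lsmul_apply,
        neg_apply, ContinuousLinearMap.id_apply, smul_apply,
        smul_eq_mul]
      have := hne z hz
      field_simp

/-- A Hölder bound with some constant. -/
def BddHolder (k : ℕ) (α : ℝ) (S : Set E) (f : E → F) : Prop := ∃ C, HolderNormLE k α S f C

theorem BddHolder.exists_nonneg {f : E → F} (h : BddHolder k α S f) :
    ∃ C, 0 ≤ C ∧ HolderNormLE k α S f C := by
  obtain ⟨C, hC⟩ := h
  exact ⟨max C 0, le_max_right _ _, hC.mono_const (le_max_left _ _)⟩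

theorem BddHolder.of_le {f : E → F} {l : ℕ} (h : BddHolder k α S f) (hl : l ≤ k) :
    BddHolder l α S f := h.imp fun _ hC => hC.of_le hl

theorem BddHolder.congr {f g : E → F} (h : BddHolder k α S f) (hfg : EqOn g f S) :
    BddHolder k α S g := h.imp fun _ hC => hC.congr hfg

theorem BddHolder.mono_set {f : E → F} {S' : Set E} (h : BddHolder k α S f)
    (hS' : S' ⊆ S) (h1 : UniqueDiffOn ℝ S') (h2 : UniqueDiffOn ℝ S) : BddHolder k α S' f :=
  h.imp fun _ hC => hC.mono_set hS' h1 h2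

theorem BddHolder.contDiffOn {f : E → F} (h : BddHolder k α S f) : ContDiffOn ℝ k f S :=
  h.choose_spec.1

theorem BddHolder.exists_bound {f : E → F} (h : BddHolder k α S f) :
    ∃ C, ∀ z ∈ S, ‖f z‖ ≤ C := by
  obtain ⟨C, hC⟩ := h
  exact ⟨C, (holderNormLE_zero.1 (hC.of_le (Nat.zero_le k))).2.1⟩

theorem BddHolder.add {f g : E → F} (hf : BddHolder k α S f) (hg : BddHolder k α S g)
    (hS : UniqueDiffOn ℝ S) : BddHolder k α S (fun z => f z + g z) := by
  obtain ⟨C, hC⟩ := hf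
  obtain ⟨D, hD⟩ := hg
  exact ⟨_, hC.add hD hS⟩

theorem BddHolder.const (c : F) (hS : UniqueDiffOn ℝ S) :
    BddHolder k α S (fun _ => c) := ⟨_, HolderNormLE.const c hS⟩

theorem BddHolder.clm_comp (L : F →L[ℝ] G) {f : E → F} (hf : BddHolder k α S f)
    (hS : UniqueDiffOn ℝ S) : BddHolder k α S (fun z => L (f z)) :=
  let ⟨_, hC⟩ := hf
  ⟨_, hC.clm_comp L hS⟩

theorem BddHolder.bilin (B : F →L[ℝ] G →L[ℝ] W) {f : E → F} {g : E → G} (hf : BddHolder k α S f)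
    (hg : BddHolder k α S g) (hS : UniqueDiffOn ℝ S) :
    BddHolder k α S (fun z => B (f z) (g z)) := by
  obtain ⟨C, hC, hf⟩ := hf.exists_nonneg
  obtain ⟨D, hD, hg⟩ := hg.exists_nonneg
  obtain ⟨K, -, h⟩ := HolderNormLE.bilin (E := E) B k
  exact ⟨_, h S hS α f g C D hC hD hf hg⟩

theorem BddHolder.mul {f g : E → ℝ} (hf : BddHolder k α S f) (hg : BddHolder k α S g)
    (hS : UniqueDiffOn ℝ S) : BddHolder k α S (fun z => f z * g z) :=
  hf.bilin (ContinuousLinearMap.mul ℝ ℝ) hg hS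

theorem BddHolder.smul {f : E → ℝ} {g : E → F} (hf : BddHolder k α S f) (hg : BddHolder k α S g)
    (hS : UniqueDiffOn ℝ S) : BddHolder k α S (fun z => f z • g z) :=
  hf.bilin (ContinuousLinearMap.lsmul ℝ ℝ : ℝ →L[ℝ] F →L[ℝ] F) hg hS

theorem BddHolder.neg {f : E → F} (hf : BddHolder k α S f) (hS : UniqueDiffOn ℝ S) :
    BddHolder k α S (fun z => -f z) := hf.clm_comp (-ContinuousLinearMap.id ℝ F) hS

theorem BddHolder.sub {f g : E → F} (hf : BddHolder k α S f) (hg : BddHolder k α S g)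
    (hS : UniqueDiffOn ℝ S) : BddHolder k α S (fun z => f z - g z) := by
  simpa only [sub_eq_add_neg] using hf.add (hg.neg hS) hS

theorem BddHolder.sum {ι : Type*} (s : Finset ι) {f : ι → E → F} (hS : UniqueDiffOn ℝ S)
    (hf : ∀ i ∈ s, BddHolder k α S (f i)) :
    BddHolder k α S (fun z => ∑ i ∈ s, f i z) := by
  classical
  induction s using Finset.induction_on with
  | empty => simpa using BddHolder.const (0 : F) hS
  | insert a s ha ih =>
    simp only [Finset.sum_insert ha]
    exact (hf a (by simp)).add (ih fun i hi => hf i (by simp [hi])) hS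

theorem BddHolder.prod {ι : Type*} (s : Finset ι) {f : ι → E → ℝ} (hS : UniqueDiffOn ℝ S)
    (hf : ∀ i ∈ s, BddHolder k α S (f i)) :
    BddHolder k α S (fun z => ∏ i ∈ s, f i z) := by
  classical
  induction s using Finset.induction_on with
  | empty => simpa using BddHolder.const (1 : ℝ) hS
  | insert a s ha ih =>
    simp only [Finset.prod_insert ha]
    exact (hf a (by simp)).mul (ih fun i hi => hf i (by simp [hi])) hS

theorem BddHolder.inv {f : E → ℝ} {c : ℝ} (hf : BddHolder k α S f) (hS : UniqueDiffOn ℝ S)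
    (hc : 0 < c) (hl : ∀ z ∈ S, c ≤ |f z|) : BddHolder k α S (fun z => (f z)⁻¹) := by
  obtain ⟨C, hC, hf⟩ := hf.exists_nonneg
  obtain ⟨K, -, h⟩ := HolderNormLE.inv (E := E) k hC hc
  exact ⟨K, h S hS α f hl hf⟩

theorem BddHolder.fderivWithin {f : E → F} (hf : BddHolder (k + 1) α S f)
    (hS : UniqueDiffOn ℝ S) : BddHolder k α S (fderivWithin ℝ f S) :=
  hf.imp fun _ hC => hC.fderivWithin hS

end Holder

/-! ### Geometry of the ball model -/

section Ball

variable {n : ℕ}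

theorem rho_pos {x : Euc n} (hx : ‖x‖ < 1) : 0 < rho x := by
  unfold rho; nlinarith [norm_nonneg x]

theorem rho_le_half (x : Euc n) : rho x ≤ 1 / 2 := by
  unfold rho; nlinarith [sq_nonneg ‖x‖]

theorem rho_continuous : Continuous (rho : Euc n → ℝ) := by
  unfold rho; fun_prop

theorem sinh_hypDist_half {x y : Euc n} :
    Real.sinh (hypDist x y / 2) = ‖x - y‖ / Real.sqrt ((1 - ‖x‖ ^ 2) * (1 - ‖y‖ ^ 2)) := by
  unfold hypDist
  rw [mul_div_cancel_left₀ _ two_ne_zero, Real.sinh_arsinh]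

theorem hypDist_zero_left (x : Euc n) :
    Real.sinh (hypDist 0 x / 2) = ‖x‖ / Real.sqrt (1 - ‖x‖ ^ 2) := by
  rw [sinh_hypDist_half]; simp

theorem cosh_hypDist_zero_left {x : Euc n} (hx : ‖x‖ < 1) :
    Real.cosh (hypDist 0 x / 2) = 1 / Real.sqrt (1 - ‖x‖ ^ 2) := by
  have h1 : 0 < 1 - ‖x‖ ^ 2 := by nlinarith [norm_nonneg x]
  have hs := Real.sqrt_pos.2 h1
  have hsq := Real.sq_sqrt h1.le
  have h := Real.cosh_sq (hypDist 0 x / 2)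
  rw [hypDist_zero_left] at h
  have h2 : Real.cosh (hypDist 0 x / 2) ^ 2 = (1 / Real.sqrt (1 - ‖x‖ ^ 2)) ^ 2 := by
    rw [h, div_pow, div_pow, hsq]; field_simp; ring
  exact (pow_left_inj₀ (Real.cosh_pos _).le (by positivity) two_ne_zero).1 h2

/-- This turns hyperbolic balls about the origin into Euclidean ones, with radius `tanh (R / 2)`. -/
theorem tanh_hypDist_zero_left {x : Euc n} (hx : ‖x‖ < 1) :
    Real.tanh (hypDist 0 x / 2) = ‖x‖ := by
  have h1 : 0 < 1 - ‖x‖ ^ 2 := by nlinarith [norm_nonneg x]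
  have hs := Real.sqrt_pos.2 h1
  rw [Real.tanh_eq_sinh_div_cosh, hypDist_zero_left, cosh_hypDist_zero_left hx]
  field_simp

theorem mem_hypExterior {R : ℝ} {x : Euc n} :
    x ∈ hypExterior n R ↔ Real.tanh (R / 2) < ‖x‖ ∧ ‖x‖ < 1 := by
  unfold hypExterior
  rw [mem_ofPred_eq, and_comm]
  refine and_congr_left fun hx => ?_
  rw [← tanh_hypDist_zero_left hx, ← Real.artanh_lt_artanh_iff (Real.tanh_bijOn.mapsTo trivial)
    (Real.tanh_bijOn.mapsTo trivial), Real.artanh_tanh, Real.artanh_tanh]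
  constructor <;> intro h <;> linarith

theorem isOpen_hypExterior (R : ℝ) : IsOpen (hypExterior n R) := by
  have : hypExterior n R = {x | Real.tanh (R / 2) < ‖x‖} ∩ {x | ‖x‖ < 1} := by
    ext x; exact mem_hypExterior
  rw [this]
  exact (isOpen_lt continuous_const continuous_norm).inter
    (isOpen_lt continuous_norm continuous_const)

theorem hypExterior_anti {R R' : ℝ} (h : R ≤ R') : hypExterior n R' ⊆ hypExterior n R :=
  fun _ hx => ⟨hx.1, h.trans_lt hx.2⟩

/-- Only triangles with a vertex at the origin are needed. There the addition formula for `sinh`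
reduces the claim to `‖x‖ - ‖y‖ ≤ ‖x - y‖`. -/
theorem hypDist_triangle {x y : Euc n} (hx : ‖x‖ < 1) (hy : ‖y‖ < 1) :
    hypDist 0 x ≤ hypDist 0 y + hypDist x y := by
  have h1 : 0 < 1 - ‖x‖ ^ 2 := by nlinarith [norm_nonneg x]
  have h2 : 0 < 1 - ‖y‖ ^ 2 := by nlinarith [norm_nonneg y]
  have hs := Real.sqrt_pos.2 h1
  have hs' := Real.sqrt_pos.2 h2
  suffices h : hypDist 0 x / 2 - hypDist 0 y / 2 ≤ hypDist x y / 2 by linarith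
  rw [← Real.sinh_le_sinh, Real.sinh_sub, sinh_hypDist_half (x := x), hypDist_zero_left, hypDist_zero_left,
    cosh_hypDist_zero_left hx, cosh_hypDist_zero_left hy, Real.sqrt_mul h1.le]
  have : ‖x‖ / √(1 - ‖x‖ ^ 2) * (1 / √(1 - ‖y‖ ^ 2)) - 1 / √(1 - ‖x‖ ^ 2) * (‖y‖ / √(1 - ‖y‖ ^ 2))
      = (‖x‖ - ‖y‖) / (√(1 - ‖x‖ ^ 2) * √(1 - ‖y‖ ^ 2)) := by
    field_simp
  rw [this]
  gcongr
  exact norm_sub_norm_le x y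

/-- The unit geodesic ball about `x` in the rescaled coordinate `z`, `y = x + ρ(x) z`. -/
def hypPiece (x : Euc n) : Set (Euc n) := {z | x + rho x • z ∈ hypBall x 1}

theorem isOpen_hypPiece {x : Euc n} (hx : ‖x‖ < 1) : IsOpen (hypPiece x) := by
  have h1 : 0 < 1 - ‖x‖ ^ 2 := by nlinarith [norm_nonneg x]
  have hb : IsOpen {y : Euc n | ‖y‖ < 1} := isOpen_lt continuous_norm continuous_const
  have hc : ContinuousOn (fun y : Euc n => hypDist x y) {y | ‖y‖ < 1} := by
    unfold hypDist
    refine continuousOn_const.mul (Real.continuous_arsinh.comp_continuousOn ?_)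
    refine ContinuousOn.div (by fun_prop) (by fun_prop) fun y hy => ?_
    have h2 : 0 < 1 - ‖y‖ ^ 2 := by
      have : ‖y‖ < 1 := hy
      nlinarith [norm_nonneg y]
    exact (Real.sqrt_pos.2 (mul_pos h1 h2)).ne'
  have : IsOpen (hypBall x 1) := hc.isOpen_inter_preimage hb isOpen_Iio
  exact this.preimage (by fun_prop)

theorem zero_mem_hypPiece {x : Euc n} (hx : ‖x‖ < 1) : (0 : Euc n) ∈ hypPiece x := by
  simp [hypPiece, hypBall, hx, hypDist]

/-- By definition of the distance, `‖x - y‖² = 4 sinh²(d/2) ρ(x) ρ(y)`. The constant `4/3` comes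
from `sinh²(1/2) = (cosh 1 - 1)/2 < 1/3`. -/
theorem sq_dist_lt_of_hypDist_lt {x y : Euc n} (hx : ‖x‖ < 1) (hy : ‖y‖ < 1)
    (h : hypDist x y < 1) : ‖x - y‖ ^ 2 < (4 / 3) * (rho x * rho y) := by
  have h1 : 0 < 1 - ‖x‖ ^ 2 := by nlinarith [norm_nonneg x]
  have h2 : 0 < 1 - ‖y‖ ^ 2 := by nlinarith [norm_nonneg y]
  have hs := Real.sqrt_pos.2 (mul_pos h1 h2)
  have hlt : Real.sinh (hypDist x y / 2) < Real.sinh (1 / 2) := by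
    rw [Real.sinh_lt_sinh]; linarith
  have hb : Real.sinh (1 / 2) ^ 2 < 1 / 3 := by
    have h3 : Real.cosh 1 = 2 * Real.sinh (1 / 2) ^ 2 + 1 := by
      have := Real.cosh_two_mul (1 / 2)
      have h4 := Real.cosh_sq (1 / 2)
      norm_num at this h4 ⊢
      linarith
    have h5 : Real.cosh 1 < 1.6 := by
      rw [Real.cosh_eq, Real.exp_neg]
      have h6 := Real.exp_one_lt_d9
      have h7 := Real.exp_one_gt_d9
      have h8 : (Real.exp 1)⁻¹ < 0.4 := by
        rw [inv_lt_comm₀ (by positivity) (by norm_num)]; norm_num; linarith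
      linarith
    linarith
  rw [sinh_hypDist_half, div_lt_iff₀ hs] at hlt
  have hx' : rho x * rho y = (1 - ‖x‖ ^ 2) * (1 - ‖y‖ ^ 2) / 4 := by unfold rho; ring
  rw [hx']
  have hsq := Real.sq_sqrt (mul_pos h1 h2).le
  have hp := mul_pos h1 h2
  calc ‖x - y‖ ^ 2 < (Real.sinh (1 / 2) * √((1 - ‖x‖ ^ 2) * (1 - ‖y‖ ^ 2))) ^ 2 := by gcongr
    _ = Real.sinh (1 / 2) ^ 2 * ((1 - ‖x‖ ^ 2) * (1 - ‖y‖ ^ 2)) := by rw [mul_pow, hsq]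
    _ ≤ _ := by nlinarith

theorem hypDist_comm (x y : Euc n) : hypDist x y = hypDist y x := by
  unfold hypDist; rw [norm_sub_rev, mul_comm (1 - ‖x‖ ^ 2)]

theorem abs_rho_sub_le {x y : Euc n} (hx : ‖x‖ < 1) (hy : ‖y‖ < 1) :
    |rho x - rho y| ≤ ‖x - y‖ := by
  have h : rho x - rho y = (‖y‖ - ‖x‖) * ((‖x‖ + ‖y‖) / 2) := by unfold rho; ring
  rw [h, abs_mul]
  have h1 : |‖y‖ - ‖x‖| ≤ ‖x - y‖ := by rw [norm_sub_rev]; exact abs_norm_sub_norm_le y x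
  have h2 : |(‖x‖ + ‖y‖) / 2| ≤ 1 := by
    rw [abs_of_nonneg (by positivity)]; linarith
  calc _ ≤ ‖x - y‖ * 1 := mul_le_mul h1 h2 (abs_nonneg _) (norm_nonneg _)
    _ = _ := mul_one _

/-- Harnack inequality for the weight on unit balls. If `ρ(y) > 3ρ(x)`, then `‖x - y‖² > (4/9)
ρ(y)²` because `ρ` is 1-Lipschitz, whereas `(4/3) ρ(x) ρ(y) < (4/9) ρ(y)²`. -/
theorem rho_comparable {x y : Euc n} (hx : ‖x‖ < 1) (hy : ‖y‖ < 1)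
    (h : hypDist x y < 1) : rho y ≤ 3 * rho x := by
  have h1 := sq_dist_lt_of_hypDist_lt hx hy h
  have h2 := abs_rho_sub_le hx hy
  have h3 := rho_pos hx
  have h4 := rho_pos hy
  by_contra! h5
  have h6 : rho y - rho x ≤ ‖x - y‖ := by
    rw [abs_sub_comm] at h2; exact (le_abs_self _).trans h2
  have h7 : (rho y - rho x) ^ 2 ≤ ‖x - y‖ ^ 2 := by
    apply pow_le_pow_left₀ (by linarith) h6
  nlinarith

theorem norm_lt_two_of_mem_hypPiece {x z : Euc n} (hx : ‖x‖ < 1) (hz : z ∈ hypPiece x) :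
    ‖z‖ < 2 := by
  obtain ⟨hy, hd⟩ := hz
  have h1 := sq_dist_lt_of_hypDist_lt hx hy hd
  have h2 := rho_comparable hx hy hd
  have h3 := rho_pos hx
  have h4 : ‖x - (x + rho x • z)‖ = rho x * ‖z‖ := by
    rw [sub_add_cancel_left, norm_neg, norm_smul, Real.norm_eq_abs, abs_of_pos h3]
  rw [h4] at h1
  have h5 : (rho x * ‖z‖) ^ 2 < (rho x * 2) ^ 2 := by nlinarith
  have h6 := lt_of_pow_lt_pow_left₀ 2 (by positivity) h5
  exact lt_of_mul_lt_mul_left h6 h3.le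

theorem mem_hypExterior_of_mem_hypPiece {x z : Euc n} {R : ℝ} (hx : x ∈ hypExterior n (R + 1))
    (hz : z ∈ hypPiece x) : x + rho x • z ∈ hypExterior n R := by
  have h := hypDist_triangle hx.1 hz.1
  have h1 := hz.2
  have h2 := hx.2
  exact ⟨hz.1, by linarith⟩

/-- The ratio `ρ(y) / ρ(x)` in the rescaled coordinate. -/
theorem rho_add_smul (x z : Euc n) :
    rho (x + rho x • z) = rho x * (1 - inner ℝ x z - rho x / 2 * inner ℝ z z) := by
  have h : ‖x + rho x • z‖ ^ 2 = ‖x‖ ^ 2 + 2 * (rho x * inner ℝ x z) + rho x ^ 2 * inner ℝ z z := by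
    rw [norm_add_sq_real, inner_smul_right, norm_smul, mul_pow, Real.norm_eq_abs, sq_abs,
      real_inner_self_eq_norm_sq]
  unfold rho at *
  rw [h]; ring

end Ball

/-! ### Functions of given order at infinity -/

section Asymptotics

variable {n : ℕ}

/-- The filter of neighbourhoods of the sphere at infinity. -/
def far (n : ℕ) : Filter (Euc n) := comap (fun x => ‖x‖) (𝓝[<] 1)

theorem eventually_far_iff_norm {p : Euc n → Prop} :
    (∀ᶠ x in far n, p x) ↔ ∃ r, 0 < r ∧ r < 1 ∧ ∀ x, r < ‖x‖ → ‖x‖ < 1 → p x := by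
  unfold far
  rw [eventually_comap]
  constructor
  · intro h
    obtain ⟨l, hl, hl'⟩ := (mem_nhdsLT_iff_exists_Ioo_subset (a := (1 : ℝ))).1 h
    refine ⟨max l (1 / 2), by positivity, max_lt hl (by norm_num), fun x hx hx' => ?_⟩
    exact hl' ⟨(le_max_left _ _).trans_lt hx, hx'⟩ x rfl
  · rintro ⟨r, hr0, hr, h⟩
    refine mem_of_superset (Ioo_mem_nhdsLT hr) ?_
    rintro a ⟨ha, ha'⟩ x rfl
    exact h x ha ha'

theorem eventually_far_iff {p : Euc n → Prop} :
    (∀ᶠ x in far n, p x) ↔ ∃ R, 0 < R ∧ ∀ x ∈ hypExterior n R, p x := by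
  rw [eventually_far_iff_norm]
  constructor
  · rintro ⟨r, hr0, hr, h⟩
    refine ⟨2 * Real.artanh r, by have := Real.artanh_pos ⟨hr0, hr⟩; positivity, fun x hx => ?_⟩
    rw [mem_hypExterior, mul_div_cancel_left₀ _ two_ne_zero,
      Real.tanh_artanh ⟨by linarith, hr⟩] at hx
    exact h x hx.1 hx.2
  · rintro ⟨R, hR, h⟩
    have ht := Real.tanh_bijOn.mapsTo (mem_univ (R / 2))
    refine ⟨Real.tanh (R / 2), ?_, ht.2, fun x hx hx' => h x (mem_hypExterior.2 ⟨hx, hx'⟩)⟩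
    rw [Real.tanh_eq_sinh_div_cosh]
    exact div_pos (Real.sinh_pos_iff.2 (by linarith)) (Real.cosh_pos _)

theorem eventually_far_mem (R : ℝ) : ∀ᶠ x in far n, x ∈ hypExterior n R :=
  eventually_far_iff.2 ⟨max R 1, by positivity, fun _ hx => hypExterior_anti (le_max_left _ _) hx⟩

theorem eventually_far_norm_lt : ∀ᶠ x in far n, ‖x‖ < 1 :=
  (eventually_far_mem 0).mono fun _ hx => hx.1

/-- A unit ball whose centre is at distance more than `R + 1` from the origin stays outside radius
`R`. Conditions near infinity may therefore be used at every point of the piece. -/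
theorem eventually_far_piece {p : Euc n → Prop} (h : ∀ᶠ x in far n, p x) :
    ∀ᶠ x in far n, ∀ z ∈ hypPiece x, p (x + rho x • z) := by
  obtain ⟨R, -, h⟩ := eventually_far_iff.1 h
  filter_upwards [eventually_far_mem (R + 1)] with x hx z hz
  exact h _ (mem_hypExterior_of_mem_hypPiece hx hz)

theorem eventually_far_nhds {p : Euc n → Prop} (h : ∀ᶠ x in far n, p x) :
    ∀ᶠ x in far n, ∀ᶠ y in 𝓝 x, p y := by
  obtain ⟨R, -, h⟩ := eventually_far_iff.1 h
  filter_upwards [eventually_far_mem R] with x hx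
  exact mem_of_superset ((isOpen_hypExterior R).mem_nhds hx) h

variable {F G W : Type} [NormedAddCommGroup F] [NormedSpace ℝ F] [NormedAddCommGroup G]
  [NormedSpace ℝ G] [NormedAddCommGroup W] [NormedSpace ℝ W] {k : ℕ} {α s s' : ℝ}

/-- `T = O(ρ^s)` at infinity together with its derivatives of order at most `k` and their Hölder
quotients, in the rescaled coordinates. -/
def Asy (α : ℝ) (k : ℕ) (s : ℝ) (T : Euc n → F) : Prop :=
  ∃ C, 0 ≤ C ∧ ∀ᶠ x in far n,
    HolderNormLE k α (hypPiece x) (fun z => T (x + rho x • z)) (C * rho x ^ s)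

theorem HolderNormLE.const_smul {E : Type} [NormedAddCommGroup E] [NormedSpace ℝ E] {S : Set E}
    {f : E → F} {C : ℝ} (hf : HolderNormLE k α S f C)
    (hS : UniqueDiffOn ℝ S) (hC : 0 ≤ C) (c : ℝ) :
    HolderNormLE k α S (fun z => c • f z) (|c| * C) := by
  refine (hf.clm_comp (c • ContinuousLinearMap.id ℝ F) hS).mono_const ?_
  gcongr
  rw [norm_smul, Real.norm_eq_abs]
  exact mul_le_of_le_one_right (abs_nonneg _) ContinuousLinearMap.norm_id_le

/-- The factor `ρ(x)^m` does not depend on `z`, so it can be moved into the exponent. From here on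
tensors are treated as fields of Euclidean components; for instance `Ψ_* g - b` has order `τ - 2`.
-/
theorem WeightedHolder.asy {m : ℕ} {R : ℝ} {T : Euc n → F} (h : WeightedHolder m k α s R T) :
    Asy α k (s - m) T := by
  obtain ⟨C, h⟩ := h
  refine ⟨|C|, abs_nonneg C, ?_⟩
  filter_upwards [eventually_far_mem (R + 1)] with x hx
  have hρ := rho_pos hx.1
  have hO := (isOpen_hypPiece hx.1).uniqueDiffOn (𝕜 := ℝ)
  have h1 := ((h x hx).mono_const (C' := |C| * rho x ^ s)
    (by gcongr; exact le_abs_self C)).const_smul hO (by positivity) (rho x ^ m)⁻¹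
  refine (h1.congr fun z hz => ?_).mono_const (le_of_eq ?_)
  · rw [inv_smul_smul₀ (by positivity)]
  · rw [Real.rpow_sub hρ, Real.rpow_natCast, abs_of_pos (by positivity)]
    field_simp

theorem Asy.weightedHolder {T : Euc n → F} (h : Asy α k s T) (m : ℕ) :
    ∃ R, 0 < R ∧ ∀ R', R ≤ R' → WeightedHolder m k α (s + m) R' T := by
  obtain ⟨C, hC, h⟩ := h
  obtain ⟨R, hR, h⟩ := eventually_far_iff.1 h
  refine ⟨R, hR, fun R' hR' => ⟨C, fun x hx => ?_⟩⟩
  have hρ := rho_pos hx.1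
  have hO := (isOpen_hypPiece hx.1).uniqueDiffOn (𝕜 := ℝ)
  have h1 := (h x (hypExterior_anti (by linarith) hx)).const_smul hO (by positivity) (rho x ^ m)
  refine h1.mono_const (le_of_eq ?_)
  rw [Real.rpow_add hρ, Real.rpow_natCast, abs_of_pos (by positivity)]
  ring

theorem Asy.of_le {T : Euc n → F} {l : ℕ} (h : Asy α k s T) (hl : l ≤ k) : Asy α l s T :=
  let ⟨C, hC, h⟩ := h
  ⟨C, hC, h.mono fun _ hx => hx.of_le hl⟩

theorem Asy.congr {T T' : Euc n → F} (h : Asy α k s T) (hT : ∀ᶠ x in far n, T' x = T x) :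
    Asy α k s T' := by
  obtain ⟨C, hC, h⟩ := h
  refine ⟨C, hC, ?_⟩
  filter_upwards [h, eventually_far_piece hT] with x hx hx'
  exact hx.congr hx'

theorem Asy.mono {T : Euc n → F} (h : Asy α k s T) (hs : s' ≤ s) : Asy α k s' T := by
  obtain ⟨C, hC, h⟩ := h
  refine ⟨C, hC, ?_⟩
  filter_upwards [h, eventually_far_norm_lt] with x hx hx'
  refine hx.mono_const ?_
  refine mul_le_mul_of_nonneg_left ?_ hC
  exact Real.rpow_le_rpow_of_exponent_ge (rho_pos hx') (by linarith [rho_le_half x]) hs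

theorem Asy.add {T T' : Euc n → F} (h : Asy α k s T) (h' : Asy α k s T') :
    Asy α k s (fun x => T x + T' x) := by
  obtain ⟨C, hC, h⟩ := h
  obtain ⟨D, hD, h'⟩ := h'
  refine ⟨C + D, by positivity, ?_⟩
  filter_upwards [h, h', eventually_far_norm_lt] with x hx hx' hx1
  rw [add_mul]
  exact hx.add hx' (isOpen_hypPiece hx1).uniqueDiffOn

theorem Asy.clm_comp (L : F →L[ℝ] G) {T : Euc n → F} (h : Asy α k s T) :
    Asy α k s (fun x => L (T x)) := by
  obtain ⟨C, hC, h⟩ := h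
  refine ⟨‖L‖ * C, by positivity, ?_⟩
  filter_upwards [h, eventually_far_norm_lt] with x hx hx1
  rw [mul_assoc]
  exact hx.clm_comp L (isOpen_hypPiece hx1).uniqueDiffOn

theorem Asy.neg {T : Euc n → F} (h : Asy α k s T) : Asy α k s (fun x => -T x) :=
  h.clm_comp (-ContinuousLinearMap.id ℝ F)

theorem Asy.sub {T T' : Euc n → F} (h : Asy α k s T) (h' : Asy α k s T') :
    Asy α k s (fun x => T x - T' x) := by
  simpa only [sub_eq_add_neg] using h.add h'.neg

theorem Asy.bilin (B : F →L[ℝ] G →L[ℝ] W) {T : Euc n → F} {T' : Euc n → G} (h : Asy α k s T)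
    (h' : Asy α k s' T') : Asy α k (s + s') (fun x => B (T x) (T' x)) := by
  obtain ⟨C, hC, h⟩ := h
  obtain ⟨D, hD, h'⟩ := h'
  obtain ⟨K, hK, hB⟩ := HolderNormLE.bilin (E := Euc n) B k
  refine ⟨K * (C * D), by positivity, ?_⟩
  filter_upwards [h, h', eventually_far_norm_lt] with x hx hx' hx1
  have hρ := rho_pos hx1
  refine (hB _ (isOpen_hypPiece hx1).uniqueDiffOn α _ _ _ _ (by positivity) (by positivity)
    hx hx').mono_const (le_of_eq ?_)
  rw [Real.rpow_add hρ]; ring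

theorem Asy.mul {T T' : Euc n → ℝ} (h : Asy α k s T) (h' : Asy α k s' T') :
    Asy α k (s + s') (fun x => T x * T' x) := h.bilin (ContinuousLinearMap.mul ℝ ℝ) h'

theorem Asy.smul {T : Euc n → ℝ} {T' : Euc n → F} (h : Asy α k s T) (h' : Asy α k s' T') :
    Asy α k (s + s') (fun x => T x • T' x) :=
  h.bilin (ContinuousLinearMap.lsmul ℝ ℝ : ℝ →L[ℝ] F →L[ℝ] F) h'

theorem Asy.const (c : F) : Asy α k 0 (fun _ : Euc n => c) := by
  refine ⟨‖c‖, norm_nonneg c, ?_⟩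
  filter_upwards [eventually_far_norm_lt] with x hx1
  rw [Real.rpow_zero, mul_one]
  exact HolderNormLE.const c (isOpen_hypPiece hx1).uniqueDiffOn

theorem Asy.zero (s : ℝ) : Asy α k s (fun _ : Euc n => (0 : F)) := by
  refine ⟨0, le_rfl, ?_⟩
  filter_upwards [eventually_far_norm_lt] with x hx1
  rw [zero_mul, ← norm_zero (E := F)]
  exact HolderNormLE.const 0 (isOpen_hypPiece hx1).uniqueDiffOn

theorem Asy.const_mul {T : Euc n → ℝ} (c : ℝ) (h : Asy α k s T) : Asy α k s (fun x => c * T x) :=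
  h.clm_comp (ContinuousLinearMap.mul ℝ ℝ c)

theorem Asy.sum {ι : Type*} (A : Finset ι) {T : ι → Euc n → F}
    (h : ∀ i ∈ A, Asy α k s (T i)) : Asy α k s (fun x => ∑ i ∈ A, T i x) := by
  classical
  induction A using Finset.induction_on with
  | empty => simpa using Asy.zero s
  | insert a A ha ih =>
    simp only [Finset.sum_insert ha]
    exact (h a (by simp)).add (ih fun i hi => h i (by simp [hi]))

theorem Asy.prod {ι : Type*} (A : Finset ι) {T : ι → Euc n → ℝ}
    (h : ∀ i ∈ A, Asy α k 0 (T i)) : Asy α k 0 (fun x => ∏ i ∈ A, T i x) := by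
  classical
  induction A using Finset.induction_on with
  | empty => simpa using Asy.const (1 : ℝ)
  | insert a A ha ih =>
    simp only [Finset.prod_insert ha]
    simpa using (h a (by simp)).mul (ih fun i hi => h i (by simp [hi]))

theorem Asy.inv {T : Euc n → ℝ} {c : ℝ} (hc : 0 < c) (hl : ∀ᶠ x in far n, c ≤ |T x|)
    (h : Asy α k 0 T) : Asy α k 0 (fun x => (T x)⁻¹) := by
  obtain ⟨C, hC, h⟩ := h
  obtain ⟨K, hK, hI⟩ := HolderNormLE.inv (E := Euc n) k hC hc
  refine ⟨K, hK, ?_⟩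
  filter_upwards [h, eventually_far_piece hl, eventually_far_norm_lt] with x hx hx' hx1
  rw [Real.rpow_zero, mul_one] at hx ⊢
  exact hI _ (isOpen_hypPiece hx1).uniqueDiffOn α _ hx' hx

theorem Asy.eventually_norm_le {T : Euc n → F} (h : Asy α k s T) :
    ∃ C, 0 ≤ C ∧ ∀ᶠ x in far n, ‖T x‖ ≤ C * rho x ^ s := by
  obtain ⟨C, hC, h⟩ := h
  refine ⟨C, hC, ?_⟩
  filter_upwards [h, eventually_far_norm_lt] with x hx hx1
  -- The centre of the piece, `z = 0`, suffices for a pointwise bound.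
  have := (holderNormLE_zero.1 (hx.of_le (Nat.zero_le k))).2.1 0 (zero_mem_hypPiece hx1)
  simpa using this

theorem Asy.eventually_contDiffAt {T : Euc n → F} (h : Asy α k s T) :
    ∀ᶠ x in far n, ContDiffAt ℝ k T x := by
  obtain ⟨C, hC, h⟩ := h
  filter_upwards [h, eventually_far_norm_lt] with x hx hx1
  have hρ := rho_pos hx1
  have h0 := hx.1.contDiffAt ((isOpen_hypPiece hx1).mem_nhds (zero_mem_hypPiece hx1))
  have e : T = (fun z => T (x + rho x • z)) ∘ (fun y => (rho x)⁻¹ • (y - x)) := by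
    ext y; simp [smul_inv_smul₀ hρ.ne']
  rw [e]
  refine ContDiffAt.comp x (by simpa using h0) (by fun_prop)

theorem Asy.eventually_differentiableAt {T : Euc n → F} (h : Asy α (k + 1) s T) :
    ∀ᶠ x in far n, DifferentiableAt ℝ T x :=
  h.eventually_contDiffAt.mono fun _ hx => hx.differentiableAt (by simp)

/-- By the chain rule a derivative in `z` is `ρ(x)` times a derivative in `y = x + ρ(x) z`, so a
Euclidean derivative costs one power of `ρ`. -/
theorem Asy.fderiv {T : Euc n → F} (h : Asy α (k + 1) s T) : Asy α k (s - 1) (fderiv ℝ T) := by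
  have hd := eventually_far_piece h.eventually_differentiableAt
  obtain ⟨C, hC, h⟩ := h
  refine ⟨C, hC, ?_⟩
  filter_upwards [h, hd, eventually_far_norm_lt] with x hx hxd hx1
  have hρ := rho_pos hx1
  have hO := isOpen_hypPiece hx1
  have h1 := (hx.fderivWithin hO.uniqueDiffOn).const_smul hO.uniqueDiffOn (by positivity) (rho x)⁻¹
  refine (h1.congr fun z hz => ?_).mono_const (le_of_eq ?_)
  · have hin : HasFDerivAt (fun z : Euc n => x + rho x • z)
        (rho x • ContinuousLinearMap.id ℝ (Euc n)) z :=
      ((hasFDerivAt_id z).const_smul (rho x)).const_add x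
    have := ((hxd z hz).hasFDerivAt.comp z hin).fderiv
    rw [fderivWithin_of_isOpen hO hz]
    simp only [Function.comp_def] at this
    rw [this]
    ext v
    simp [hρ.ne']
  · rw [Real.rpow_sub hρ, Real.rpow_one, abs_of_pos (by positivity)]
    field_simp

theorem Asy.pd {T : Euc n → ℝ} (h : Asy α (k + 1) s T) (i : Fin n) :
    Asy α k (s - 1) (pd univ i T) := by
  have := h.fderiv.clm_comp (ContinuousLinearMap.apply ℝ ℝ (EuclideanSpace.single i (1 : ℝ)))
  refine this.congr (Eventually.of_forall fun x => ?_)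
  simp [AHJang.pd]

theorem HolderNormLE.id_of_norm_lt {S : Set (Euc n)} (hS : UniqueDiffOn ℝ S)
    (hα₀ : 0 ≤ α) (hα₁ : α ≤ 1) (hb : ∀ z ∈ S, ‖z‖ < 2) (k : ℕ) :
    HolderNormLE k α S (fun z => z) 4 := by
  have h0 : HolderNormLE 0 α S (fun z : Euc n => z) 4 := by
    refine holderNormLE_zero.2 ⟨continuousOn_id, fun z hz => by linarith [hb z hz],
      fun z hz z' hz' => ?_⟩
    rcases (norm_nonneg (z - z')).eq_or_lt with h | h
    · rw [← h]; positivity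
    -- A Lipschitz function on a set of diameter at most `4` is Hölder with constant `4^{1-α} ≤ 4`.
    · have h4 : ‖z - z'‖ ≤ 4 := (norm_sub_le _ _).trans (by linarith [hb z hz, hb z' hz'])
      calc ‖z - z'‖ = ‖z - z'‖ ^ (1 - α) * ‖z - z'‖ ^ α := by
            rw [← Real.rpow_add h]; simp
        _ ≤ 4 * ‖z - z'‖ ^ α := by
          gcongr
          calc ‖z - z'‖ ^ (1 - α) ≤ 4 ^ (1 - α) := by gcongr
            _ ≤ 4 ^ (1 : ℝ) := Real.rpow_le_rpow_of_exponent_le (by norm_num) (by linarith)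
            _ = 4 := Real.rpow_one 4
  rcases k with _ | k
  · exact h0
  · refine (holderNormLE_succ hS).2 ⟨h0, differentiableOn_id, ?_⟩
    refine ((HolderNormLE.const (ContinuousLinearMap.id ℝ (Euc n)) hS).congr
      fun z hz => fderivWithin_fun_id (hS z hz)).mono_const
      (ContinuousLinearMap.norm_id_le.trans (by norm_num))

theorem asy_id (hα₀ : 0 ≤ α) (hα₁ : α ≤ 1) : Asy α k 0 (fun x : Euc n => x) := by
  refine ⟨3, by norm_num, ?_⟩
  filter_upwards [eventually_far_norm_lt] with x hx1
  have hρ := rho_pos hx1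
  have hO := (isOpen_hypPiece hx1).uniqueDiffOn (𝕜 := ℝ)
  have h1 := (HolderNormLE.id_of_norm_lt hO hα₀ hα₁
    (fun z hz => norm_lt_two_of_mem_hypPiece hx1 hz) k).const_smul hO (by norm_num) (rho x)
  refine ((HolderNormLE.const x hO).add h1 hO).mono_const ?_
  rw [abs_of_pos hρ, Real.rpow_zero]
  linarith [rho_le_half x]

theorem asy_coord (hα₀ : 0 ≤ α) (hα₁ : α ≤ 1) (i : Fin n) : Asy α k 0 (fun x : Euc n => x i) :=
  (asy_id hα₀ hα₁).clm_comp (EuclideanSpace.proj i : Euc n →L[ℝ] ℝ)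

/-- The function is `ρ(y)/ρ(x)` by `rho_add_smul`. It is a quadratic polynomial in `z` whose
coefficients are bounded uniformly in `x`, on pieces contained in `‖z‖ < 2`. -/
theorem exists_ratio_bound (hα₀ : 0 ≤ α) (hα₁ : α ≤ 1) (k : ℕ) : ∃ C, 0 ≤ C ∧
    ∀ x : Euc n, ‖x‖ < 1 → HolderNormLE k α (hypPiece x)
      (fun z => (1 - inner ℝ x z - rho x / 2 * inner ℝ z z : ℝ)) C := by
  obtain ⟨K, hK, hB⟩ := HolderNormLE.bilin (E := Euc n) (innerSL ℝ : Euc n →L[ℝ] Euc n →L[ℝ] ℝ) k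
  refine ⟨‖(1 : ℝ)‖ + |(-1 : ℝ)| * (K * (1 * 4)) + 1 * (K * (4 * 4)), by positivity,
    fun x hx1 => ?_⟩
  have hρ := rho_pos hx1
  have hO := (isOpen_hypPiece hx1).uniqueDiffOn (𝕜 := ℝ)
  have hi := HolderNormLE.id_of_norm_lt hO hα₀ hα₁
    (fun z hz => norm_lt_two_of_mem_hypPiece hx1 hz) k
  have h1 := (hB _ hO α _ _ 1 4 (by norm_num) (by norm_num)
    ((HolderNormLE.const x hO).mono_const hx1.le) hi).const_smul hO (by positivity) (-1)
  have h2 := (hB _ hO α _ _ 4 4 (by norm_num) (by norm_num) hi hi).const_smul hO (by positivity)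
    (-(rho x / 2))
  refine ((((HolderNormLE.const (1 : ℝ) hO).add h1 hO).add h2 hO).congr
    fun z hz => ?_).mono_const ?_
  · change _ = 1 + (-1 : ℝ) * inner ℝ x z + -(rho x / 2) * inner ℝ z z
    ring
  · gcongr
    rw [abs_neg, abs_of_pos (by positivity)]
    linarith [rho_le_half x]

theorem asy_rho (hα₀ : 0 ≤ α) (hα₁ : α ≤ 1) : Asy α k 1 (rho : Euc n → ℝ) := by
  obtain ⟨C, hC, h⟩ := exists_ratio_bound (n := n) hα₀ hα₁ k
  refine ⟨C, hC, ?_⟩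
  filter_upwards [eventually_far_norm_lt] with x hx1
  have hρ := rho_pos hx1
  have hO := (isOpen_hypPiece hx1).uniqueDiffOn (𝕜 := ℝ)
  refine (((h x hx1).const_smul hO hC (rho x)).congr fun z hz => ?_).mono_const (le_of_eq ?_)
  · simp only [rho_add_smul, smul_eq_mul]
  · rw [abs_of_pos hρ, Real.rpow_one, mul_comm]

theorem asy_inv_rho (hα₀ : 0 ≤ α) (hα₁ : α ≤ 1) :
    Asy α k (-1) (fun x : Euc n => (rho x)⁻¹) := by
  obtain ⟨C, hC, h⟩ := exists_ratio_bound (n := n) hα₀ hα₁ k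
  obtain ⟨K, hK, hI⟩ := HolderNormLE.inv (E := Euc n) k hC (c := 1 / 3) (by norm_num)
  refine ⟨K, hK, ?_⟩
  filter_upwards [eventually_far_norm_lt] with x hx1
  have hρ := rho_pos hx1
  have hO := (isOpen_hypPiece hx1).uniqueDiffOn (𝕜 := ℝ)
  have h1 := hI _ hO α _ (fun z hz => ?_) (h x hx1)
  · refine ((h1.const_smul hO hK (rho x)⁻¹).congr fun z hz => ?_).mono_const (le_of_eq ?_)
    · simp only [rho_add_smul, smul_eq_mul, mul_inv]
    · rw [abs_of_pos (by positivity), Real.rpow_neg_one, mul_comm]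
  -- The lower bound `1/3` for the ratio is `rho_comparable` with the two points exchanged.
  · have hy : ‖x + rho x • z‖ < 1 := hz.1
    have hd : hypDist (x + rho x • z) x < 1 := by rw [hypDist_comm]; exact hz.2
    have h3 := rho_comparable hy hx1 hd
    rw [rho_add_smul] at h3
    refine le_trans ?_ (le_abs_self _)
    by_contra! h4
    nlinarith

end Asymptotics

/-! ### Partial derivatives in the ball -/

section PartialDerivatives

variable {n : ℕ} {F F' : Euc n → ℝ} {x : Euc n} {i j : Fin n}

theorem pd_univ (i : Fin n) (F : Euc n → ℝ) (x : Euc n) :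
    pd univ i F x = fderiv ℝ F x (EuclideanSpace.single i 1) := by
  simp [pd]

theorem pd_congr (h : F =ᶠ[𝓝 x] F') : pd univ i F x = pd univ i F' x := by
  rw [pd_univ, pd_univ, h.fderiv_eq]

theorem pd_add (h : DifferentiableAt ℝ F x) (h' : DifferentiableAt ℝ F' x) :
    pd univ i (fun y => F y + F' y) x = pd univ i F x + pd univ i F' x := by
  simp only [pd_univ]
  rw [fderiv_fun_add h h']; rfl

theorem pd_sub (h : DifferentiableAt ℝ F x) (h' : DifferentiableAt ℝ F' x) :
    pd univ i (fun y => F y - F' y) x = pd univ i F x - pd univ i F' x := by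
  simp only [pd_univ]
  rw [fderiv_fun_sub h h']; rfl

theorem pd_mul (h : DifferentiableAt ℝ F x) (h' : DifferentiableAt ℝ F' x) :
    pd univ i (fun y => F y * F' y) x = pd univ i F x * F' x + F x * pd univ i F' x := by
  simp only [pd_univ]
  rw [fderiv_fun_mul h h']
  simp; ring

theorem pd_const (c : ℝ) : pd univ i (fun _ : Euc n => c) x = 0 := by
  simp [pd_univ]

theorem pd_const_mul (c : ℝ) (h : DifferentiableAt ℝ F x) :
    pd univ i (fun y => c * F y) x = c * pd univ i F x := by
  rw [pd_mul (differentiableAt_const c) h, pd_const]; ring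

theorem pd_sum {ι : Type*} (A : Finset ι) {F : ι → Euc n → ℝ}
    (h : ∀ a ∈ A, DifferentiableAt ℝ (F a) x) :
    pd univ i (fun y => ∑ a ∈ A, F a y) x = ∑ a ∈ A, pd univ i (F a) x := by
  simp only [pd_univ]
  rw [fderiv_fun_sum h]
  simp

theorem pd_coord : pd univ i (fun y : Euc n => y j) x = if i = j then 1 else 0 := by
  rw [pd_univ]
  have : HasFDerivAt (fun y : Euc n => y j) (EuclideanSpace.proj j : Euc n →L[ℝ] ℝ) x :=
    (EuclideanSpace.proj j : Euc n →L[ℝ] ℝ).hasFDerivAt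
  rw [this.fderiv]
  simp [eq_comm]

theorem differentiableAt_coord : DifferentiableAt ℝ (fun y : Euc n => y j) x :=
  (EuclideanSpace.proj j : Euc n →L[ℝ] ℝ).differentiableAt

theorem differentiableAt_rho : DifferentiableAt ℝ (rho : Euc n → ℝ) x := by
  unfold rho
  have : DifferentiableAt ℝ (fun y : Euc n => ‖y‖ ^ 2) x := differentiableAt_id.norm_sq ℝ
  exact ((differentiableAt_const (1 : ℝ)).fun_sub this).fun_mul (differentiableAt_const ((2 : ℝ)⁻¹))

theorem pd_rho : pd univ i (rho : Euc n → ℝ) x = -x i := by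
  rw [pd_univ]
  have : HasFDerivAt (rho : Euc n → ℝ) (-(innerSL ℝ x)) x := by
    have h := ((hasStrictFDerivAt_norm_sq x).hasFDerivAt.const_sub 1).mul_const (1 / 2)
    refine (h.congr_of_eventuallyEq (Eventually.of_forall fun y => ?_)).congr_fderiv ?_
    · simp [rho]; ring
    · ext v; simp
  rw [this.fderiv]
  simp [EuclideanSpace.inner_single_right]

theorem differentiableAt_inv_rho (hx : ‖x‖ < 1) :
    DifferentiableAt ℝ (fun y : Euc n => (rho y)⁻¹) x :=
  differentiableAt_rho.inv (rho_pos hx).ne'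

theorem pd_inv_rho (hx : ‖x‖ < 1) :
    pd univ i (fun y : Euc n => (rho y)⁻¹) x = x i * (rho x)⁻¹ ^ 2 := by
  have h := pd_rho (i := i) (x := x)
  rw [pd_univ] at h ⊢
  have := ((hasDerivAt_inv (rho_pos hx).ne').comp_hasFDerivAt x
    (differentiableAt_rho (x := x)).hasFDerivAt).fderiv
  simp only [Function.comp_def] at this
  rw [this]
  simp [h]
  ring

theorem sum_sq_eq_rho (x : Euc n) : ∑ k, x k * x k = 1 - 2 * rho x := by
  have := EuclideanSpace.norm_sq_eq x
  unfold rho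
  rw [this]
  simp only [Real.norm_eq_abs, sq_abs, ← sq]
  ring

/-- Christoffel symbols of the hyperbolic metric. -/
def hypChr (k i j : Fin n) (x : Euc n) : ℝ :=
  ((if k = i then 1 else 0) * x j + (if k = j then 1 else 0) * x i
    - (if i = j then 1 else 0) * x k) * (rho x)⁻¹

theorem differentiableAt_hypChr (hx : ‖x‖ < 1) (k i j : Fin n) :
    DifferentiableAt ℝ (hypChr k i j) x := by
  unfold hypChr
  refine DifferentiableAt.mul ?_ (differentiableAt_inv_rho hx)
  exact (((differentiableAt_const _).fun_mul differentiableAt_coord).add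
    ((differentiableAt_const _).fun_mul differentiableAt_coord)).sub
    ((differentiableAt_const _).fun_mul differentiableAt_coord)

theorem pd_hypChr (hx : ‖x‖ < 1) (m k i j : Fin n) :
    pd univ m (hypChr k i j) x =
      ((if k = i then 1 else 0) * (if m = j then 1 else 0)
        + (if k = j then 1 else 0) * (if m = i then 1 else 0)
        - (if i = j then 1 else 0) * (if m = k then 1 else 0)) * (rho x)⁻¹
      + ((if k = i then 1 else 0) * x j + (if k = j then 1 else 0) * x i
        - (if i = j then 1 else 0) * x k) * (x m * (rho x)⁻¹ ^ 2) := by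
  have h1 : ∀ (c : ℝ) (j : Fin n), DifferentiableAt ℝ (fun y : Euc n => c * y j) x := fun c j =>
    (differentiableAt_const _).fun_mul differentiableAt_coord
  unfold hypChr
  rw [pd_mul (((h1 _ _).fun_add (h1 _ _)).fun_sub (h1 _ _)) (differentiableAt_inv_rho hx),
    pd_sub ((h1 _ _).fun_add (h1 _ _)) (h1 _ _), pd_add (h1 _ _) (h1 _ _),
    pd_const_mul _ differentiableAt_coord, pd_const_mul _ differentiableAt_coord,
    pd_const_mul _ differentiableAt_coord, pd_inv_rho hx]
  simp only [pd_coord]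

theorem hypChr_symm (k i j : Fin n) (x : Euc n) : hypChr k i j x = hypChr k j i x := by
  unfold hypChr
  simp only [eq_comm (a := i) (b := j)]
  ring

theorem sum_hypChr_mul (i j : Fin n) (f : Fin n → ℝ) (x : Euc n) :
    ∑ l, hypChr l i j x * f l =
      (f i * x j + f j * x i - (if i = j then 1 else 0) * ∑ l, x l * f l) * (rho x)⁻¹ := by
  unfold hypChr
  simp only [sub_mul, add_mul, ite_mul, one_mul, zero_mul, Finset.sum_sub_distrib,
    Finset.sum_add_distrib, Finset.sum_ite_eq', Finset.mem_univ, if_true]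
  rw [show (∑ l, if i = j then x l * (rho x)⁻¹ * f l else 0)
    = if i = j then (∑ l, x l * f l) * (rho x)⁻¹ else 0 by
      split_ifs
      · rw [Finset.sum_mul]; exact Finset.sum_congr rfl fun _ _ => by ring
      · simp]
  split_ifs <;> ring

theorem sum_mul_hypChr (k i : Fin n) (f : Fin n → ℝ) (x : Euc n) :
    ∑ j, hypChr k i j x * f j =
      ((if k = i then 1 else 0) * ∑ j, x j * f j + x i * f k - f i * x k) * (rho x)⁻¹ := by
  unfold hypChr
  simp only [sub_mul, add_mul, ite_mul, one_mul, zero_mul, Finset.sum_sub_distrib,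
    Finset.sum_add_distrib, Finset.sum_ite_eq, Finset.mem_univ, if_true]
  rw [show (∑ l, if k = i then x l * (rho x)⁻¹ * f l else 0)
    = if k = i then (∑ l, x l * f l) * (rho x)⁻¹ else 0 by
      split_ifs
      · rw [Finset.sum_mul]; exact Finset.sum_congr rfl fun _ _ => by ring
      · simp]
  split_ifs <;> ring

theorem sum_hypChr_diag (i : Fin n) (x : Euc n) :
    ∑ k, hypChr k k i x = n * x i * (rho x)⁻¹ := by
  unfold hypChr
  rw [← Finset.sum_mul]
  simp

/-- The hyperbolic metric is Einstein, `Ric = -(n-1) b`. -/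
theorem ricci_hypChr (hx : ‖x‖ < 1) (i j : Fin n) :
    ∑ k, (pd univ k (hypChr k i j) x - pd univ j (hypChr k i k) x
      + ∑ l, (hypChr k k l x * hypChr l i j x - hypChr k j l x * hypChr l i k x))
    = -((n : ℝ) - 1) * ((rho x)⁻¹ ^ 2 * if i = j then 1 else 0) := by
  have hρ := (rho_pos hx).ne'
  have hs := sum_sq_eq_rho x
  have h1 : ∑ k, pd univ k (hypChr k i j) x =
      (2 - n) * (if i = j then 1 else 0) * (rho x)⁻¹
      + (2 * x i * x j - (if i = j then 1 else 0) * (1 - 2 * rho x)) * (rho x)⁻¹ ^ 2 := by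
    rw [← hs]
    simp only [pd_hypChr hx]
    rw [Finset.sum_add_distrib, ← Finset.sum_mul]
    simp only [sub_mul, add_mul, ite_mul, one_mul, zero_mul, Finset.sum_sub_distrib,
      Finset.sum_add_distrib, Finset.sum_ite_eq', Finset.mem_univ, if_true]
    by_cases hij : i = j
    · subst hij
      simp only [if_true, Finset.sum_const, Finset.card_univ, Fintype.card_fin, nsmul_eq_mul,
        Finset.sum_mul]
      ring_nf
    · have hji : ¬ j = i := fun h => hij h.symm
      simp [hij, hji]; ring
  have h2 : ∑ k, pd univ j (hypChr k i k) x =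
      n * (if i = j then 1 else 0) * (rho x)⁻¹ + n * x i * x j * (rho x)⁻¹ ^ 2 := by
    -- Symmetry in the lower indices turns the sum into the derivative of the contracted symbol `n
    -- x_i / ρ`.
    rw [show ∑ k, pd univ j (hypChr k i k) x
      = pd univ j (fun y => ∑ k, hypChr k k i y) x by
        rw [pd_sum _ fun k _ => differentiableAt_hypChr hx k k i]
        exact Finset.sum_congr rfl fun k _ => by
          congr 1; ext y; exact hypChr_symm k i k y]
    simp only [sum_hypChr_diag]
    rw [pd_mul ((differentiableAt_const _).fun_mul differentiableAt_coord) (differentiableAt_inv_rho hx),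
      pd_const_mul _ differentiableAt_coord, pd_coord, pd_inv_rho hx]
    simp only [eq_comm (a := j) (b := i)]
    ring
  have h3 : ∑ k, ∑ l, hypChr k k l x * hypChr l i j x =
      n * (2 * x i * x j - (if i = j then 1 else 0) * (1 - 2 * rho x)) * (rho x)⁻¹ ^ 2 := by
    rw [Finset.sum_comm]
    simp only [← Finset.sum_mul, sum_hypChr_diag]
    rw [show ∑ l, n * x l * (rho x)⁻¹ * hypChr l i j x
      = ∑ l, hypChr l i j x * (n * x l * (rho x)⁻¹) from
        Finset.sum_congr rfl fun _ _ => mul_comm _ _]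
    rw [sum_hypChr_mul, ← hs]
    rw [show ∑ l, x l * (n * x l * (rho x)⁻¹) = n * (rho x)⁻¹ * ∑ l, x l * x l by
      rw [Finset.mul_sum]; exact Finset.sum_congr rfl fun _ _ => by ring]
    ring
  have h4 : ∑ k, ∑ l, hypChr k j l x * hypChr l i k x =
      ((n + 2) * x i * x j - 2 * (if i = j then 1 else 0) * (1 - 2 * rho x)) * (rho x)⁻¹ ^ 2 := by
    simp only [sum_mul_hypChr]
    have e1 : ∀ k, ((if k = j then 1 else 0) * ∑ l, x l * hypChr l i k x
        + x j * hypChr k i k x - hypChr j i k x * x k) * (rho x)⁻¹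
        = ((if k = j then 1 else 0) * ∑ l, x l * hypChr l i k x) * (rho x)⁻¹
        + (x j * (rho x)⁻¹) * hypChr k k i x - hypChr j i k x * (x k * (rho x)⁻¹) := fun k => by
      rw [hypChr_symm k i k]; ring
    simp only [e1]
    rw [Finset.sum_sub_distrib, Finset.sum_add_distrib, ← Finset.mul_sum, sum_hypChr_diag,
      sum_mul_hypChr, ← Finset.sum_mul]
    simp only [ite_mul, one_mul, zero_mul, Finset.sum_ite_eq', Finset.mem_univ, if_true]
    rw [show ∑ l, x l * hypChr l i j x = ∑ l, hypChr l i j x * x l from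
        Finset.sum_congr rfl fun _ _ => mul_comm _ _, sum_hypChr_mul]
    rw [show ∑ l, x l * (x l * (rho x)⁻¹) = (rho x)⁻¹ * ∑ l, x l * x l by
      rw [Finset.mul_sum]; exact Finset.sum_congr rfl fun _ _ => by ring, hs]
    by_cases hij : i = j
    · subst hij; simp only [if_true]; ring
    · have hji : ¬ j = i := fun h => hij h.symm
      simp only [hij, hji, if_false]; ring
  simp only [Finset.sum_add_distrib, Finset.sum_sub_distrib]
  rw [h1, h2, h3, h4]
  field_simp
  ring

end PartialDerivatives

/-! ### Linearization of the scalar curvature at the hyperbolic metric -/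

section Linearization

variable {n : ℕ}

/-- The linear part of the Christoffel symbols of the first kind of `b + e`. -/
def linChr (e : Fin n → Fin n → Euc n → ℝ) (i j l : Fin n) (x : Euc n) : ℝ :=
  (1 / 2) * (pd univ i (e j l) x + pd univ j (e i l) x - pd univ l (e i j) x)
    - ∑ m, hypChr m i j x * e l m x

/-- The one-form `div e - d tr e` with respect to the hyperbolic metric. -/
def linDiv (e : Fin n → Fin n → Euc n → ℝ) (k : Fin n) (x : Euc n) : ℝ :=
  rho x ^ 2 * (∑ i, pd univ i (e i k) x - ∑ i, pd univ k (e i i) x)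
    + (n - 2) * (rho x * ∑ m, x m * e k m x) + rho x * (x k * ∑ i, e i i x)

/-- The linearization of the scalar curvature at the hyperbolic metric. -/
def linScal (e : Fin n → Fin n → Euc n → ℝ) (x : Euc n) : ℝ :=
  rho x ^ 2 * (∑ k, pd univ k (linDiv e k) x
    + (n - 2) * ((rho x)⁻¹ * ∑ k, x k * linDiv e k x) + (n - 1) * ∑ i, e i i x)

/-- The difference of the Christoffel symbols of `G` and of the hyperbolic metric. -/
def chrDiff (G : Euc n → Euc n →L[ℝ] Euc n →L[ℝ] ℝ) (k i j : Fin n) (x : Euc n) : ℝ :=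
  christoffel univ G k i j x - hypChr k i j x

/-- Components of `G - b`. -/
def devComp (G : Euc n → Euc n →L[ℝ] Euc n →L[ℝ] ℝ) (i j : Fin n) (x : Euc n) : ℝ :=
  comp (fun y => G y - hypMetric n y) x i j

theorem comp_hypMetric (x : Euc n) (i j : Fin n) :
    comp (hypMetric n) x i j = (rho x)⁻¹ ^ 2 * if i = j then 1 else 0 := by
  simp only [comp, hypMetric, euclideanForm, Matrix.of_apply]
  change (rho x ^ 2)⁻¹ * (inner ℝ (EuclideanSpace.single i (1 : ℝ)) (EuclideanSpace.single j 1) : ℝ) = _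
  rw [inv_pow]
  simp [EuclideanSpace.inner_single_left]

theorem comp_eq_add_devComp (G : Euc n → Euc n →L[ℝ] Euc n →L[ℝ] ℝ) (x : Euc n) (i j : Fin n) :
    comp G x i j = (rho x)⁻¹ ^ 2 * (if i = j then 1 else 0) + devComp G i j x := by
  rw [← comp_hypMetric]
  simp [comp, devComp]

theorem sum_compInv_mul_comp {G : Euc n → Euc n →L[ℝ] Euc n →L[ℝ] ℝ} {x : Euc n}
    (h : (comp G x).det ≠ 0) (k m : Fin n) :
    ∑ l, compInv G x k l * comp G x l m = if k = m then 1 else 0 := by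
  have := congrFun (congrFun (Matrix.nonsing_inv_mul (comp G x) (isUnit_iff_ne_zero.2 h)) k) m
  rw [Matrix.mul_apply, Matrix.one_apply] at this
  exact this

/-- An exact identity. The symbols of the first kind of `G = b + e` are `G` applied to the
hyperbolic symbols plus `linChr e`, which equals `(∇_i e_jl + ∇_j e_il - ∇_l e_ij)/2`; raising the
index with `G⁻¹` isolates the difference. Nonlinearity in `e` enters only through `G⁻¹`. -/
theorem chrDiff_eq {G : Euc n → Euc n →L[ℝ] Euc n →L[ℝ] ℝ} {x : Euc n} (hx : ‖x‖ < 1)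
    (hd : ∀ i j, DifferentiableAt ℝ (devComp G i j) x) (h : (comp G x).det ≠ 0) (k i j : Fin n) :
    chrDiff G k i j x = ∑ l, compInv G x k l * linChr (devComp G) i j l x := by
  have hρ := (rho_pos hx).ne'
  have h1 : ∀ m i j, pd univ m (fun z => comp G z i j) x
      = 2 * x m * (rho x)⁻¹ ^ 3 * (if i = j then 1 else 0) + pd univ m (devComp G i j) x := by
    intro m i j
    simp only [comp_eq_add_devComp, sq]
    have h2 := differentiableAt_inv_rho hx
    rw [pd_add ((h2.fun_mul h2).fun_mul (differentiableAt_const _)) (hd i j),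
      pd_mul (h2.fun_mul h2) (differentiableAt_const _), pd_mul h2 h2, pd_const, pd_inv_rho hx]
    ring
  have h2 : ∀ l, (1 / 2) * (pd univ i (fun z => comp G z j l) x + pd univ j (fun z => comp G z i l) x
      - pd univ l (fun z => comp G z i j) x)
      = ∑ m, comp G x l m * hypChr m i j x + linChr (devComp G) i j l x := by
    intro l
    have e1 : ∑ m, comp G x l m * hypChr m i j x
        = (rho x)⁻¹ ^ 2 * hypChr l i j x + ∑ m, hypChr m i j x * devComp G l m x := by
      simp only [comp_eq_add_devComp, add_mul, Finset.sum_add_distrib]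
      congr 1
      · simp
      · exact Finset.sum_congr rfl fun _ _ => mul_comm _ _
    rw [e1, h1, h1, h1]
    unfold linChr hypChr
    simp only [eq_comm (a := l) (b := j), eq_comm (a := l) (b := i)]
    ring
  have h3 : christoffel univ G k i j x = ∑ l, compInv G x k l *
      (∑ m, comp G x l m * hypChr m i j x + linChr (devComp G) i j l x) := by
    unfold christoffel
    rw [Finset.mul_sum]
    exact Finset.sum_congr rfl fun l _ => by rw [← h2 l]; ring
  have h4 : ∑ l, compInv G x k l * ∑ m, comp G x l m * hypChr m i j x = hypChr k i j x := by
    simp only [Finset.mul_sum]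
    rw [Finset.sum_comm]
    simp only [← mul_assoc, ← Finset.sum_mul, sum_compInv_mul_comp h]
    simp
  unfold chrDiff
  rw [h3]
  simp only [mul_add, Finset.sum_add_distrib]
  rw [h4]; ring

theorem christoffel_hypMetric {x : Euc n} (hx : ‖x‖ < 1) (k i j : Fin n) :
    christoffel univ (hypMetric n) k i j x = hypChr k i j x := by
  have h0 : ∀ i j, devComp (hypMetric n) i j = fun _ => 0 := fun i j => by
    ext y; simp [devComp, comp]
  have hc : comp (hypMetric n) x = (rho x)⁻¹ ^ 2 • (1 : Matrix (Fin n) (Fin n) ℝ) := by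
    ext i j; rw [comp_hypMetric]; simp [Matrix.one_apply]
  -- The case `e = 0` of the difference formula.
  have h := chrDiff_eq (G := hypMetric n) hx (fun i j => by rw [h0]; exact differentiableAt_const _)
    (by rw [hc, Matrix.det_smul, Matrix.det_one, mul_one]
        exact pow_ne_zero _ (pow_ne_zero _ (inv_ne_zero (rho_pos hx).ne'))) k i j
  simp only [linChr, h0, pd_const] at h
  simp only [chrDiff] at h
  simpa [sub_eq_zero] using h

/-- The part of the Ricci curvature linear in the difference of the Christoffel symbols. -/
def ricLin (C : Fin n → Fin n → Fin n → Euc n → ℝ) (i j : Fin n) (x : Euc n) : ℝ :=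
  ∑ k, (pd univ k (C k i j) x - pd univ j (C k i k) x
    + ∑ l, (hypChr k k l x * C l i j x + C k k l x * hypChr l i j x
      - hypChr k j l x * C l i k x - C k j l x * hypChr l i k x))

/-- The part of the Ricci curvature quadratic in the difference of the Christoffel symbols. -/
def ricQuad (C : Fin n → Fin n → Fin n → Euc n → ℝ) (i j : Fin n) (x : Euc n) : ℝ :=
  ∑ k, ∑ l, (C k k l x * C l i j x - C k j l x * C l i k x)

/-- The Ricci formula is a quadratic polynomial in the symbols and their first derivatives, so
substituting hyperbolic symbols plus `C` splits it exactly into degrees 0, 1 and 2 in `C`. Degree 0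
is the Einstein property of `b`. -/
theorem coordRicci_eq {G : Euc n → Euc n →L[ℝ] Euc n →L[ℝ] ℝ} {x : Euc n} (hx : ‖x‖ < 1)
    (hd : ∀ k i j, DifferentiableAt ℝ (chrDiff G k i j) x) (i j : Fin n) :
    coordRicci univ G i j x = -((n : ℝ) - 1) * ((rho x)⁻¹ ^ 2 * if i = j then 1 else 0)
      + ricLin (chrDiff G) i j x + ricQuad (chrDiff G) i j x := by
  have h1 : ∀ k i j, christoffel univ G k i j = fun y => hypChr k i j y + chrDiff G k i j y :=
    fun k i j => by ext y; simp [chrDiff]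
  rw [← ricci_hypChr hx]
  unfold coordRicci ricLin ricQuad
  rw [← Finset.sum_add_distrib, ← Finset.sum_add_distrib]
  refine Finset.sum_congr rfl fun k _ => ?_
  simp only [h1]
  rw [pd_add (differentiableAt_hypChr hx _ _ _) (hd _ _ _),
    pd_add (differentiableAt_hypChr hx _ _ _) (hd _ _ _)]
  have : ∀ A B C D E F G : ℝ, A + B - (C + D) + E = (A - C + F) + (B - D + G) + (E - F - G) := by
    intros; ring
  rw [this _ _ _ _ _ (∑ l, (hypChr k k l x * hypChr l i j x - hypChr k j l x * hypChr l i k x))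
    (∑ l, (hypChr k k l x * chrDiff G l i j x + chrDiff G k k l x * hypChr l i j x
      - hypChr k j l x * chrDiff G l i k x - chrDiff G k j l x * hypChr l i k x))]
  congr 1
  rw [← Finset.sum_sub_distrib, ← Finset.sum_sub_distrib]
  exact Finset.sum_congr rfl fun l _ => by ring

/-- Invariantly, the linear part of Ricci is `∇_k C^k_ij - ∇_j C^k_ik`, so its trace is a
divergence. For `X^k = ρ² W^k` the hyperbolic divergence is `ρ^n ∂_k(ρ^{-n} X^k) = ρ² (∂_k W^k +
(n-2) ρ⁻¹ x_k W^k)`, which explains the zeroth order term; here `W` is the trace vector in the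
statement. -/
theorem sum_ricLin {C : Fin n → Fin n → Fin n → Euc n → ℝ} {x : Euc n}
    (hs : ∀ k i j, C k i j x = C k j i x)
    (hd : ∀ k i j, DifferentiableAt ℝ (C k i j) x) :
    ∑ i, ricLin C i i x = ∑ k, pd univ k (fun y => ∑ i, C k i i y - ∑ l, C l k l y) x
      + (n - 2) * ((rho x)⁻¹ * ∑ k, x k * (∑ i, C k i i x - ∑ l, C l k l x)) := by
  have e1 : ∑ k, pd univ k (fun y => ∑ i, C k i i y - ∑ l, C l k l y) x
      = ∑ i, ∑ k, (pd univ k (C k i i) x - pd univ i (C k i k) x) := by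
    have : ∀ k, pd univ k (fun y => ∑ i, C k i i y - ∑ l, C l k l y) x
        = ∑ i, pd univ k (C k i i) x - ∑ l, pd univ k (C l k l) x := fun k => by
      rw [pd_sub (DifferentiableAt.fun_sum fun i _ => hd k i i)
        (DifferentiableAt.fun_sum fun i _ => hd i k i), pd_sum _ fun i _ => hd k i i,
        pd_sum _ fun i _ => hd i k i]
    simp only [this, Finset.sum_sub_distrib]
    rw [Finset.sum_comm]
  unfold ricLin
  rw [e1]
  simp only [Finset.sum_add_distrib (f := fun k => pd univ k _ x - _)]
  have t1 : ∑ i, ∑ k, ∑ l, hypChr k k l x * C l i i x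
      = n * (rho x)⁻¹ * ∑ l, x l * ∑ i, C l i i x := by
    rw [Finset.mul_sum]
    calc _ = ∑ i, ∑ l, n * x l * (rho x)⁻¹ * C l i i x := by
          refine Finset.sum_congr rfl fun i _ => ?_
          rw [Finset.sum_comm]
          simp only [← Finset.sum_mul, sum_hypChr_diag]
      _ = _ := by
          rw [Finset.sum_comm]
          refine Finset.sum_congr rfl fun l _ => ?_
          rw [← Finset.mul_sum]; ring
  have t2 : ∑ i, ∑ k, ∑ l, C k k l x * hypChr l i i x
      = (2 - n) * (rho x)⁻¹ * ∑ l, x l * ∑ k, C k l k x := by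
    have : ∀ l, ∑ i, hypChr l i i x = (2 - n) * x l * (rho x)⁻¹ := fun l => by
      unfold hypChr
      rw [← Finset.sum_mul]
      simp [Finset.sum_add_distrib, Finset.sum_sub_distrib]
      left
      ring
    rw [Finset.sum_comm]
    simp_rw [Finset.sum_comm (γ := Fin n) (s := Finset.univ (α := Fin n))
      (f := fun (a : Fin n) (b : Fin n) => C _ _ b x * hypChr b a a x)]
    simp only [← Finset.mul_sum, this]
    rw [Finset.sum_comm, Finset.mul_sum]
    refine Finset.sum_congr rfl fun l _ => ?_
    rw [← Finset.sum_mul, Finset.sum_congr rfl fun k _ => hs k k l]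
    ring
  have t3 : ∑ i, ∑ k, ∑ l, hypChr k i l x * C l i k x = (rho x)⁻¹ * ∑ l, x l * ∑ i, C l i i x := by
    have e2 : ∀ i k, ∑ l, hypChr k i l x * C l i k x
        = ((if k = i then 1 else 0) * ∑ l, x l * C l i i x) * (rho x)⁻¹
          + (x i * C k i k x - x k * C i i k x) * (rho x)⁻¹ := fun i k => by
      rw [sum_mul_hypChr]
      by_cases h : k = i
      · subst h
        simp only [if_true]
        ring
      · simp only [h, if_false]
        ring
    simp only [e2, Finset.sum_add_distrib, ← Finset.sum_mul, Finset.sum_sub_distrib]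
    -- After renaming indices and using the symmetry of `C`, the two contractions of trace type
    -- cancel.
    rw [show ∑ i, ∑ k, x k * C i i k x = ∑ i, ∑ k, x i * C k i k x by
      rw [Finset.sum_comm]
      exact Finset.sum_congr rfl fun i _ => Finset.sum_congr rfl fun k _ => by rw [hs k k i]]
    simp only [one_mul, zero_mul, Finset.sum_ite_eq', Finset.mem_univ, if_true, sub_self,
      add_zero]
    rw [Finset.sum_comm, mul_comm]
    congr 1
    exact Finset.sum_congr rfl fun l _ => by rw [Finset.mul_sum]
  have t4 : ∑ i, ∑ k, ∑ l, C k i l x * hypChr l i k x = (rho x)⁻¹ * ∑ l, x l * ∑ i, C l i i x := by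
    rw [← t3]
    refine Finset.sum_congr rfl fun i _ => ?_
    rw [Finset.sum_comm]
    exact Finset.sum_congr rfl fun k _ => Finset.sum_congr rfl fun l _ => mul_comm _ _
  simp only [Finset.sum_add_distrib, Finset.sum_sub_distrib, mul_sub]
  rw [t1, t2, t3, t4]
  ring

end Linearization

/-! ### Asymptotically hyperbolic metrics in the ball -/

section AsymptoticMetric

variable {n : ℕ} {α τ : ℝ}

theorem asy_hypChr (hα₀ : 0 ≤ α) (hα₁ : α ≤ 1) {k : ℕ} (l i j : Fin n) :
    Asy α k (-1) (hypChr l i j) := by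
  have h1 : ∀ (c : ℝ) (j : Fin n), Asy α k 0 (fun x : Euc n => c * x j) :=
    fun c j => (asy_coord hα₀ hα₁ j).const_mul c
  have := (((h1 (if l = i then 1 else 0) j).add (h1 (if l = j then 1 else 0) i)).sub
    (h1 (if i = j then 1 else 0) l)).mul (asy_inv_rho hα₀ hα₁)
  exact this.mono (by norm_num)

theorem Asy.det {A : Euc n → Matrix (Fin n) (Fin n) ℝ} {k : ℕ}
    (h : ∀ i j, Asy α k 0 (fun x => A x i j)) : Asy α k 0 (fun x => (A x).det) := by
  simp only [Matrix.det_apply]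
  refine Asy.sum _ fun σ _ => ?_
  have h1 := Asy.prod (α := α) (k := k) Finset.univ fun i _ => h (σ i) i
  refine (h1.const_mul ((Equiv.Perm.sign σ : ℤ) : ℝ)).congr (Eventually.of_forall fun x => ?_)
  rw [Units.smul_def, zsmul_eq_mul]

theorem tendsto_rho_far : Tendsto (rho : Euc n → ℝ) (far n) (𝓝 0) := by
  have h1 : Tendsto (fun x : Euc n => ‖x‖) (far n) (𝓝 1) :=
    tendsto_comap.mono_right nhdsWithin_le_nhds
  have h2 : Tendsto (fun x : Euc n => (1 - ‖x‖ ^ 2) / 2) (far n) (𝓝 ((1 - 1 ^ 2) / 2)) :=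
    ((h1.pow 2).const_sub 1).div_const 2
  rw [show ((1 : ℝ) - 1 ^ 2) / 2 = 0 by norm_num] at h2
  exact h2

theorem Asy.tendsto_zero {F : Type} [NormedAddCommGroup F] [NormedSpace ℝ F] {k : ℕ} {s : ℝ}
    {T : Euc n → F} (h : Asy α k s T) (hs : 0 < s) : Tendsto T (far n) (𝓝 0) := by
  obtain ⟨C, hC, h⟩ := h.eventually_norm_le
  have h1 : Tendsto (fun x : Euc n => C * rho x ^ s) (far n) (𝓝 0) := by
    have := (tendsto_rho_far (n := n)).rpow_const (p := s) (Or.inr hs.le)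
    rw [Real.zero_rpow hs.ne'] at this
    simpa using this.const_mul C
  exact squeeze_zero_norm' h h1

/-- A metric in the ball which differs from the hyperbolic metric by `O(ρ^τ)`. -/
structure AsyHyp (α τ : ℝ) (G : Euc n → Euc n →L[ℝ] Euc n →L[ℝ] ℝ) : Prop where
  alpha_nonneg : 0 ≤ α
  alpha_le : α ≤ 1
  tau_pos : 0 < τ
  symm : ∀ᶠ x in far n, ∀ i j, comp G x i j = comp G x j i
  dev : ∀ i j, Asy α 2 (τ - 2) (devComp G i j)

variable {G : Euc n → Euc n →L[ℝ] Euc n →L[ℝ] ℝ}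

theorem AsyHyp.scaled_eq (_hG : AsyHyp α τ G) : ∀ᶠ x in far n, ∀ i j,
    (rho x ^ 2 • comp G x) i j = (if i = j then 1 else 0) + rho x ^ 2 * devComp G i j x := by
  filter_upwards [eventually_far_norm_lt] with x hx i j
  have hρ := (rho_pos hx).ne'
  rw [Matrix.smul_apply, comp_eq_add_devComp, smul_eq_mul]
  field_simp

theorem AsyHyp.asy_scaled (hG : AsyHyp α τ G) (i j : Fin n) :
    Asy α 2 0 (fun x => (rho x ^ 2 • comp G x) i j) := by
  have hρ : Asy α 2 1 (rho : Euc n → ℝ) := asy_rho hG.alpha_nonneg hG.alpha_le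
  have h1 : Asy α 2 0 (fun x => rho x * rho x * devComp G i j x) :=
    ((hρ.mul hρ).mul (hG.dev i j)).mono (by linarith [hG.tau_pos])
  refine ((Asy.const (if i = j then (1 : ℝ) else 0)).add h1).congr ?_
  filter_upwards [hG.scaled_eq] with x hx
  rw [hx]; ring

theorem AsyHyp.tendsto_scaled (hG : AsyHyp α τ G) :
    Tendsto (fun x => rho x ^ 2 • comp G x) (far n) (𝓝 1) := by
  have hρ : Asy α 2 1 (rho : Euc n → ℝ) := asy_rho hG.alpha_nonneg hG.alpha_le
  refine tendsto_pi_nhds.2 fun i => tendsto_pi_nhds.2 fun j => ?_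
  -- The rescaled matrix `ρ² G` is the identity plus a term of positive order `τ`.
  have h1 : Asy α 2 τ (fun x => rho x * rho x * devComp G i j x) :=
    ((hρ.mul hρ).mul (hG.dev i j)).mono (by linarith)
  have h2 := (h1.tendsto_zero hG.tau_pos).const_add (if i = j then (1 : ℝ) else 0)
  rw [add_zero] at h2
  rw [Matrix.one_apply]
  refine h2.congr' ?_
  filter_upwards [hG.scaled_eq] with x hx
  rw [hx]; ring

theorem AsyHyp.tendsto_det (hG : AsyHyp α τ G) :
    Tendsto (fun x => (rho x ^ 2 • comp G x).det) (far n) (𝓝 1) := by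
  have h1 : Continuous (fun A : Matrix (Fin n) (Fin n) ℝ => A.det) :=
    Continuous.matrix_det continuous_id
  have h2 := (h1.tendsto 1).comp hG.tendsto_scaled
  rwa [Matrix.det_one] at h2

/-- Any interval around `1` would do. With these endpoints the square root, which becomes the volume
density relative to `ρ^{-n}`, lies between `1/2` and `2`. -/
theorem AsyHyp.eventually_det (hG : AsyHyp α τ G) :
    ∀ᶠ x in far n, 1 / 4 ≤ (rho x ^ 2 • comp G x).det ∧ (rho x ^ 2 • comp G x).det ≤ 4 :=
  hG.tendsto_det.eventually (Icc_mem_nhds (by norm_num) (by norm_num))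

theorem AsyHyp.eventually_det_ne (hG : AsyHyp α τ G) : ∀ᶠ x in far n, (comp G x).det ≠ 0 := by
  filter_upwards [hG.eventually_det] with x hx h0
  rw [Matrix.det_smul, h0, mul_zero] at hx
  linarith [hx.1]

/-- Rescale before inverting: `G⁻¹ = ρ² (ρ² G)⁻¹`. By Cramer's rule the entries of `(ρ² G)⁻¹` are
polynomials of order 0 divided by a determinant bounded away from zero. -/
theorem AsyHyp.asy_compInv (hG : AsyHyp α τ G) (i j : Fin n) :
    Asy α 2 2 (fun x => compInv G x i j) := by
  have hρ : Asy α 2 1 (rho : Euc n → ℝ) := asy_rho hG.alpha_nonneg hG.alpha_le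
  have hdet := Asy.inv (c := 1 / 4) (by norm_num)
    (hG.eventually_det.mono fun x hx => hx.1.trans (le_abs_self _)) (Asy.det hG.asy_scaled)
  have hadj : Asy α 2 0 (fun x => (rho x ^ 2 • comp G x).adjugate i j) := by
    simp only [Matrix.adjugate_apply]
    refine Asy.det fun a b => ?_
    simp only [Matrix.updateRow_apply]
    split_ifs
    · exact Asy.const _
    · exact hG.asy_scaled a b
  refine (((hρ.mul hρ).mul (hdet.mul hadj)).mono (by norm_num)).congr ?_
  filter_upwards [hG.eventually_det_ne, eventually_far_norm_lt] with x hx hx1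
  have hρ := (rho_pos hx1).ne'
  have hd : (rho x ^ 2 • comp G x).det ≠ 0 := by
    rw [Matrix.det_smul]; exact mul_ne_zero (by positivity) hx
  have : compInv G x = rho x ^ 2 • (((rho x ^ 2 • comp G x).det)⁻¹ •
      (rho x ^ 2 • comp G x).adjugate) := by
    refine Matrix.inv_eq_left_inv ?_
    rw [Matrix.smul_mul, ← Matrix.mul_smul, Matrix.smul_mul, Matrix.adjugate_mul, smul_smul,
      inv_mul_cancel₀ hd, one_smul]
  rw [this]
  simp only [Matrix.smul_apply, smul_eq_mul]
  ring

/-- The deviation of the inverse metric. -/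
def devInv (G : Euc n → Euc n →L[ℝ] Euc n →L[ℝ] ℝ) (i j : Fin n) (x : Euc n) : ℝ :=
  compInv G x i j - rho x ^ 2 * if i = j then 1 else 0

theorem sum_compInv_devComp {x : Euc n} (h : (comp G x).det ≠ 0) (i j : Fin n) :
    (rho x)⁻¹ ^ 2 * compInv G x i j + ∑ k, compInv G x i k * devComp G k j x
      = if i = j then 1 else 0 := by
  rw [← sum_compInv_mul_comp h i j]
  simp only [comp_eq_add_devComp, mul_add, Finset.sum_add_distrib]
  congr 1
  simp; ring

/-- From `G⁻¹(b + e) = 1` one gets `G⁻¹ - b⁻¹ = -ρ² G⁻¹ e`, of order `2 + 2 + (τ - 2)`. -/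
theorem AsyHyp.asy_devInv (hG : AsyHyp α τ G) (i j : Fin n) : Asy α 2 (τ + 2) (devInv G i j) := by
  have hρ : Asy α 2 1 (rho : Euc n → ℝ) := asy_rho hG.alpha_nonneg hG.alpha_le
  have h1 : Asy α 2 (2 + (τ - 2)) (fun x => ∑ k, compInv G x i k * devComp G k j x) :=
    Asy.sum _ fun k _ => (hG.asy_compInv i k).mul (hG.dev k j)
  refine ((((hρ.mul hρ).mul h1).neg).mono (by linarith)).congr ?_
  filter_upwards [hG.eventually_det_ne, eventually_far_norm_lt] with x hx hx1
  have hρ := (rho_pos hx1).ne'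
  unfold devInv
  rw [← sum_compInv_devComp hx i j]
  field_simp
  ring

/-- Partial derivatives and hyperbolic Christoffel symbols each cost one power of `ρ`. The order `σ`
is kept free in estimates on linear operators in `e`: some of them are applied both to a metric
deviation, `σ = τ`, and to a difference of two metrics, `σ = 2τ`. -/
theorem asy_linChr (hα₀ : 0 ≤ α) (hα₁ : α ≤ 1) {e : Fin n → Fin n → Euc n → ℝ} {σ : ℝ}
    (he : ∀ i j, Asy α 2 (σ - 2) (e i j)) (i j l : Fin n) : Asy α 1 (σ - 3) (linChr e i j l) := by
  have h1 : ∀ m i j, Asy α 1 (σ - 3) (pd univ m (e i j)) := fun m i j =>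
    ((he i j).pd m).mono (by linarith)
  refine (((((h1 i j l).add (h1 j i l)).sub (h1 l i j)).const_mul (1 / 2)).sub
    (Asy.sum _ fun m _ => (((asy_hypChr hα₀ hα₁ m i j).mul
      ((he l m).of_le (by norm_num))).mono (s' := σ - 3) (by linarith))))

theorem asy_linDiv (hα₀ : 0 ≤ α) (hα₁ : α ≤ 1) {e : Fin n → Fin n → Euc n → ℝ} {σ : ℝ}
    (he : ∀ i j, Asy α 2 (σ - 2) (e i j)) (k : Fin n) : Asy α 1 (σ - 1) (linDiv e k) := by
  have hρ : Asy α 1 1 (rho : Euc n → ℝ) := asy_rho hα₀ hα₁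
  have he1 : ∀ i j, Asy α 1 (σ - 2) (e i j) := fun i j => (he i j).of_le (by norm_num)
  have h1 : ∀ m i j, Asy α 1 (σ - 3) (pd univ m (e i j)) := fun m i j =>
    ((he i j).pd m).mono (by linarith)
  have a1 : Asy α 1 (σ - 1) (fun x => rho x * rho x *
      (∑ i, pd univ i (e i k) x - ∑ i, pd univ k (e i i) x)) :=
    ((hρ.mul hρ).mul ((Asy.sum _ fun i _ => h1 i i k).sub (Asy.sum _ fun i _ => h1 k i i))).mono
      (by linarith)
  have a2 : Asy α 1 (σ - 1) (fun x => ((n : ℝ) - 2) * (rho x * ∑ m, x m * e k m x)) :=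
    ((hρ.mul (Asy.sum _ fun m _ => (asy_coord hα₀ hα₁ m).mul (he1 k m))).mono
      (by linarith)).const_mul _
  have a3 : Asy α 1 (σ - 1) (fun x => rho x * (x k * ∑ i, e i i x)) :=
    (hρ.mul ((asy_coord hα₀ hα₁ k).mul (Asy.sum _ fun i _ => he1 i i))).mono (by linarith)
  refine ((a1.add a2).add a3).congr (Eventually.of_forall fun x => ?_)
  unfold linDiv; ring

theorem asy_linScal (hα₀ : 0 ≤ α) (hα₁ : α ≤ 1) {e : Fin n → Fin n → Euc n → ℝ} {σ : ℝ}
    (he : ∀ i j, Asy α 2 (σ - 2) (e i j)) : Asy α 0 σ (linScal e) := by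
  have hρ : Asy α 0 1 (rho : Euc n → ℝ) := asy_rho hα₀ hα₁
  have hρ' : Asy α 0 (-1) (fun x : Euc n => (rho x)⁻¹) := asy_inv_rho hα₀ hα₁
  have hY := asy_linDiv hα₀ hα₁ he
  have a1 : Asy α 0 (σ - 2) (fun x => ∑ k, pd univ k (linDiv e k) x) :=
    Asy.sum _ fun k _ => ((hY k).pd k).mono (by linarith)
  have a2 : Asy α 0 (σ - 2)
      (fun x => ((n : ℝ) - 2) * ((rho x)⁻¹ * ∑ k, x k * linDiv e k x)) :=
    ((hρ'.mul (Asy.sum _ fun k _ => (asy_coord hα₀ hα₁ k).mul ((hY k).of_le (by norm_num)))).mono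
      (by linarith)).const_mul _
  have a3 : Asy α 0 (σ - 2) (fun x => ((n : ℝ) - 1) * ∑ i, e i i x) :=
    (Asy.sum _ fun i _ => (he i i).of_le (by norm_num)).const_mul _
  refine (((hρ.mul hρ).mul ((a1.add a2).add a3)).mono (by linarith)).congr
    (Eventually.of_forall fun x => ?_)
  unfold linScal; ring

theorem AsyHyp.eventually_differentiableAt_devComp (hG : AsyHyp α τ G) :
    ∀ᶠ x in far n, ∀ i j, DifferentiableAt ℝ (devComp G i j) x :=
  eventually_all.2 fun i => eventually_all.2 fun j => (hG.dev i j).eventually_differentiableAt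

theorem AsyHyp.eventually_chrDiff_eq (hG : AsyHyp α τ G) : ∀ᶠ x in far n, ∀ k i j,
    chrDiff G k i j x = ∑ l, compInv G x k l * linChr (devComp G) i j l x := by
  filter_upwards [hG.eventually_det_ne, eventually_far_norm_lt,
    hG.eventually_differentiableAt_devComp] with x h1 h2 h3 k i j
  exact chrDiff_eq h2 h3 h1 k i j

theorem AsyHyp.asy_chrDiff (hG : AsyHyp α τ G) (k i j : Fin n) :
    Asy α 1 (τ - 1) (chrDiff G k i j) := by
  have h1 : Asy α 1 (τ - 1) (fun x => ∑ l, compInv G x k l * linChr (devComp G) i j l x) :=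
    Asy.sum _ fun l _ => (((hG.asy_compInv k l).of_le (by norm_num)).mul
      (asy_linChr hG.alpha_nonneg hG.alpha_le hG.dev i j l)).mono (by linarith)
  exact h1.congr (hG.eventually_chrDiff_eq.mono fun x hx => hx k i j)

theorem AsyHyp.eventually_devComp_symm (hG : AsyHyp α τ G) :
    ∀ᶠ x in far n, ∀ i j, devComp G i j x = devComp G j i x := by
  filter_upwards [hG.symm] with x hx i j
  have h := hx i j
  rw [comp_eq_add_devComp, comp_eq_add_devComp] at h
  simpa [eq_comm (a := i) (b := j)] using h

theorem AsyHyp.eventually_chrDiff_symm (hG : AsyHyp α τ G) :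
    ∀ᶠ x in far n, ∀ k i j, chrDiff G k i j x = chrDiff G k j i x := by
  filter_upwards [eventually_far_nhds hG.symm] with x hx k i j
  unfold chrDiff christoffel
  rw [hypChr_symm k i j]
  congr 2
  refine Finset.sum_congr rfl fun l _ => ?_
  rw [pd_congr (hx.mono fun y hy => hy i j)]
  ring

/-- Trace identity behind `div e - d tr e`. -/
theorem linDiv_eq {e : Fin n → Fin n → Euc n → ℝ} {x : Euc n} (hx : ‖x‖ < 1)
    (he : ∀ i j, e i j x = e j i x) (k : Fin n) :
    linDiv e k x = rho x ^ 2 * (∑ i, linChr e i i k x - ∑ l, linChr e k l l x) := by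
  have hρ := (rho_pos hx).ne'
  have h1 : ∑ i, ∑ m, hypChr m i i x * e k m x = (2 - n) * (∑ m, x m * e k m x) * (rho x)⁻¹ := by
    simp only [sum_hypChr_mul, if_true, one_mul]
    rw [← Finset.sum_mul, Finset.sum_sub_distrib, Finset.sum_add_distrib]
    simp only [Finset.sum_const, Finset.card_univ, Fintype.card_fin, nsmul_eq_mul]
    rw [Finset.sum_congr rfl fun m _ => mul_comm (e k m x) (x m)]
    ring
  have h2 : ∑ l, ∑ m, hypChr m k l x * e l m x = (x k * ∑ i, e i i x) * (rho x)⁻¹ := by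
    simp only [sum_hypChr_mul]
    rw [← Finset.sum_mul, Finset.sum_sub_distrib, Finset.sum_add_distrib, ← Finset.sum_mul]
    simp only [ite_mul, one_mul, zero_mul, Finset.sum_ite_eq, Finset.mem_univ, if_true]
    rw [Finset.sum_congr rfl fun m _ => show e m k x * x m = x m * e k m x by rw [he m k, mul_comm]]
    ring
  unfold linChr linDiv
  simp only [Finset.sum_sub_distrib, ← Finset.mul_sum, Finset.sum_add_distrib]
  rw [h1, h2]
  field_simp
  ring

/-- Replacing `G⁻¹` by `b⁻¹` in `chrDiff` leaves terms `devInv * linChr`, quadratic in `e` and of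
order `(τ + 2) + (τ - 3)`. What remains is `linDiv` by `linDiv_eq`. -/
theorem AsyHyp.asy_trace_sub_linDiv (hG : AsyHyp α τ G) (k : Fin n) :
    Asy α 1 (2 * τ - 1) (fun x => (∑ i, chrDiff G k i i x - ∑ l, chrDiff G l k l x)
      - linDiv (devComp G) k x) := by
  have hT := asy_linChr hG.alpha_nonneg hG.alpha_le hG.dev
  have hN : ∀ i j, Asy α 1 (τ + 2) (devInv G i j) := fun i j =>
    (hG.asy_devInv i j).of_le (by norm_num)
  have h1 : Asy α 1 (2 * τ - 1)
      (fun x => ∑ i, ∑ l, devInv G k l x * linChr (devComp G) i i l x) :=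
    Asy.sum _ fun i _ => Asy.sum _ fun l _ => ((hN k l).mul (hT i i l)).mono (by linarith)
  have h2 : Asy α 1 (2 * τ - 1)
      (fun x => ∑ l, ∑ m, devInv G l m x * linChr (devComp G) k l m x) :=
    Asy.sum _ fun l _ => Asy.sum _ fun m _ => ((hN l m).mul (hT k l m)).mono (by linarith)
  refine (h1.sub h2).congr ?_
  filter_upwards [hG.eventually_chrDiff_eq, hG.eventually_devComp_symm, eventually_far_norm_lt]
    with x hx hs hx1
  have e1 : ∀ k i j, chrDiff G k i j x = rho x ^ 2 * linChr (devComp G) i j k x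
      + ∑ l, devInv G k l x * linChr (devComp G) i j l x := fun k i j => by
    rw [hx]
    simp only [devInv, sub_mul, Finset.sum_sub_distrib]
    simp
  rw [linDiv_eq hx1 hs]
  simp only [e1, Finset.sum_add_distrib, ← Finset.mul_sum]
  ring

theorem AsyHyp.asy_ricLin (hG : AsyHyp α τ G) (i j : Fin n) :
    Asy α 0 (τ - 2) (ricLin (chrDiff G) i j) := by
  have hC := hG.asy_chrDiff
  have hC0 : ∀ k i j, Asy α 0 (τ - 1) (chrDiff G k i j) := fun k i j =>
    (hC k i j).of_le (by norm_num)
  have hB : ∀ k i j, Asy α 0 (-1) (hypChr (n := n) k i j) := asy_hypChr hG.alpha_nonneg hG.alpha_le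
  have h1 : ∀ m k i j, Asy α 0 (τ - 2) (pd univ m (chrDiff G k i j)) := fun m k i j =>
    ((hC k i j).pd m).mono (by linarith)
  have h2 : ∀ k i j k' i' j', Asy α 0 (τ - 2) (fun x => hypChr k i j x * chrDiff G k' i' j' x) :=
    fun k i j k' i' j' => ((hB k i j).mul (hC0 k' i' j')).mono (by linarith)
  have h3 : ∀ k i j k' i' j', Asy α 0 (τ - 2) (fun x => chrDiff G k' i' j' x * hypChr k i j x) :=
    fun k i j k' i' j' => ((hC0 k' i' j').mul (hB k i j)).mono (by linarith)
  exact Asy.sum _ fun k _ => ((h1 k k i j).sub (h1 j k i k)).add (Asy.sum _ fun l _ =>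
    (((h2 k k l l i j).add (h3 l i j k k l)).sub (h2 k j l l i k)).sub (h3 l i k k j l))

theorem AsyHyp.asy_ricQuad (hG : AsyHyp α τ G) (i j : Fin n) :
    Asy α 0 (2 * τ - 2) (ricQuad (chrDiff G) i j) := by
  have hC0 : ∀ k i j, Asy α 0 (τ - 1) (chrDiff G k i j) := fun k i j =>
    (hG.asy_chrDiff k i j).of_le (by norm_num)
  have h2 : ∀ k i j k' i' j',
      Asy α 0 (2 * τ - 2) (fun x => chrDiff G k i j x * chrDiff G k' i' j' x) :=
    fun k i j k' i' j' => ((hC0 k i j).mul (hC0 k' i' j')).mono (by linarith)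
  exact Asy.sum _ fun k _ => Asy.sum _ fun l _ => (h2 k k l l i j).sub (h2 k j l l i k)

/-- The scalar curvature of `G = b + e` is `-n(n-1)` plus its linearization up to `O(ρ^{2τ})`. -/
theorem AsyHyp.asy_scal (hG : AsyHyp α τ G) :
    Asy α 0 (2 * τ) (fun x => coordScal univ G x + n * (n - 1) - linScal (devComp G) x) := by
  have hα₀ := hG.alpha_nonneg
  have hα₁ := hG.alpha_le
  have hρ : Asy α 0 1 (rho : Euc n → ℝ) := asy_rho hα₀ hα₁
  have hρ' : Asy α 0 (-1) (fun x : Euc n => (rho x)⁻¹) := asy_inv_rho hα₀ hα₁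
  set W : Fin n → Euc n → ℝ := fun k x =>
    (∑ i, chrDiff G k i i x - ∑ l, chrDiff G l k l x) - linDiv (devComp G) k x with hW
  have hWa : ∀ k, Asy α 1 (2 * τ - 1) (W k) := hG.asy_trace_sub_linDiv
  -- The remainder has four pieces, each quadratic in the deviation: the divergence of `W`, the
  -- linear Ricci part traced with `G⁻¹ - b⁻¹`, the quadratic Ricci part, and the second order part
  -- of `tr G⁻¹`.
  have a1 : Asy α 0 (2 * τ) (fun x => rho x * rho x * (∑ k, pd univ k (W k) x
      + ((n : ℝ) - 2) * ((rho x)⁻¹ * ∑ k, x k * W k x))) := by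
    have b1 : Asy α 0 (2 * τ - 2) (fun x => ∑ k, pd univ k (W k) x) :=
      Asy.sum _ fun k _ => ((hWa k).pd k).mono (by linarith)
    have b2 : Asy α 0 (2 * τ - 2) (fun x => ((n : ℝ) - 2) * ((rho x)⁻¹ * ∑ k, x k * W k x)) :=
      ((hρ'.mul (Asy.sum _ fun k _ => (asy_coord hα₀ hα₁ k).mul
        ((hWa k).of_le (by norm_num)))).mono (by linarith)).const_mul _
    exact ((hρ.mul hρ).mul (b1.add b2)).mono (by linarith)
  have a2 : Asy α 0 (2 * τ) (fun x => ∑ i, ∑ j, devInv G i j x * ricLin (chrDiff G) i j x) :=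
    Asy.sum _ fun i _ => Asy.sum _ fun j _ =>
      (((hG.asy_devInv i j).of_le (by norm_num)).mul (hG.asy_ricLin i j)).mono (by linarith)
  have a3 : Asy α 0 (2 * τ) (fun x => ∑ i, ∑ j, compInv G x i j * ricQuad (chrDiff G) i j x) :=
    Asy.sum _ fun i _ => Asy.sum _ fun j _ =>
      (((hG.asy_compInv i j).of_le (by norm_num)).mul (hG.asy_ricQuad i j)).mono (by linarith)
  have a4 : Asy α 0 (2 * τ)
      (fun x => ((n : ℝ) - 1) * ∑ i, ∑ k, devInv G i k x * devComp G k i x) :=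
    (Asy.sum _ fun i _ => Asy.sum _ fun k _ => ((((hG.asy_devInv i k).mul (hG.dev k i)).of_le
      (by norm_num)).mono (by linarith))).const_mul _
  refine (((a1.add a2).add a3).add a4).congr ?_
  have hCd : ∀ᶠ x in far n, ∀ k i j, DifferentiableAt ℝ (chrDiff G k i j) x :=
    eventually_all.2 fun k => eventually_all.2 fun i => eventually_all.2 fun j =>
      (hG.asy_chrDiff k i j).eventually_differentiableAt
  have hYd : ∀ᶠ x in far n, ∀ k, DifferentiableAt ℝ (linDiv (devComp G) k) x :=
    eventually_all.2 fun k => (asy_linDiv hα₀ hα₁ hG.dev k).eventually_differentiableAt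
  filter_upwards [hCd, hYd, hG.eventually_chrDiff_symm, hG.eventually_det_ne,
    eventually_far_norm_lt] with x hC hY hs hd hx
  have hρ0 := (rho_pos hx).ne'
  have e1 : ∀ k, pd univ k (W k) x = pd univ k (fun y => ∑ i, chrDiff G k i i y
      - ∑ l, chrDiff G l k l y) x - pd univ k (linDiv (devComp G) k) x := fun k =>
    pd_sub ((DifferentiableAt.fun_sum fun i _ => hC k i i).fun_sub
      (DifferentiableAt.fun_sum fun i _ => hC i k i)) (hY k)
  have e2 : ∑ i, ricLin (chrDiff G) i i x = ∑ k, pd univ k (W k) x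
      + ∑ k, pd univ k (linDiv (devComp G) k) x
      + (n - 2) * ((rho x)⁻¹ * (∑ k, x k * W k x + ∑ k, x k * linDiv (devComp G) k x)) := by
    rw [sum_ricLin hs hC]
    simp only [e1, Finset.sum_sub_distrib]
    rw [← Finset.sum_add_distrib]
    congr 1
    · ring
    · congr 2
      refine Finset.sum_congr rfl fun k _ => ?_
      rw [hW]; ring
  -- Expansion of the trace of the inverse. Multiplied by `-(n-1) ρ⁻²`, its constant term is
  -- `-n(n-1)` and its linear term is the zeroth order term `(n-1) ρ² tr e` of `linScal`.
  have e3 : ∑ i, compInv G x i i = rho x ^ 2 * (n - rho x ^ 2 * ∑ i, devComp G i i x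
      - ∑ i, ∑ k, devInv G i k x * devComp G k i x) := by
    have : ∀ i, compInv G x i i = rho x ^ 2 * (1 - rho x ^ 2 * devComp G i i x
        - ∑ k, devInv G i k x * devComp G k i x) := fun i => by
      have h := sum_compInv_devComp hd i i
      have h' : ∑ k, compInv G x i k * devComp G k i x = rho x ^ 2 * devComp G i i x
          + ∑ k, devInv G i k x * devComp G k i x := by
        simp only [devInv, sub_mul, Finset.sum_sub_distrib]
        simp
      rw [h', if_pos rfl] at h
      rw [← h]
      field_simp
      ring
    rw [Finset.sum_congr rfl fun i _ => this i, ← Finset.mul_sum, Finset.sum_sub_distrib,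
      Finset.sum_sub_distrib, ← Finset.mul_sum]
    simp
  have e4 : coordScal univ G x = -((n : ℝ) - 1) * ((rho x)⁻¹ ^ 2 * ∑ i, compInv G x i i)
      + (rho x ^ 2 * ∑ i, ricLin (chrDiff G) i i x
        + ∑ i, ∑ j, devInv G i j x * ricLin (chrDiff G) i j x)
      + ∑ i, ∑ j, compInv G x i j * ricQuad (chrDiff G) i j x := by
    unfold coordScal
    simp only [coordRicci_eq hx hC, mul_add, Finset.sum_add_distrib]
    congr 2
    · simp only [Finset.mul_sum]
      refine Finset.sum_congr rfl fun i _ => ?_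
      simp; ring
    · simp only [devInv, sub_mul, Finset.sum_sub_distrib]
      simp [Finset.mul_sum]
  rw [e4, e3, e2]
  unfold linScal
  field_simp
  ring

end AsymptoticMetric

/-! ### The mass form -/

section MassForm

variable {n : ℕ} {α : ℝ}

/-- Functions `V = O(ρ⁻¹)` with `Hess V = V b` with respect to the hyperbolic metric. -/
structure IsStatic (α : ℝ) (V : Euc n → ℝ) : Prop where
  smooth : ∀ x, ‖x‖ < 1 → ContDiffAt ℝ 2 V x
  hess : ∀ x, ‖x‖ < 1 → ∀ i j, pd univ i (pd univ j V) x =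
    (x j * pd univ i V x + x i * pd univ j V x
      - (if i = j then 1 else 0) * ∑ k, x k * pd univ k V x) * (rho x)⁻¹
      + (rho x)⁻¹ ^ 2 * (if i = j then 1 else 0) * V x
  asy : ∀ k, Asy α k (-1) V

theorem eventually_norm_lt_one {x : Euc n} (hx : ‖x‖ < 1) : ∀ᶠ y in 𝓝 x, ‖y‖ < 1 :=
  (isOpen_lt continuous_norm continuous_const).mem_nhds hx

theorem differentiableAt_pd {V : Euc n → ℝ} {x : Euc n} (h : ContDiffAt ℝ 2 V x) (i : Fin n) :
    DifferentiableAt ℝ (pd univ i V) x := by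
  have h1 : DifferentiableAt ℝ (fderiv ℝ V) x :=
    (h.fderiv_right (m := 1) (by norm_num)).differentiableAt (by norm_num)
  have h2 : pd univ i V = fun y => fderiv ℝ V y (EuclideanSpace.single i 1) := by
    ext y; rw [pd_univ]
  rw [h2]
  exact h1.clm_apply (differentiableAt_const _)

theorem IsStatic.add {V W : Euc n → ℝ} (hV : IsStatic α V) (hW : IsStatic α W) :
    IsStatic α (V + W) := by
  have h1 : ∀ y : Euc n, ‖y‖ < 1 → ∀ i, pd univ i (V + W) y = pd univ i V y + pd univ i W y :=
    fun y hy i => pd_add ((hV.smooth y hy).differentiableAt (by norm_num))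
      ((hW.smooth y hy).differentiableAt (by norm_num))
  refine ⟨fun x hx => (hV.smooth x hx).add (hW.smooth x hx), fun x hx i j => ?_,
    fun k => (hV.asy k).add (hW.asy k)⟩
  rw [pd_congr ((eventually_norm_lt_one hx).mono fun y hy => h1 y hy j),
    pd_add (differentiableAt_pd (hV.smooth x hx) j) (differentiableAt_pd (hW.smooth x hx) j),
    hV.hess x hx, hW.hess x hx]
  simp only [h1 x hx, Pi.add_apply, mul_add, Finset.sum_add_distrib]
  ring

theorem IsStatic.smul {V : Euc n → ℝ} (c : ℝ) (hV : IsStatic α V) : IsStatic α (c • V) := by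
  have h1 : ∀ y : Euc n, ‖y‖ < 1 → ∀ i, pd univ i (c • V) y = c * pd univ i V y :=
    fun y hy i => pd_const_mul c ((hV.smooth y hy).differentiableAt (by norm_num))
  refine ⟨fun x hx => contDiffAt_const.smul (hV.smooth x hx), fun x hx i j => ?_,
    fun k => (hV.asy k).const_mul c⟩
  rw [pd_congr ((eventually_norm_lt_one hx).mono fun y hy => h1 y hy j),
    pd_const_mul c (differentiableAt_pd (hV.smooth x hx) j), hV.hess x hx]
  simp only [h1 x hx, Pi.smul_apply, smul_eq_mul, mul_left_comm _ c, ← Finset.mul_sum]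
  ring

theorem contDiffAt_inv_rho {k : ℕ∞} {x : Euc n} (hx : ‖x‖ < 1) :
    ContDiffAt ℝ k (fun y : Euc n => (rho y)⁻¹) x := by
  have : ContDiffAt ℝ k (rho : Euc n → ℝ) x := by
    have h : ContDiff ℝ k (rho : Euc n → ℝ) :=
      ((contDiff_const (c := (1 : ℝ))).sub (contDiff_norm_sq ℝ)).div_const 2
    exact h.contDiffAt
  exact this.inv (rho_pos hx).ne'

theorem contDiffAt_coord {k : WithTop ℕ∞} {x : Euc n} (i : Fin n) :
    ContDiffAt ℝ k (fun y : Euc n => y i) x :=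
  (EuclideanSpace.proj i : Euc n →L[ℝ] ℝ).contDiff.contDiffAt

theorem isStatic_kernelZero (hα₀ : 0 ≤ α) (hα₁ : α ≤ 1) : IsStatic α (kernelZero n) := by
  have h0 : ∀ y : Euc n, ‖y‖ < 1 → kernelZero n y = (rho y)⁻¹ - 1 := fun y hy => by
    have := (rho_pos hy).ne'
    unfold kernelZero; field_simp
  have h1 : ∀ y : Euc n, ‖y‖ < 1 → ∀ i, pd univ i (kernelZero n) y
      = y i * ((rho y)⁻¹ * (rho y)⁻¹) := fun y hy i => by
    rw [pd_congr ((eventually_norm_lt_one hy).mono h0),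
      pd_sub (differentiableAt_inv_rho hy) (differentiableAt_const _), pd_const, pd_inv_rho hy]
    ring
  refine ⟨fun x hx => ?_, fun x hx i j => ?_, fun k => ?_⟩
  · exact ((contDiffAt_inv_rho (k := 2) hx).sub contDiffAt_const).congr_of_eventuallyEq
      ((eventually_norm_lt_one hx).mono h0)
  · have hi := differentiableAt_inv_rho hx
    rw [pd_congr ((eventually_norm_lt_one hx).mono fun y hy => h1 y hy j),
      pd_mul differentiableAt_coord (hi.fun_mul hi), pd_mul hi hi, pd_inv_rho hx, pd_coord]
    simp only [h1 x hx]
    -- The relation `|x|² = 1 - 2ρ` is what closes the Hessian identity.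
    rw [show ∑ k, x k * (x k * ((rho x)⁻¹ * (rho x)⁻¹)) = (1 - 2 * rho x) * (rho x)⁻¹ ^ 2 by
      rw [← sum_sq_eq_rho, Finset.sum_mul]; exact Finset.sum_congr rfl fun _ _ => by ring, h0 x hx]
    have := (rho_pos hx).ne'
    field_simp
    split_ifs <;> ring
  · exact ((asy_inv_rho hα₀ hα₁).sub ((Asy.const (1 : ℝ)).mono (by norm_num))).congr
      (eventually_far_norm_lt.mono h0)

theorem isStatic_kernelCoord (hα₀ : 0 ≤ α) (hα₁ : α ≤ 1) (l : Fin n) :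
    IsStatic α (kernelCoord l) := by
  have h0 : ∀ y : Euc n, kernelCoord l y = y l * (rho y)⁻¹ := fun y => rfl
  have h1 : ∀ y : Euc n, ‖y‖ < 1 → ∀ i, pd univ i (kernelCoord l) y
      = (if i = l then 1 else 0) * (rho y)⁻¹ + y l * (y i * ((rho y)⁻¹ * (rho y)⁻¹)) :=
    fun y hy i => by
    rw [pd_congr (Eventually.of_forall h0),
      pd_mul differentiableAt_coord (differentiableAt_inv_rho hy), pd_coord, pd_inv_rho hy]
    ring
  refine ⟨fun x hx => ?_, fun x hx i j => ?_, fun k => ?_⟩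
  · exact (contDiffAt_coord l).mul (contDiffAt_inv_rho (k := 2) hx)
  · have hi := differentiableAt_inv_rho hx
    have hc : ∀ j : Fin n, DifferentiableAt ℝ (fun y : Euc n => y j) x :=
      fun j => differentiableAt_coord
    rw [pd_congr ((eventually_norm_lt_one hx).mono fun y hy => h1 y hy j),
      pd_add ((differentiableAt_const _).fun_mul hi) ((hc l).fun_mul ((hc j).fun_mul (hi.fun_mul hi))),
      pd_const_mul _ hi, pd_mul (hc l) ((hc j).fun_mul (hi.fun_mul hi)),
      pd_mul (hc j) (hi.fun_mul hi), pd_mul hi hi, pd_inv_rho hx, pd_coord, pd_coord]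
    simp only [h1 x hx, h0]
    rw [show ∑ k, x k * ((if k = l then 1 else 0) * (rho x)⁻¹ + x l * (x k * ((rho x)⁻¹ * (rho x)⁻¹)))
      = x l * (rho x)⁻¹ + x l * (1 - 2 * rho x) * (rho x)⁻¹ ^ 2 by
        rw [← sum_sq_eq_rho]
        simp only [mul_add, Finset.sum_add_distrib, Finset.mul_sum, Finset.sum_mul]
        congr 1
        · simp
        · exact Finset.sum_congr rfl fun _ _ => by ring]
    have := (rho_pos hx).ne'
    field_simp
    split_ifs <;> ring
  · exact ((asy_coord hα₀ hα₁ l).mul (asy_inv_rho hα₀ hα₁)).mono (by norm_num)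

theorem isStatic_of_mem (hα₀ : 0 ≤ α) (hα₁ : α ≤ 1) {V : Euc n → ℝ} (hV : V ∈ kernelSpace n) :
    IsStatic α V := by
  unfold kernelSpace at hV
  induction hV using Submodule.span_induction with
  | mem V h =>
    rcases h with rfl | ⟨i, rfl⟩
    · exact isStatic_kernelZero hα₀ hα₁
    · exact isStatic_kernelCoord hα₀ hα₁ i
  | zero =>
    have := (isStatic_kernelZero (n := n) hα₀ hα₁).smul 0
    rwa [zero_smul] at this
  | add V W _ _ hV hW => exact hV.add hW
  | smul c V _ hV => exact hV.smul c

/-- The weight `ρ^{2-n}` which turns the divergence of one-forms with respect to the hyperbolic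
metric into a Euclidean one. -/
def fluxWeight (n : ℕ) (x : Euc n) : ℝ := rho x * (rho x)⁻¹ ^ (n - 1)

theorem pd_inv_rho_pow {x : Euc n} (hx : ‖x‖ < 1) (p : ℕ) (i : Fin n) :
    DifferentiableAt ℝ (fun y : Euc n => (rho y)⁻¹ ^ p) x ∧
    pd univ i (fun y : Euc n => (rho y)⁻¹ ^ p) x = p * (x i * (rho x)⁻¹) * (rho x)⁻¹ ^ p := by
  have hi := differentiableAt_inv_rho hx
  induction p with
  | zero => simp only [pow_zero]; exact ⟨differentiableAt_const _, by rw [pd_const]; simp⟩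
  | succ p ih =>
    simp only [pow_succ]
    refine ⟨ih.1.fun_mul hi, ?_⟩
    rw [pd_mul ih.1 hi, ih.2, pd_inv_rho hx]
    push_cast
    ring

theorem differentiableAt_fluxWeight {x : Euc n} (hx : ‖x‖ < 1) :
    DifferentiableAt ℝ (fluxWeight n) x := by
  rcases n with _ | n
  · have : fluxWeight 0 = fun _ => fluxWeight 0 0 := by
      ext y; rw [Subsingleton.elim y 0]
    rw [this]; exact differentiableAt_const _
  · exact differentiableAt_rho.fun_mul (pd_inv_rho_pow hx (n + 1 - 1) 0).1

theorem pd_fluxWeight (hn : 2 ≤ n) {x : Euc n} (hx : ‖x‖ < 1) (i : Fin n) :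
    pd univ i (fluxWeight n) x = (n - 2) * (x i * (rho x)⁻¹) * fluxWeight n x := by
  have h := pd_inv_rho_pow hx (n - 1) i
  have hρ := (rho_pos hx).ne'
  unfold fluxWeight
  rw [pd_mul differentiableAt_rho h.1, h.2, pd_rho, Nat.cast_sub (by omega)]
  push_cast
  field_simp
  ring

theorem asy_inv_rho_pow (hα₀ : 0 ≤ α) (hα₁ : α ≤ 1) (k p : ℕ) :
    Asy α k (-p) (fun y : Euc n => (rho y)⁻¹ ^ p) := by
  induction p with
  | zero => simpa using Asy.const (1 : ℝ)
  | succ p ih =>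
    simp only [pow_succ]
    exact (ih.mul (asy_inv_rho hα₀ hα₁)).mono (by push_cast; linarith)

theorem asy_fluxWeight (hn : 2 ≤ n) (hα₀ : 0 ≤ α) (hα₁ : α ≤ 1) {k : ℕ} :
    Asy α k (2 - n) (fluxWeight n) := by
  refine ((asy_rho hα₀ hα₁).mul (asy_inv_rho_pow hα₀ hα₁ k (n - 1))).mono ?_
  rw [Nat.cast_sub (by omega)]; push_cast; linarith

/-- The components of the mass form, multiplied by `ρ^{2-n}`. -/
def massVec (V : Euc n → ℝ) (e : Fin n → Fin n → Euc n → ℝ) (j : Fin n) (x : Euc n) : ℝ :=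
  fluxWeight n x * (V x * linDiv e j x
    + rho x * rho x * ((∑ i, e i i x) * pd univ j V x - ∑ i, pd univ i V x * e j i x))

/-- Both summands have order `σ - 2`: the growth `ρ⁻¹` of `V` costs one power and the derivative in
`linDiv`, or the one falling on `V`, another. The weight contributes `2 - n`. So the mass form
decays exactly when this count exceeds the threshold `σ = n`. -/
theorem asy_massVec (hn : 2 ≤ n) (hα₀ : 0 ≤ α) (hα₁ : α ≤ 1) {V : Euc n → ℝ}
    (hV : IsStatic α V) {e : Fin n → Fin n → Euc n → ℝ} {σ : ℝ}
    (he : ∀ i j, Asy α 2 (σ - 2) (e i j)) (j : Fin n) : Asy α 1 (σ - n) (massVec V e j) := by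
  have hρ : Asy α 1 1 (rho : Euc n → ℝ) := asy_rho hα₀ hα₁
  have he1 : ∀ i j, Asy α 1 (σ - 2) (e i j) := fun i j => (he i j).of_le (by norm_num)
  have hd : ∀ i, Asy α 1 (-2) (pd univ i V) := fun i => ((hV.asy 2).pd i).mono (by norm_num)
  have a1 : Asy α 1 (σ - 2) (fun x => V x * linDiv e j x) :=
    ((hV.asy 1).mul (asy_linDiv hα₀ hα₁ he j)).mono (by linarith)
  have a2 : Asy α 1 (σ - 4) (fun x => (∑ i, e i i x) * pd univ j V x) :=
    ((Asy.sum _ fun i _ => he1 i i).mul (hd j)).mono (by linarith)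
  have a3 : Asy α 1 (σ - 4) (fun x => ∑ i, pd univ i V x * e j i x) :=
    Asy.sum _ fun i _ => ((hd i).mul (he1 j i)).mono (by linarith)
  exact ((asy_fluxWeight hn hα₀ hα₁).mul (a1.add
    (((hρ.mul hρ).mul (a2.sub a3)).mono (s' := σ - 2) (by linarith)))).mono (by linarith)

/-- The divergence of the mass form is the linearized scalar curvature. -/
theorem div_massVec (hn : 2 ≤ n) {x : Euc n} (hx : ‖x‖ < 1) {V : Euc n → ℝ}
    (hV : IsStatic α V) {e : Fin n → Fin n → Euc n → ℝ}
    (hs : ∀ i j, e i j x = e j i x) (hd : ∀ i j, DifferentiableAt ℝ (e i j) x)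
    (hY : ∀ k, DifferentiableAt ℝ (linDiv e k) x) :
    ∑ j, pd univ j (massVec V e j) x = fluxWeight n x * V x * (rho x)⁻¹ ^ 2 * linScal e x := by
  have hρ := (rho_pos hx).ne'
  have dV := (hV.smooth x hx).differentiableAt (by norm_num)
  have dVi := fun i => differentiableAt_pd (hV.smooth x hx) i
  have dr : DifferentiableAt ℝ (fun y : Euc n => rho y * rho y) x :=
    differentiableAt_rho.fun_mul differentiableAt_rho
  have dt : DifferentiableAt ℝ (fun y => ∑ i, e i i y) x := DifferentiableAt.fun_sum fun i _ => hd i i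
  have ds : ∀ j, DifferentiableAt ℝ (fun y => ∑ i, pd univ i V y * e j i y) x :=
    fun j => DifferentiableAt.fun_sum fun i _ => (dVi i).fun_mul (hd j i)
  have hρj : ∀ j, pd univ j (fun y : Euc n => rho y * rho y) x = -2 * rho x * x j := fun j => by
    rw [pd_mul differentiableAt_rho differentiableAt_rho, pd_rho]; ring
  have h1 : ∀ j, pd univ j (massVec V e j) x = fluxWeight n x * (
      (n - 2) * (x j * (rho x)⁻¹) * (V x * linDiv e j x
        + rho x * rho x * ((∑ i, e i i x) * pd univ j V x - ∑ i, pd univ i V x * e j i x))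
      + (pd univ j V x * linDiv e j x + V x * pd univ j (linDiv e j) x)
      + (-2 * rho x * x j) * ((∑ i, e i i x) * pd univ j V x - ∑ i, pd univ i V x * e j i x)
      + rho x * rho x * ((∑ i, pd univ j (e i i) x) * pd univ j V x
        + (∑ i, e i i x) * pd univ j (pd univ j V) x
        - ∑ i, (pd univ j (pd univ i V) x * e j i x + pd univ i V x * pd univ j (e j i) x))) := by
    intro j
    unfold massVec
    rw [pd_mul (differentiableAt_fluxWeight hx) ((dV.fun_mul (hY j)).fun_add (dr.fun_mul
        ((dt.fun_mul (dVi j)).fun_sub (ds j)))),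
      pd_add (dV.fun_mul (hY j)) (dr.fun_mul ((dt.fun_mul (dVi j)).fun_sub (ds j))),
      pd_mul dV (hY j), pd_mul dr ((dt.fun_mul (dVi j)).fun_sub (ds j)),
      pd_sub (dt.fun_mul (dVi j)) (ds j), pd_mul dt (dVi j), pd_sum _ (fun i _ => hd i i),
      pd_sum _ (fun i _ => (dVi i).fun_mul (hd j i)), pd_fluxWeight hn hx, hρj]
    simp only [pd_mul (dVi _) (hd _ _)]
    ring
  set t := ∑ i, e i i x with ht
  -- `D` and `E` come from derivatives of the weights and from Christoffel symbols. `A` and `B` pair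
  -- `dV` with first derivatives of `e`; they occur with opposite signs in the two halves of the
  -- form and cancel at the end.
  set D := ∑ k, x k * pd univ k V x with hD
  set E := ∑ j, x j * ∑ i, pd univ i V x * e j i x with hE
  set A := ∑ j, pd univ j V x * ∑ i, pd univ i (e i j) x with hA
  set B := ∑ j, pd univ j V x * ∑ i, pd univ j (e i i) x with hB
  have s1 : ∑ j, pd univ j V x * linDiv e j x
      = rho x ^ 2 * (A - B) + (n - 2) * (rho x * E) + rho x * (t * D) := by
    have : E = ∑ j, pd univ j V x * ∑ m, x m * e j m x := by
      rw [hE]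
      simp only [Finset.mul_sum]
      rw [Finset.sum_comm]
      refine Finset.sum_congr rfl fun i _ => Finset.sum_congr rfl fun j _ => ?_
      rw [hs j i]; ring
    have e1 : ∀ j, pd univ j V x * linDiv e j x
        = rho x ^ 2 * (pd univ j V x * ∑ i, pd univ i (e i j) x)
          - rho x ^ 2 * (pd univ j V x * ∑ i, pd univ j (e i i) x)
          + (n - 2) * rho x * (pd univ j V x * ∑ m, x m * e j m x)
          + rho x * t * (x j * pd univ j V x) := fun j => by
      unfold linDiv; rw [← ht]; ring
    simp only [e1, Finset.sum_add_distrib, Finset.sum_sub_distrib, ← Finset.mul_sum]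
    rw [← hA, ← hB, ← hD, ← this]
    ring
  -- Here and in the next contraction the equation `Hess V = V b` enters. Together they say `(tr e)
  -- ΔV - ⟨Hess V, e⟩ = (n-1) V tr e`, the zeroth order term of the linearized scalar curvature.
  have s2 : ∑ j, pd univ j (pd univ j V) x
      = (2 - n) * D * (rho x)⁻¹ + n * (rho x)⁻¹ ^ 2 * V x := by
    simp only [hV.hess x hx, ← hD, if_true, one_mul, mul_one]
    rw [Finset.sum_add_distrib, ← Finset.sum_mul, Finset.sum_sub_distrib, Finset.sum_add_distrib,
      ← hD]
    simp only [Finset.sum_const, Finset.card_univ, Fintype.card_fin, nsmul_eq_mul]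
    ring
  have s3 : ∑ j, ∑ i, pd univ j (pd univ i V) x * e j i x
      = (2 * E - t * D) * (rho x)⁻¹ + (rho x)⁻¹ ^ 2 * V x * t := by
    have e1 : ∀ j i, pd univ j (pd univ i V) x * e j i x
        = (x j * (pd univ i V x * e j i x)) * (rho x)⁻¹ + (x i * (pd univ j V x * e i j x)) * (rho x)⁻¹
          + (if j = i then e j i x else 0) * ((rho x)⁻¹ ^ 2 * V x - D * (rho x)⁻¹) := fun j i => by
      rw [hV.hess x hx, hs i j, ← hD]
      split_ifs <;> ring
    simp only [e1, Finset.sum_add_distrib, ← Finset.sum_mul]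
    rw [Finset.sum_comm (f := fun j i => x i * (pd univ j V x * e i j x))]
    simp only [← Finset.mul_sum, Finset.sum_ite_eq, Finset.mem_univ, if_true]
    rw [← hE, ← ht]
    ring
  have s4 : ∑ j, ∑ i, pd univ i V x * pd univ j (e j i) x = A := by
    rw [Finset.sum_comm, hA]
    simp only [Finset.mul_sum]
  have s5 : ∑ j, (∑ i, pd univ j (e i i) x) * pd univ j V x = B :=
    Finset.sum_congr rfl fun j _ => mul_comm _ _
  have s6 : ∑ j, x j * (t * pd univ j V x - ∑ i, pd univ i V x * e j i x) = t * D - E := by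
    simp only [mul_sub, Finset.sum_sub_distrib]
    rw [← hE, hD, Finset.mul_sum]
    congr 1
    exact Finset.sum_congr rfl fun j _ => by ring
  have h2 : ∑ j, pd univ j (massVec V e j) x = fluxWeight n x * (
      (n - 2) * (rho x)⁻¹ * V x * ∑ j, x j * linDiv e j x
      + (n - 4) * rho x * ∑ j, x j * (t * pd univ j V x - ∑ i, pd univ i V x * e j i x)
      + ∑ j, pd univ j V x * linDiv e j x + V x * ∑ j, pd univ j (linDiv e j) x
      + rho x * rho x * (∑ j, (∑ i, pd univ j (e i i) x) * pd univ j V x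
        + t * ∑ j, pd univ j (pd univ j V) x
        - (∑ j, ∑ i, pd univ j (pd univ i V) x * e j i x
          + ∑ j, ∑ i, pd univ i V x * pd univ j (e j i) x))) := by
    have e1 : ∀ j, pd univ j (massVec V e j) x = fluxWeight n x * (
        ((n - 2) * (rho x)⁻¹ * V x) * (x j * linDiv e j x)
        + ((n - 4) * rho x) * (x j * (t * pd univ j V x - ∑ i, pd univ i V x * e j i x))
        + pd univ j V x * linDiv e j x + V x * pd univ j (linDiv e j) x
        + rho x * rho x * ((∑ i, pd univ j (e i i) x) * pd univ j V x
          + t * pd univ j (pd univ j V) x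
          - (∑ i, pd univ j (pd univ i V) x * e j i x
            + ∑ i, pd univ i V x * pd univ j (e j i) x))) := fun j => by
      rw [h1 j, Finset.sum_add_distrib]
      field_simp
      ring
    simp only [e1]
    rw [← Finset.mul_sum]
    simp only [Finset.sum_add_distrib, Finset.sum_sub_distrib,
      ← Finset.mul_sum (s := Finset.univ) (f := fun j => x j * linDiv e j x),
      ← Finset.mul_sum (s := Finset.univ) (f := fun j => x j * (_ - _)),
      ← Finset.mul_sum (s := Finset.univ) (f := fun j => pd univ j (linDiv e j) x),
      ← Finset.mul_sum (s := Finset.univ) (f := fun j => pd univ j (pd univ j V) x),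
      ← Finset.mul_sum (s := Finset.univ) (a := rho x * rho x)]
  rw [h2, s1, s2, s3, s4, s5, s6]
  unfold linScal
  rw [← ht]
  field_simp
  ring

theorem compInv_hypMetric {x : Euc n} (hx : ‖x‖ < 1) (i j : Fin n) :
    compInv (hypMetric n) x i j = rho x * rho x * if i = j then 1 else 0 := by
  have hρ := (rho_pos hx).ne'
  have : compInv (hypMetric n) x = (rho x * rho x) • (1 : Matrix (Fin n) (Fin n) ℝ) := by
    refine Matrix.inv_eq_left_inv ?_
    ext i j
    rw [Matrix.smul_mul, one_mul, Matrix.smul_apply, comp_hypMetric, Matrix.one_apply, smul_eq_mul]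
    field_simp
  rw [this, Matrix.smul_apply, Matrix.one_apply, smul_eq_mul]

theorem coordTrace_hypMetric (T : Euc n → Euc n →L[ℝ] Euc n →L[ℝ] ℝ) {x : Euc n} (hx : ‖x‖ < 1) :
    coordTrace (hypMetric n) T x = rho x * rho x * ∑ i, comp T x i i := by
  unfold coordTrace
  simp only [compInv_hypMetric hx]
  simp [Finset.mul_sum]

/-- The weight collects `ρ` from the `b`-unit normal and `ρ^{1-n}` from the area element, so the
hyperbolic flux becomes the Euclidean flux of `massVec`. The proof unfolds the covariant divergence
with the explicit symbols of `b`. -/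
theorem massForm_eq {T : Euc n → Euc n →L[ℝ] Euc n →L[ℝ] ℝ} {x : Euc n} (hx : ‖x‖ < 1)
    (V : Euc n → ℝ) (hs : ∀ᶠ y in 𝓝 x, ∀ i j, comp T y i j = comp T y j i)
    (hd : ∀ i j, DifferentiableAt ℝ (fun y => comp T y i j) x) (j : Fin n) :
    massForm V T j x * fluxWeight n x = massVec V (fun i j y => comp T y i j) j x := by
  have hρ := (rho_pos hx).ne'
  have hsx := hs.self_of_nhds
  have h1 : pd univ j (coordTrace (hypMetric n) T) x
      = -2 * rho x * x j * ∑ i, comp T x i i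
        + rho x * rho x * ∑ i, pd univ j (fun y => comp T y i i) x := by
    rw [pd_congr ((eventually_norm_lt_one hx).mono fun y hy => coordTrace_hypMetric T hy),
      pd_mul (differentiableAt_rho.fun_mul differentiableAt_rho)
        (DifferentiableAt.fun_sum fun i _ => hd i i),
      pd_mul differentiableAt_rho differentiableAt_rho, pd_sum _ fun i _ => hd i i, pd_rho]
    ring
  have h2 : coordDiv univ (hypMetric n) T j x
      = rho x * rho x * ∑ i, pd univ i (fun y => comp T y i j) x
        + (n - 2) * (rho x * ∑ m, x m * comp T x j m) - rho x * (x j * ∑ i, comp T x i i) := by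
    unfold coordDiv
    simp only [compInv_hypMetric hx, christoffel_hypMetric hx, sum_hypChr_mul]
    simp only [mul_assoc, ite_mul, one_mul, zero_mul, mul_ite, mul_zero, Finset.sum_ite_eq,
      Finset.mem_univ, if_true]
    have e1 : ∀ i, rho x * (rho x * (pd univ i (fun z => comp T z i j) x
        - (comp T x i j * x i + (comp T x i j * x i - ∑ l, x l * comp T x l j)) * (rho x)⁻¹
        - (comp T x i i * x j + (comp T x i j * x i
          - if i = j then ∑ l, x l * comp T x i l else 0)) * (rho x)⁻¹))
        = rho x * rho x * pd univ i (fun z => comp T z i j) x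
          - rho x * (3 * (x i * comp T x j i)) + rho x * ∑ l, x l * comp T x j l
          - rho x * x j * comp T x i i + rho x * (if i = j then ∑ l, x l * comp T x i l else 0) := by
      intro i
      simp only [hsx _ j]
      field_simp
      ring
    have e2 : ∀ a b c : ℝ, a + b - c = a + (b - c) := fun a b c => by ring
    simp only [e2] at e1 ⊢
    simp only [e1]
    simp only [← e2, Finset.sum_add_distrib, Finset.sum_sub_distrib, ← Finset.mul_sum,
      Finset.sum_ite_eq', Finset.mem_univ, if_true, Finset.sum_const, Finset.card_univ,
      Fintype.card_fin, nsmul_eq_mul]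
    ring
  unfold massForm massVec linDiv
  rw [h1, h2, coordTrace_hypMetric T hx]
  have h3 : ∑ i, gradUp univ (hypMetric n) V i x * comp T x i j
      = rho x * rho x * ∑ i, pd univ i V x * comp T x j i := by
    unfold gradUp
    simp only [compInv_hypMetric hx]
    rw [Finset.mul_sum]
    refine Finset.sum_congr rfl fun i _ => ?_
    rw [hsx i j]
    simp; ring
  rw [h3]
  ring

end MassForm

/-! ### Fluxes through spheres -/

section Flux

variable {n : ℕ}

/-- The integral of `h` over the sphere of radius `r`, parametrized by the unit sphere. -/
def sphInt (h : Euc n → ℝ) (r : ℝ) : ℝ :=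
  ∫ θ : Metric.sphere (0 : Euc n) 1, h (r • (θ : Euc n)) ∂(volume : Measure (Euc n)).toSphere

/-- Fubini after the measure preserving identification of the punctured space with sphere times
half-line. The first half transfers integrability of a divergence to its radial function, the second
converts integrals over space. -/
theorem integrable_polar (hn : 1 ≤ n) {h : Euc n → ℝ} (hh : Integrable h) :
    IntegrableOn (fun r => r ^ (n - 1) * sphInt h r) (Ioi 0) ∧
      ∫ x, h x = ∫ r in Ioi (0 : ℝ), r ^ (n - 1) * sphInt h r := by
  have : Nonempty (Fin n) := ⟨⟨0, hn⟩⟩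
  have hfr : Module.finrank ℝ (Euc n) = n := by simp
  set μ : Measure (Euc n) := volume with hμ
  have hmp := μ.measurePreserving_homeomorphUnitSphereProd
  rw [hfr] at hmp
  have hme := (homeomorphUnitSphereProd (Euc n)).measurableEmbedding
  set k : Metric.sphere (0 : Euc n) 1 × Ioi (0 : ℝ) → ℝ := fun p => h ((p.2 : ℝ) • (p.1 : Euc n))
    with hk
  have hkc : k ∘ homeomorphUnitSphereProd (Euc n) = h ∘ (↑) := by
    ext x
    simp only [hk, Function.comp_apply, homeomorphUnitSphereProd_apply_snd_coe,
      homeomorphUnitSphereProd_apply_fst_coe]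
    rw [smul_inv_smul₀ (norm_ne_zero_iff.2 x.2)]
  have hms : MeasurableSet ({0}ᶜ : Set (Euc n)) := (measurableSet_singleton 0).compl
  have hcomap : Integrable (h ∘ ((↑) : ({0}ᶜ : Set (Euc n)) → Euc n)) (μ.comap (↑)) := by
    rw [← integrableOn_iff_comap_subtypeVal hms]
    exact hh.integrableOn
  have hki : Integrable k (μ.toSphere.prod (Measure.volumeIoiPow (n - 1))) := by
    rw [← hkc] at hcomap
    exact (hmp.integrable_comp_emb hme).1 hcomap
  have hint : ∫ x, h x = ∫ r : Ioi (0 : ℝ), sphInt h r ∂(Measure.volumeIoiPow (n - 1)) := by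
    calc ∫ x, h x = ∫ x in ({0}ᶜ : Set (Euc n)), h x ∂μ := by
          rw [restrict_compl_singleton]
      _ = ∫ x : ({0}ᶜ : Set (Euc n)), h x ∂(μ.comap (↑)) :=
          (integral_subtype_comap hms h).symm
      _ = ∫ x : ({0}ᶜ : Set (Euc n)), k (homeomorphUnitSphereProd (Euc n) x) ∂(μ.comap (↑)) := by
          refine integral_congr_ae (Eventually.of_forall fun x => ?_)
          exact (congrFun hkc x).symm
      _ = ∫ p, k p ∂(μ.toSphere.prod (Measure.volumeIoiPow (n - 1))) :=
          hmp.integral_comp hme k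
      _ = _ := integral_prod_symm k hki
  have hir : Integrable (fun r : Ioi (0 : ℝ) => sphInt h r) (Measure.volumeIoiPow (n - 1)) :=
    hki.integral_prod_right
  constructor
  · rw [integrableOn_iff_comap_subtypeVal measurableSet_Ioi]
    rw [Measure.volumeIoiPow, integrable_withDensity_iff_integrable_smul' (by fun_prop)
      (Eventually.of_forall fun _ => ENNReal.ofReal_lt_top)] at hir
    refine hir.congr (Eventually.of_forall fun r => ?_)
    have : (0 : ℝ) ≤ (r : ℝ) ^ (n - 1) := pow_nonneg r.2.out.le _
    simp [ENNReal.toReal_ofReal this]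
  · rw [hint]
    simp only [Measure.volumeIoiPow, ENNReal.ofReal]
    rw [integral_withDensity_eq_integral_smul (by fun_prop),
      integral_subtype_comap measurableSet_Ioi fun a => Real.toNNReal (a ^ (n - 1)) • sphInt h a]
    refine setIntegral_congr_fun measurableSet_Ioi fun r hr => ?_
    have : (0 : ℝ) ≤ r ^ (n - 1) := pow_nonneg (mem_Ioi.1 hr).le _
    simp only [NNReal.smul_def, Real.coe_toNNReal _ this, smul_eq_mul]

/-- The shell `r₀ < |x| < 1`. -/
def shell (n : ℕ) (r₀ : ℝ) : Set (Euc n) := {x | r₀ < ‖x‖ ∧ ‖x‖ < 1}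

theorem isOpen_shell (r₀ : ℝ) : IsOpen (shell n r₀) :=
  (isOpen_lt continuous_const continuous_norm).inter (isOpen_lt continuous_norm continuous_const)

theorem norm_smul_sphere {r : ℝ} (hr : 0 ≤ r) (θ : Metric.sphere (0 : Euc n) 1) :
    ‖r • (θ : Euc n)‖ = r := by
  rw [norm_smul, Real.norm_eq_abs, abs_of_nonneg hr]
  simp

theorem continuousOn_sphInt {r₀ : ℝ} (hr₀ : 0 ≤ r₀) {h : Euc n → ℝ}
    (hh : ContinuousOn h (shell n r₀)) : ContinuousOn (sphInt h) (Ioo r₀ 1) := by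
  rw [continuousOn_iff_continuous_domRestrict]
  have hc : Continuous (Function.uncurry
      fun (r : Ioo r₀ 1) (θ : Metric.sphere (0 : Euc n) 1) => h ((r : ℝ) • (θ : Euc n))) := by
    refine hh.comp_continuous (by fun_prop) fun p => ?_
    have : ‖(p.1 : ℝ) • (p.2 : Euc n)‖ = p.1 := norm_smul_sphere (hr₀.trans p.1.2.1.le) p.2
    rw [shell, mem_ofPred_eq, this]
    exact p.1.2
  have : LocallyCompactSpace (Ioo r₀ 1) := isOpen_Ioo.locallyCompactSpace
  have := continuous_parametric_integral_of_continuous (μ := (volume : Measure (Euc n)).toSphere)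
    hc isCompact_univ
  simp only [Measure.restrict_univ] at this
  exact this

theorem integrable_sphere {r₀ r : ℝ} (hr₀ : 0 ≤ r₀) (hr : r ∈ Ioo r₀ 1) {h : Euc n → ℝ}
    (hh : ContinuousOn h (shell n r₀)) :
    Integrable (fun θ : Metric.sphere (0 : Euc n) 1 => h (r • (θ : Euc n)))
      (volume : Measure (Euc n)).toSphere := by
  have hc : Continuous (fun θ : Metric.sphere (0 : Euc n) 1 => h (r • (θ : Euc n))) := by
    refine hh.comp_continuous (by fun_prop) fun θ => ?_
    have : ‖r • (θ : Euc n)‖ = r := norm_smul_sphere (hr₀.trans hr.1.le) θ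
    rw [shell, mem_ofPred_eq, this]
    exact hr
  exact hc.integrable_of_hasCompactSupport (HasCompactSupport.of_compactSpace _)

theorem integral_pd_eq_zero {X : Euc n → ℝ} (hX : ContDiff ℝ 1 X) (hs : HasCompactSupport X)
    (j : Fin n) : Integrable (pd univ j X) ∧ ∫ x, pd univ j X x = 0 := by
  have h1 : pd univ j X = fun x => fderiv ℝ X x (EuclideanSpace.single j 1) := by
    ext x; rw [pd_univ]
  constructor
  · rw [h1]
    refine Continuous.integrable_of_hasCompactSupport
      ((hX.continuous_fderiv (by norm_num)).clm_apply continuous_const) ?_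
    exact (hs.fderiv (𝕜 := ℝ)).mono fun x hx => by
      rw [Function.mem_support] at hx ⊢
      intro h0; apply hx; rw [h0]; rfl
  · obtain ⟨D, hD⟩ := ContDiff.lipschitzWith_of_hasCompactSupport hs hX (by norm_num)
    -- Integration by parts against the constant function `1`; a compactly supported `C¹` function
    -- is Lipschitz. The direction is reversed to absorb the sign.
    have h2 := LipschitzWith.integral_lineDeriv_mul_eq (μ := (volume : Measure (Euc n)))
      (LipschitzWith.const (1 : ℝ)) hD hs (-(EuclideanSpace.single j (1 : ℝ)))
    simp only [neg_neg, mul_one] at h2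
    have h3 : ∀ x, lineDeriv ℝ (fun _ : Euc n => (1 : ℝ)) x (-(EuclideanSpace.single j (1 : ℝ))) = 0 := by
      intro x; simp [lineDeriv]
    simp only [h3, zero_mul, integral_zero] at h2
    rw [h1, h2]
    refine integral_congr_ae (Eventually.of_forall fun x => ?_)
    exact ((hX.differentiable (by norm_num)) x).lineDeriv_eq_fderiv.symm

variable {r₀ : ℝ} {F : Fin n → Euc n → ℝ}

/-- Weak form of the statement that the flux through `|x| = r` has derivative `r^{n-1} ∫ div F`. The
field `φ(|x|) F`, extended by zero, has compact support, so its divergence integrates to zero; polar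
coordinates give the formula without any boundary term. -/
theorem integral_test (hn : 1 ≤ n) (hr₀ : 0 < r₀) (hF : ∀ j, ContDiffOn ℝ 1 (F j) (shell n r₀))
    {φ : ℝ → ℝ} (hφ : ContDiff ℝ 1 φ) {c d : ℝ} (hc : r₀ < c) (hd : d < 1)
    (hφ0 : ∀ s, s ∉ Icc c d → φ s = 0) :
    ∫ r in Ioi (0 : ℝ), r ^ (n - 1) * (deriv φ r * sphInt (fun x => ∑ j, F j x * (x j / ‖x‖)) r
      + φ r * sphInt (fun x => ∑ j, pd univ j (F j) x) r) = 0 := by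
  have hφd : ∀ s, s ∉ Icc c d → deriv φ s = 0 := fun s hs => by
    have : φ =ᶠ[𝓝 s] fun _ => 0 :=
      mem_of_superset (isClosed_Icc.isOpen_compl.mem_nhds hs) fun t ht => hφ0 t ht
    rw [this.deriv_eq]; simp
  have hsh : ∀ x : Euc n, ‖x‖ ∈ Icc c d → x ∈ shell n r₀ := fun x hx =>
    ⟨hc.trans_le hx.1, hx.2.trans_lt hd⟩
  have hne : ∀ x ∈ shell n r₀, x ≠ 0 := fun x hx h0 => by
    have := hx.1; rw [h0, norm_zero] at this; linarith
  set X : Fin n → Euc n → ℝ := fun j x => φ ‖x‖ * F j x with hX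
  have hX0 : ∀ j (x : Euc n), ‖x‖ ∉ Icc c d → X j =ᶠ[𝓝 x] fun _ => 0 := fun j x hx =>
    mem_of_superset ((((isClosed_Icc (a := c) (b := d)).isOpen_compl).preimage continuous_norm).mem_nhds hx)
      fun y hy => by simp only [hX, mem_ofPred_eq]; rw [hφ0 _ hy, zero_mul]
  have hFat : ∀ j, ∀ x ∈ shell n r₀, ContDiffAt ℝ 1 (F j) x := fun j x hx =>
    (hF j).contDiffAt ((isOpen_shell r₀).mem_nhds hx)
  have hnat : ∀ x ∈ shell n r₀, ContDiffAt ℝ 1 (fun y : Euc n => φ ‖y‖) x := fun x hx =>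
    hφ.contDiffAt.comp x (contDiffAt_norm ℝ (hne x hx))
  have hXc : ∀ j, ContDiff ℝ 1 (X j) := fun j => contDiff_iff_contDiffAt.2 fun x => by
    by_cases hx : ‖x‖ ∈ Icc c d
    · exact (hnat x (hsh x hx)).mul (hFat j x (hsh x hx))
    · exact contDiffAt_const.congr_of_eventuallyEq (hX0 j x hx)
  have hXs : ∀ j, HasCompactSupport (X j) := fun j =>
    HasCompactSupport.intro (isCompact_closedBall (0 : Euc n) d) fun x hx => by
      refine (hX0 j x fun hx' => hx ?_).self_of_nhds
      simpa using hx'.2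
  have hdiv : ∀ j x, pd univ j (X j) x
      = deriv φ ‖x‖ * (F j x * (x j / ‖x‖)) + φ ‖x‖ * pd univ j (F j) x := by
    intro j x
    by_cases hx : ‖x‖ ∈ Icc c d
    · have hs := hsh x hx
      have h1 : HasFDerivAt (fun y : Euc n => φ ‖y‖) (deriv φ ‖x‖ • (‖x‖⁻¹ • innerSL ℝ x)) x := by
        have h2 : HasFDerivAt (fun y : Euc n => ‖y‖) (‖x‖⁻¹ • innerSL ℝ x) x := by
          have h3 := ((hasStrictFDerivAt_norm_sq x).hasFDerivAt).sqrt
            (by have := norm_pos_iff.2 (hne x hs); positivity)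
          simp only [Real.sqrt_sq (norm_nonneg _)] at h3
          refine h3.congr_fderiv ?_
          ext v
          have := (norm_pos_iff.2 (hne x hs)).ne'
          simp
          field_simp
        exact ((hφ.differentiable (by norm_num)) ‖x‖).hasDerivAt.comp_hasFDerivAt x h2
      have h4 : pd univ j (fun y : Euc n => φ ‖y‖) x = deriv φ ‖x‖ * (x j / ‖x‖) := by
        rw [pd_univ, h1.fderiv]
        simp [EuclideanSpace.inner_single_right]
        left; ring
      simp only [hX]
      rw [pd_mul h1.differentiableAt ((hFat j x hs).differentiableAt (by norm_num)), h4]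
      ring
    · rw [pd_congr (hX0 j x hx), pd_const, hφ0 _ hx, hφd _ hx]; ring
  have hi : Integrable (fun x => ∑ j, pd univ j (X j) x) :=
    integrable_finsetSum _ fun j _ => (integral_pd_eq_zero (hXc j) (hXs j) j).1
  have h0 : ∫ x, ∑ j, pd univ j (X j) x = 0 := by
    rw [integral_finsetSum _ fun j _ => (integral_pd_eq_zero (hXc j) (hXs j) j).1]
    exact Finset.sum_eq_zero fun j _ => (integral_pd_eq_zero (hXc j) (hXs j) j).2
  rw [(integrable_polar hn hi).2] at h0
  refine Eq.trans ?_ h0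
  refine setIntegral_congr_fun measurableSet_Ioi fun r hr => ?_
  have hr' : (0 : ℝ) ≤ r := (mem_Ioi.1 hr).le
  simp only
  congr 1
  have he : ∀ θ : Metric.sphere (0 : Euc n) 1, ∑ j, pd univ j (X j) (r • (θ : Euc n))
      = deriv φ r * (∑ j, F j (r • (θ : Euc n)) * ((r • (θ : Euc n)) j / ‖r • (θ : Euc n)‖))
        + φ r * ∑ j, pd univ j (F j) (r • (θ : Euc n)) := fun θ => by
    simp only [hdiv, norm_smul_sphere hr' θ, Finset.sum_add_distrib, Finset.mul_sum]
  unfold sphInt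
  simp only [he]
  by_cases hrc : r ∈ Icc c d
  · have hr2 : r ∈ Ioo r₀ 1 := ⟨hc.trans_le hrc.1, hrc.2.trans_lt hd⟩
    have c1 : ContinuousOn (fun x : Euc n => ∑ j, F j x * (x j / ‖x‖)) (shell n r₀) :=
      continuousOn_finsetSum _ fun j _ => (hF j).continuousOn.mul
        (ContinuousOn.div (by fun_prop) (by fun_prop) fun x hx => (norm_pos_iff.2 (hne x hx)).ne')
    have c2 : ContinuousOn (fun x : Euc n => ∑ j, pd univ j (F j) x) (shell n r₀) :=
      continuousOn_finsetSum _ fun j _ => by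
        have := (hF j).continuousOn_fderiv_of_isOpen (isOpen_shell r₀) (by norm_num)
        refine (this.clm_apply (continuousOn_const (c := EuclideanSpace.single j (1 : ℝ)))).congr
          fun x _ => ?_
        rw [pd_univ]
    rw [integral_add ((integrable_sphere hr₀.le hr2 c1).const_mul _)
      ((integrable_sphere hr₀.le hr2 c2).const_mul _), integral_const_mul, integral_const_mul]
  · rw [hφ0 r hrc, hφd r hrc]; simp

/-- Du Bois-Reymond's lemma: a continuous function annihilated by all derivatives of test functions
is constant. One inequality is enough, since `a` and `b` may be exchanged. -/
theorem integral_deriv_mul_eq_zero {G : ℝ → ℝ} {a b : ℝ}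
    (ha : a ∈ Ioo r₀ 1) (hb : b ∈ Ioo r₀ 1) (hG : ContinuousOn G (Ioo r₀ 1))
    (h : ∀ φ : ℝ → ℝ, ContDiff ℝ 1 φ → ∀ c d, r₀ < c → c ≤ d → d < 1 →
      (∀ s, s ∉ Icc c d → φ s = 0) → ∫ s in c..d, deriv φ s * G s = 0) : G b ≤ G a := by
  by_contra! hlt
  obtain ⟨m, hm1, hmb⟩ := exists_between hlt
  obtain ⟨m', hmm, hm2⟩ := exists_between hmb
  have hop : IsOpen (Ioo r₀ 1 : Set ℝ) := isOpen_Ioo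
  have ea : ∀ᶠ s in 𝓝 a, s ∈ Ioo r₀ 1 ∧ G s < m :=
    (hop.mem_nhds ha |> fun h => (Filter.eventually_mem_set.2 h)).and
      ((hG.continuousAt (hop.mem_nhds ha)).eventually_lt continuousAt_const hm1)
  have eb : ∀ᶠ s in 𝓝 b, s ∈ Ioo r₀ 1 ∧ m' < G s :=
    (hop.mem_nhds hb |> fun h => (Filter.eventually_mem_set.2 h)).and
      (continuousAt_const.eventually_lt (hG.continuousAt (hop.mem_nhds hb)) hm2)
  obtain ⟨δ, hδ, hδ'⟩ := Metric.eventually_nhds_iff_ball.1 ea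
  obtain ⟨ε, hε, hε'⟩ := Metric.eventually_nhds_iff_ball.1 eb
  let f₁ : ContDiffBump a := ⟨δ / 4, δ / 2, by positivity, by linarith⟩
  let f₂ : ContDiffBump b := ⟨ε / 4, ε / 2, by positivity, by linarith⟩
  set ψ₁ : ℝ → ℝ := f₁.normed volume with hψ₁
  set ψ₂ : ℝ → ℝ := f₂.normed volume with hψ₂
  have c1 : Continuous ψ₁ := f₁.continuous_normed
  have c2 : Continuous ψ₂ := f₂.continuous_normed
  have s1 : ∀ s, s ∉ Metric.ball a (δ / 2) → ψ₁ s = 0 := fun s hs => by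
    by_contra h0
    have : s ∈ Function.support ψ₁ := h0
    rw [hψ₁, f₁.support_normed_eq] at this
    exact hs this
  have s2 : ∀ s, s ∉ Metric.ball b (ε / 2) → ψ₂ s = 0 := fun s hs => by
    by_contra h0
    have : s ∈ Function.support ψ₂ := h0
    rw [hψ₂, f₂.support_normed_eq] at this
    exact hs this
  have ba : Metric.closedBall a (δ / 2) ⊆ Metric.ball a δ :=
    Metric.closedBall_subset_ball (by linarith)
  have bb : Metric.closedBall b (ε / 2) ⊆ Metric.ball b ε :=
    Metric.closedBall_subset_ball (by linarith)
  have mem : ∀ {p q : ℝ}, 0 ≤ q → p - q ∈ Metric.closedBall p q ∧ p + q ∈ Metric.closedBall p q := by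
    intro p q hq
    simp [abs_of_nonneg hq]
  have a1 := (hδ' _ (ba (mem (by positivity : 0 ≤ δ / 2)).1)).1
  have a2 := (hδ' _ (ba (mem (by positivity : 0 ≤ δ / 2)).2)).1
  have b1 := (hε' _ (bb (mem (by positivity : 0 ≤ ε / 2)).1)).1
  have b2 := (hε' _ (bb (mem (by positivity : 0 ≤ ε / 2)).2)).1
  set c := min (a - δ / 2) (b - ε / 2) with hc
  set d := max (a + δ / 2) (b + ε / 2) with hd
  have hca : c ≤ a - δ / 2 := min_le_left _ _
  have hcb : c ≤ b - ε / 2 := min_le_right _ _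
  have hda : a + δ / 2 ≤ d := le_max_left _ _
  have hdb : b + ε / 2 ≤ d := le_max_right _ _
  have hrc : r₀ < c := lt_min a1.1 b1.1
  have hd1 : d < 1 := max_lt a2.2 b2.2
  have hcd : c ≤ d := by linarith
  have z1 : ∀ s, s ≤ c ∨ d ≤ s → ψ₁ s = 0 := fun s hs => s1 s fun hs' => by
    rw [Real.ball_eq_Ioo] at hs'
    rcases hs with hs | hs <;> linarith [hs'.1, hs'.2]
  have z2 : ∀ s, s ≤ c ∨ d ≤ s → ψ₂ s = 0 := fun s hs => s2 s fun hs' => by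
    rw [Real.ball_eq_Ioo] at hs'
    rcases hs with hs | hs <;> linarith [hs'.1, hs'.2]
  have itot : ∀ ψ : ℝ → ℝ, (∀ s, s ≤ c ∨ d ≤ s → ψ s = 0) → ∫ s in c..d, ψ s = ∫ s, ψ s := by
    intro ψ hψ
    rw [intervalIntegral.integral_of_le hcd, ← integral_Icc_eq_integral_Ioc]
    refine setIntegral_eq_integral_of_forall_compl_eq_zero fun s hs => hψ s ?_
    by_contra! h0
    exact hs ⟨h0.1.le, h0.2.le⟩
  have t1 : ∫ s in c..d, ψ₁ s = 1 := by rw [itot _ z1]; exact f₁.integral_normed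
  have t2 : ∫ s in c..d, ψ₂ s = 1 := by rw [itot _ z2]; exact f₂.integral_normed
  -- The test function with derivative a unit bump at `a` minus a unit bump at `b`; as the two
  -- masses cancel, it vanishes again past `d`. Testing with it equates an average of `G` near `a`,
  -- at most `m`, with one near `b`, at least `m' > m`.
  set φ : ℝ → ℝ := fun s => ∫ t in c..s, (ψ₁ t - ψ₂ t) with hφ
  have cψ : Continuous fun t => ψ₁ t - ψ₂ t := c1.sub c2
  have hder : ∀ s, HasDerivAt φ (ψ₁ s - ψ₂ s) s := fun s =>
    cψ.integral_hasStrictDerivAt c s |>.hasDerivAt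
  have hφ1 : ContDiff ℝ 1 φ := by
    rw [contDiff_one_iff_deriv]
    refine ⟨fun s => (hder s).differentiableAt, ?_⟩
    rw [show deriv φ = fun s => ψ₁ s - ψ₂ s from funext fun s => (hder s).deriv]
    exact cψ
  have hφ0 : ∀ s, s ∉ Icc c d → φ s = 0 := by
    intro s hs
    have h0 : ∀ t, t ≤ c ∨ d ≤ t → ψ₁ t - ψ₂ t = 0 := fun t ht => by rw [z1 t ht, z2 t ht, sub_zero]
    rw [mem_Icc, not_and_or, not_le, not_le] at hs
    rcases hs with hs | hs
    · simp only [hφ]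
      rw [intervalIntegral.integral_symm, intervalIntegral.integral_of_le hs.le,
        setIntegral_eq_zero_of_forall_eq_zero, neg_zero]
      · exact fun t ht => h0 t (Or.inl ht.2)
    · simp only [hφ]
      rw [← intervalIntegral.integral_add_adjacent_intervals (b := d)
        (cψ.intervalIntegrable _ _) (cψ.intervalIntegrable _ _),
        intervalIntegral.integral_sub (c1.intervalIntegrable _ _) (c2.intervalIntegrable _ _), t1, t2,
        intervalIntegral.integral_of_le hs.le, setIntegral_eq_zero_of_forall_eq_zero]
      · norm_num
      · exact fun t ht => h0 t (Or.inr ht.1.le)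
  have hz := h φ hφ1 c d hrc hcd hd1 hφ0
  simp only [(hder _).deriv] at hz
  have hsub : Icc c d ⊆ Ioo r₀ 1 := fun s hs => ⟨hrc.trans_le hs.1, hs.2.trans_lt hd1⟩
  have hGi : ContinuousOn G (uIcc c d) := by rw [uIcc_of_le hcd]; exact hG.mono hsub
  have i1 : IntervalIntegrable (fun s => ψ₁ s * G s) volume c d :=
    (c1.continuousOn.mul hGi).intervalIntegrable
  have i2 : IntervalIntegrable (fun s => ψ₂ s * G s) volume c d :=
    (c2.continuousOn.mul hGi).intervalIntegrable
  simp only [sub_mul] at hz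
  rw [intervalIntegral.integral_sub i1 i2, sub_eq_zero] at hz
  have u1 : ∫ s in c..d, ψ₁ s * G s ≤ m := by
    calc ∫ s in c..d, ψ₁ s * G s ≤ ∫ s in c..d, ψ₁ s * m := by
          refine intervalIntegral.integral_mono_on hcd i1
            ((c1.mul continuous_const).intervalIntegrable _ _) fun s _ => ?_
          by_cases hs : s ∈ Metric.ball a (δ / 2)
          · exact mul_le_mul_of_nonneg_left (hδ' s (ba (Metric.ball_subset_closedBall hs))).2.le (f₁.nonneg_normed s)
          · rw [s1 s hs]; simp
      _ = m := by rw [intervalIntegral.integral_mul_const, t1, one_mul]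
  have u2 : m' ≤ ∫ s in c..d, ψ₂ s * G s := by
    calc m' = ∫ s in c..d, ψ₂ s * m' := by rw [intervalIntegral.integral_mul_const, t2, one_mul]
      _ ≤ ∫ s in c..d, ψ₂ s * G s := by
          refine intervalIntegral.integral_mono_on hcd
            ((c2.mul continuous_const).intervalIntegrable _ _) i2 fun s _ => ?_
          by_cases hs : s ∈ Metric.ball b (ε / 2)
          · exact mul_le_mul_of_nonneg_left (hε' s (bb (Metric.ball_subset_closedBall hs))).2.le
              (f₂.nonneg_normed s)
          · rw [s2 s hs]; simp
  linarith

/-- The flux `Φ` and a primitive `P` of the radial divergence `D` have the same weak derivative, so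
they differ by a constant. Since `D` is integrable up to `r = 1`, the primitive is continuous there,
and so the flux has a limit. -/
theorem exists_tendsto_flux (hn : 1 ≤ n) (hr₀ : 0 < r₀) (hr₁ : r₀ < 1)
    (hF : ∀ j, ContDiffOn ℝ 1 (F j) (shell n r₀))
    (hdiv : IntegrableOn (fun x => ∑ j, pd univ j (F j) x) (shell n r₀)) :
    ∃ L, Tendsto (fun r => r ^ (n - 1) * sphInt (fun x => ∑ j, F j x * (x j / ‖x‖)) r)
      (𝓝[<] 1) (𝓝 L) := by
  set Φ : ℝ → ℝ := fun r => r ^ (n - 1) * sphInt (fun x => ∑ j, F j x * (x j / ‖x‖)) r with hΦ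
  set D : ℝ → ℝ := fun r => r ^ (n - 1) * sphInt (fun x => ∑ j, pd univ j (F j) x) r with hD
  have hne : ∀ x ∈ shell n r₀, ‖x‖ ≠ 0 := fun x hx => by have := hx.1; linarith
  have c1 : ContinuousOn Φ (Ioo r₀ 1) :=
    ((continuous_pow (n - 1)).continuousOn).mul (continuousOn_sphInt hr₀.le
      (continuousOn_finsetSum _ fun j _ => (hF j).continuousOn.mul
        (ContinuousOn.div (by fun_prop) (by fun_prop) hne)))
  have c2 : ContinuousOn D (Ioo r₀ 1) :=
    ((continuous_pow (n - 1)).continuousOn).mul (continuousOn_sphInt hr₀.le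
      (continuousOn_finsetSum _ fun j _ => by
        have := (hF j).continuousOn_fderiv_of_isOpen (isOpen_shell r₀) (by norm_num)
        refine (this.clm_apply (continuousOn_const (c := EuclideanSpace.single j (1 : ℝ)))).congr
          fun x _ => ?_
        rw [pd_univ]))
  have hDi : IntegrableOn D (Ioo r₀ 1) := by
    rw [← integrable_indicator_iff (isOpen_shell r₀).measurableSet] at hdiv
    refine ((integrable_polar hn hdiv).1.mono_set
      (fun r hr => hr₀.trans hr.1 : Ioo r₀ 1 ⊆ Ioi 0)).congr_fun (fun r hr => ?_) measurableSet_Ioo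
    simp only [hD]
    congr 1
    unfold sphInt
    refine integral_congr_ae (Eventually.of_forall fun θ => ?_)
    simp only
    rw [indicator_of_mem]
    rw [shell, mem_ofPred_eq, norm_smul_sphere (hr₀.trans hr.1).le]
    exact hr
  obtain ⟨a, ha, ha1⟩ := exists_between hr₁
  have haI : a ∈ Ioo r₀ 1 := ⟨ha, ha1⟩
  -- Extension by zero makes `D` integrable on the whole line, so that its primitive is defined and
  -- continuous at the endpoint `1`.
  set D' : ℝ → ℝ := (Ioo r₀ 1).indicator D with hD'
  have hD'i : Integrable D' := (integrable_indicator_iff measurableSet_Ioo).2 hDi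
  have hD'e : ∀ r ∈ Ioo r₀ 1, D' r = D r := fun r hr => indicator_of_mem hr D
  set P : ℝ → ℝ := fun s => ∫ t in a..s, D' t with hP
  have hPc : Continuous P := intervalIntegral.continuous_primitive
    (fun _ _ => hD'i.intervalIntegrable) a
  have hPd : ∀ s ∈ Ioo r₀ 1, HasDerivAt P (D s) s := fun s hs => by
    have hcs : ContinuousAt D' s := by
      refine (c2.continuousAt (isOpen_Ioo.mem_nhds hs)).congr ?_
      exact mem_of_superset (isOpen_Ioo.mem_nhds hs) fun t ht => (hD'e t ht).symm
    rw [← hD'e s hs]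
    exact intervalIntegral.integral_hasDerivAt_right hD'i.intervalIntegrable
      hD'i.aestronglyMeasurable.stronglyMeasurableAtFilter hcs
  have hG : ContinuousOn (fun s => Φ s - P s) (Ioo r₀ 1) := c1.sub hPc.continuousOn
  have htest : ∀ φ : ℝ → ℝ, ContDiff ℝ 1 φ → ∀ c d, r₀ < c → c ≤ d → d < 1 →
      (∀ s, s ∉ Icc c d → φ s = 0) → ∫ s in c..d, deriv φ s * (Φ s - P s) = 0 := by
    intro φ hφ c d hc hcd hd hφ0
    -- The interval is enlarged slightly because `φ` is only known to vanish outside `[c, d]`, and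
    -- the integration by parts for `P` needs it to vanish at the endpoints.
    obtain ⟨c', hc', hc''⟩ := exists_between hc
    obtain ⟨d', hd', hd''⟩ := exists_between hd
    have hcd' : c' ≤ d' := by linarith
    have hφd : ∀ s, s ∉ Icc c d → deriv φ s = 0 := fun s hs => by
      have : φ =ᶠ[𝓝 s] fun _ => 0 :=
        mem_of_superset (isClosed_Icc.isOpen_compl.mem_nhds hs) fun t ht => hφ0 t ht
      rw [this.deriv_eq]; simp
    have hsub : Icc c' d' ⊆ Ioo r₀ 1 := fun s hs => ⟨hc'.trans_le hs.1, hs.2.trans_lt hd''⟩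
    have cφ' : Continuous (deriv φ) := hφ.continuous_deriv (by norm_num)
    have iu : uIcc c' d' = Icc c' d' := uIcc_of_le hcd'
    have k1 : ∫ s in c'..d', (deriv φ s * Φ s + φ s * D s) = 0 := by
      rw [← integral_test hn hr₀ hF hφ hc hd hφ0, intervalIntegral.integral_of_le hcd',
        ← integral_Icc_eq_integral_Ioc]
      rw [setIntegral_eq_of_subset_of_forall_sdiff_eq_zero measurableSet_Ioi
        (fun s hs => hr₀.trans (hsub hs).1 : Icc c' d' ⊆ Ioi 0)]
      · refine setIntegral_congr_fun measurableSet_Icc fun s _ => ?_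
        simp only [hΦ, hD]; ring
      · intro s hs
        have : s ∉ Icc c d := fun h => hs.2 ⟨hc''.le.trans h.1, h.2.trans hd'.le⟩
        rw [hφ0 s this, hφd s this]; simp
    have i1 : IntervalIntegrable (fun s => deriv φ s * Φ s) volume c' d' :=
      (cφ'.continuousOn.mul (by rw [iu]; exact c1.mono hsub)).intervalIntegrable
    have i2 : IntervalIntegrable (fun s => φ s * D s) volume c' d' :=
      (hφ.continuous.continuousOn.mul (by rw [iu]; exact c2.mono hsub)).intervalIntegrable
    have i3 : IntervalIntegrable (fun s => deriv φ s * P s) volume c' d' :=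
      (cφ'.mul hPc).intervalIntegrable _ _
    have i4 : IntervalIntegrable D volume c' d' :=
      ContinuousOn.intervalIntegrable (by rw [iu]; exact c2.mono hsub)
    have k2 : ∫ s in c'..d', (deriv φ s * P s + φ s * D s) = 0 := by
      rw [intervalIntegral.integral_deriv_mul_eq_sub
        (fun s _ => ((hφ.differentiable (by norm_num)) s).hasDerivAt)
        (fun s hs => hPd s (hsub (iu ▸ hs))) (cφ'.intervalIntegrable _ _) i4,
        hφ0 c' fun h => absurd h.1 (not_le.2 hc''), hφ0 d' fun h => absurd h.2 (not_le.2 hd')]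
      simp
    have k3 : ∫ s in c'..d', deriv φ s * (Φ s - P s) = 0 := by
      rw [intervalIntegral.integral_add i1 i2] at k1
      rw [intervalIntegral.integral_add i3 i2] at k2
      simp only [mul_sub]
      rw [intervalIntegral.integral_sub i1 i3]
      linarith
    rw [intervalIntegral.integral_of_le hcd', ← integral_Icc_eq_integral_Ioc] at k3
    rw [intervalIntegral.integral_of_le hcd, ← integral_Icc_eq_integral_Ioc, ← k3]
    refine (setIntegral_eq_of_subset_of_forall_sdiff_eq_zero measurableSet_Icc
      (Icc_subset_Icc hc''.le hd'.le) fun s hs => ?_).symm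
    rw [hφd s hs.2, zero_mul]
  have hcst : ∀ s ∈ Ioo r₀ 1, Φ s = Φ a - P a + P s := fun s hs => by
    have e1 := integral_deriv_mul_eq_zero haI hs hG htest
    have e2 := integral_deriv_mul_eq_zero hs haI hG htest
    linarith
  refine ⟨Φ a - P a + P 1, ?_⟩
  refine Tendsto.congr' (f₁ := fun s => Φ a - P a + P s) ?_
    ((continuous_const.add hPc).continuousAt.tendsto.mono_left nhdsWithin_le_nhds)
  filter_upwards [Ioo_mem_nhdsLT hr₁] with s hs using (hcst s hs).symm

end Flux

/-! ### The mass of an asymptotically hyperbolic metric in the ball model -/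

section Mass

variable {n : ℕ} {α τ : ℝ}

theorem eventually_far_sphere {p : Euc n → Prop} (h : ∀ᶠ x in far n, p x) :
    ∀ᶠ r in 𝓝[<] (1 : ℝ), 0 < r ∧ ∀ θ : Metric.sphere (0 : Euc n) 1, p (r • (θ : Euc n)) := by
  obtain ⟨r₀, h0, h1, h⟩ := eventually_far_iff_norm.1 h
  filter_upwards [Ioo_mem_nhdsLT h1] with r hr
  have hr0 : 0 < r := h0.trans hr.1
  refine ⟨hr0, fun θ => h _ ?_ ?_⟩ <;> rw [norm_smul_sphere hr0.le]
  exacts [hr.1, hr.2]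

/-- The Euclidean flux of the vector field `massVec V e` through the sphere of radius `r`. -/
def sphFlux (V : Euc n → ℝ) (e : Fin n → Fin n → Euc n → ℝ) (r : ℝ) : ℝ :=
  r ^ (n - 1) * sphInt (fun x => ∑ j, massVec V e j x * (x j / ‖x‖)) r

theorem massFlux_eq {T : Euc n → Euc n →L[ℝ] Euc n →L[ℝ] ℝ}
    (hs : ∀ᶠ x in far n, ∀ i j, comp T x i j = comp T x j i)
    (hd : ∀ᶠ x in far n, ∀ i j, DifferentiableAt ℝ (fun y => comp T y i j) x) (V : Euc n → ℝ) :
    ∀ᶠ r in 𝓝[<] (1 : ℝ), massFlux V T r =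
      (2 * (volume : Measure (Euc n)).toSphere.real univ * ((n : ℝ) - 1))⁻¹ *
        sphFlux V (fun i j y => comp T y i j) r := by
  have h := (eventually_far_nhds hs).and (hd.and eventually_far_norm_lt)
  filter_upwards [eventually_far_sphere h] with r ⟨hr, h⟩
  unfold massFlux sphFlux sphInt
  rw [← MeasureTheory.integral_const_mul (r ^ (n - 1))]
  congr 1
  refine integral_congr_ae (Eventually.of_forall fun θ => ?_)
  obtain ⟨h1, h2, h3⟩ := h θ
  simp only
  rw [Finset.sum_mul, Finset.mul_sum]
  refine Finset.sum_congr rfl fun j _ => ?_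
  have hj : (r • (θ : Euc n)) j = r * (θ : Euc n) j := rfl
  rw [← massForm_eq h3 V h1 h2 j, norm_smul_sphere hr.le, hj, mul_div_cancel_left₀ _ hr.ne']
  unfold fluxWeight
  rw [div_eq_mul_inv r, mul_pow]
  ring

theorem tendsto_sphInt_zero {h : Euc n → ℝ} (hh : Tendsto h (far n) (𝓝 0)) :
    Tendsto (sphInt h) (𝓝[<] 1) (𝓝 0) := by
  set μ := (volume : Measure (Euc n)).toSphere.real univ with hμ
  have hμ0 : 0 ≤ μ := measureReal_nonneg
  rw [Metric.tendsto_nhds]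
  intro ε hε
  -- Adding `1` to the total mass of the sphere avoids a separate argument that this mass is
  -- nonzero.
  have hδ : 0 < ε / (μ + 1) := by positivity
  have h1 := (Metric.tendsto_nhds.1 hh) _ hδ
  filter_upwards [eventually_far_sphere h1] with r ⟨_, hr⟩
  rw [dist_zero_right]
  unfold sphInt
  refine (norm_integral_le_of_norm_le_const (C := ε / (μ + 1))
    (Eventually.of_forall fun θ => ?_)).trans_lt ?_
  · have := hr θ
    rw [dist_zero_right] at this
    exact this.le
  · rw [← hμ, div_mul_eq_mul_div, div_lt_iff₀ (by positivity)]
    nlinarith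

theorem asy_normal {k : ℕ} {s : ℝ} {F : Fin n → Euc n → ℝ} (hF : ∀ j, Asy α k s (F j)) (hs : 0 < s) :
    Tendsto (fun x => ∑ j, F j x * (x j / ‖x‖)) (far n) (𝓝 0) := by
  rw [← Finset.sum_const_zero (s := (Finset.univ : Finset (Fin n)))]
  refine tendsto_finsetSum _ fun j _ => ?_
  refine squeeze_zero_norm (a := fun x => ‖F j x‖) (fun x => ?_) (by
    simpa using ((hF j).tendsto_zero hs).norm)
  rw [norm_mul]
  refine mul_le_of_le_one_right (norm_nonneg _) ?_
  rw [norm_div, norm_norm]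
  exact div_le_one_of_le₀ (PiLp.norm_apply_le x j) (norm_nonneg _)

/-- The integrand has order `σ - n > 0`, and Euclidean spheres near radius `1` have bounded area.
Applied with `σ = 2τ`, this is the reason the graph term does not contribute to the mass. -/
theorem tendsto_sphFlux_zero (hn : 2 ≤ n) (hα₀ : 0 ≤ α) (hα₁ : α ≤ 1) {V : Euc n → ℝ}
    (hV : IsStatic α V) {e : Fin n → Fin n → Euc n → ℝ} {σ : ℝ} (hσ : n < σ)
    (he : ∀ i j, Asy α 2 (σ - 2) (e i j)) : Tendsto (sphFlux V e) (𝓝[<] 1) (𝓝 0) := by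
  have h1 := tendsto_sphInt_zero (asy_normal (asy_massVec hn hα₀ hα₁ hV he) (by linarith))
  have h2 : Tendsto (fun r : ℝ => r ^ (n - 1)) (𝓝[<] 1) (𝓝 (1 ^ (n - 1))) :=
    ((continuous_pow (n - 1)).tendsto 1).mono_left nhdsWithin_le_nhds
  have h3 := h2.mul h1
  rw [mul_zero] at h3
  exact h3

theorem exists_shell {p : Euc n → Prop} (h : ∀ᶠ x in far n, p x) :
    ∃ r, 0 < r ∧ r < 1 ∧ ∀ x ∈ shell n r, p x := by
  obtain ⟨r, h0, h1, h⟩ := eventually_far_iff_norm.1 h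
  exact ⟨r, h0, h1, fun x hx => h x hx.1 hx.2⟩

theorem sphInt_add_of_asy {F G : Euc n → ℝ} (hF : ∀ᶠ x in far n, ContinuousAt F x)
    (hG : ∀ᶠ x in far n, ContinuousAt G x) :
    ∀ᶠ r in 𝓝[<] (1 : ℝ), sphInt (fun x => F x + G x) r = sphInt F r + sphInt G r := by
  obtain ⟨r, h0, h1, h⟩ := exists_shell (hF.and hG)
  filter_upwards [Ioo_mem_nhdsLT h1] with s hs
  exact integral_add (integrable_sphere h0.le hs fun x hx => (h x hx).1.continuousWithinAt)
    (integrable_sphere h0.le hs fun x hx => (h x hx).2.continuousWithinAt)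

theorem sphInt_congr_far {F G : Euc n → ℝ} (h : ∀ᶠ x in far n, F x = G x) :
    ∀ᶠ r in 𝓝[<] (1 : ℝ), sphInt F r = sphInt G r := by
  filter_upwards [eventually_far_sphere h] with r ⟨_, hr⟩
  unfold sphInt
  simp only [hr]

theorem eventually_continuousAt_normal {k : ℕ} {s : ℝ} {F : Fin n → Euc n → ℝ}
    (hF : ∀ j, Asy α k s (F j)) :
    ∀ᶠ x in far n, ContinuousAt (fun x => ∑ j, F j x * (x j / ‖x‖)) x := by
  have h0 : ∀ᶠ x in far n, x ≠ 0 := by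
    filter_upwards [eventually_far_iff_norm.2 ⟨1 / 2, by norm_num, by norm_num,
      fun x hx _ => hx⟩] with x (hx : 1 / 2 < ‖x‖) h0
    rw [h0, norm_zero] at hx; linarith
  filter_upwards [eventually_all.2 fun j => (hF j).eventually_contDiffAt, h0] with x hx h0
  refine tendsto_finsetSum _ fun j _ => (hx j).continuousAt.mul ?_
  exact ContinuousAt.div (by fun_prop) (by fun_prop) (norm_ne_zero_iff.2 h0)

/-- Stated for two pairs `(V, e)` and `(W, e')` so that it serves additivity in `V`, for linearity
of the mass, as well as additivity in `e`, for its stability. -/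
theorem sphFlux_add {V W U : Euc n → ℝ} {e e' e'' : Fin n → Fin n → Euc n → ℝ} {k : ℕ} {s s' : ℝ}
    (hV : ∀ j, Asy α k s (massVec V e j)) (hW : ∀ j, Asy α k s' (massVec W e' j))
    (h : ∀ᶠ x in far n, ∀ j, massVec U e'' j x = massVec V e j x + massVec W e' j x) :
    ∀ᶠ r in 𝓝[<] (1 : ℝ), sphFlux U e'' r = sphFlux V e r + sphFlux W e' r := by
  have h1 := sphInt_congr_far (F := fun x => ∑ j, massVec U e'' j x * (x j / ‖x‖))
    (G := fun x => (∑ j, massVec V e j x * (x j / ‖x‖)) + ∑ j, massVec W e' j x * (x j / ‖x‖))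
    (by filter_upwards [h] with x hx
        simp only [hx, add_mul, Finset.sum_add_distrib])
  filter_upwards [h1, sphInt_add_of_asy (eventually_continuousAt_normal hV)
    (eventually_continuousAt_normal hW)] with r h1 h2
  unfold sphFlux
  rw [h1, h2, mul_add]

theorem linDiv_add {e q : Fin n → Fin n → Euc n → ℝ} {x : Euc n}
    (he : ∀ i j, DifferentiableAt ℝ (e i j) x) (hq : ∀ i j, DifferentiableAt ℝ (q i j) x)
    (k : Fin n) : linDiv (fun i j y => e i j y + q i j y) k x = linDiv e k x + linDiv q k x := by
  unfold linDiv
  simp only [pd_add (he _ _) (hq _ _), mul_add, Finset.sum_add_distrib]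
  ring

theorem massVec_add_right {V : Euc n → ℝ} {e q : Fin n → Fin n → Euc n → ℝ} {x : Euc n}
    (he : ∀ i j, DifferentiableAt ℝ (e i j) x) (hq : ∀ i j, DifferentiableAt ℝ (q i j) x)
    (j : Fin n) :
    massVec V (fun i j y => e i j y + q i j y) j x = massVec V e j x + massVec V q j x := by
  unfold massVec
  rw [linDiv_add he hq]
  simp only [mul_add, Finset.sum_add_distrib]
  ring

theorem massVec_add_left {V W : Euc n → ℝ} {e : Fin n → Fin n → Euc n → ℝ} {x : Euc n}
    (hV : DifferentiableAt ℝ V x) (hW : DifferentiableAt ℝ W x) (j : Fin n) :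
    massVec (V + W) e j x = massVec V e j x + massVec W e j x := by
  have h : ∀ i, pd univ i (V + W) x = pd univ i V x + pd univ i W x := fun i => pd_add hV hW
  unfold massVec
  simp only [h, add_mul, mul_add, Finset.sum_add_distrib, Pi.add_apply]
  ring

theorem massVec_smul_left {V : Euc n → ℝ} {e : Fin n → Fin n → Euc n → ℝ} {x : Euc n}
    (c : ℝ) (hV : DifferentiableAt ℝ V x) (j : Fin n) :
    massVec (c • V) e j x = c * massVec V e j x := by
  have h : ∀ i, pd univ i (c • V) x = c * pd univ i V x := fun i => pd_const_mul c hV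
  unfold massVec
  simp only [h, Pi.smul_apply, smul_eq_mul, mul_assoc, ← Finset.mul_sum]
  ring

theorem linScal_add {e q : Fin n → Fin n → Euc n → ℝ} {x : Euc n}
    (he : ∀ᶠ y in 𝓝 x, ∀ i j, DifferentiableAt ℝ (e i j) y)
    (hq : ∀ᶠ y in 𝓝 x, ∀ i j, DifferentiableAt ℝ (q i j) y)
    (he' : ∀ k, DifferentiableAt ℝ (linDiv e k) x) (hq' : ∀ k, DifferentiableAt ℝ (linDiv q k) x) :
    linScal (fun i j y => e i j y + q i j y) x = linScal e x + linScal q x := by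
  have h1 : ∀ k, pd univ k (linDiv (fun i j y => e i j y + q i j y) k) x
      = pd univ k (linDiv e k) x + pd univ k (linDiv q k) x := fun k => by
    rw [← pd_add (he' k) (hq' k)]
    refine pd_congr ?_
    filter_upwards [he, hq] with y hy hy'
    exact linDiv_add hy hy' k
  unfold linScal
  simp only [h1, linDiv_add he.self_of_nhds hq.self_of_nhds, mul_add, Finset.sum_add_distrib]
  ring

end Mass

/-! ### Existence, linearity and stability of the mass functional -/

section MassExistence

variable {n : ℕ} {α τ : ℝ}

/-- In polar coordinates this is the integral of `t^{n-1} (1-t)^s`, whose only singularity is at `t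
= 1`. -/
theorem integrableOn_one_sub_norm_rpow (hn : 1 ≤ n) {s r₀ : ℝ} (hs : -1 < s) (hr₀ : 0 ≤ r₀) :
    IntegrableOn (fun x : Euc n => (1 - ‖x‖) ^ s) (shell n r₀) := by
  have : Nonempty (Fin n) := ⟨⟨0, hn⟩⟩
  rw [← integrable_indicator_iff (isOpen_shell r₀).measurableSet]
  have e : (shell n r₀).indicator (fun x : Euc n => (1 - ‖x‖) ^ s)
      = fun x => (Ioo r₀ 1).indicator (fun t : ℝ => (1 - t) ^ s) ‖x‖ := by
    ext x
    by_cases hx : x ∈ shell n r₀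
    · rw [indicator_of_mem hx, indicator_of_mem (show ‖x‖ ∈ Ioo r₀ 1 from hx)]
    · rw [indicator_of_notMem hx, indicator_of_notMem (show ‖x‖ ∉ Ioo r₀ 1 from hx)]
  rw [e, integrable_fun_norm_addHaar (volume : Measure (Euc n))]
  have h1 : IntegrableOn (fun t : ℝ => (1 - t) ^ s) (Ioo r₀ 1) := by
    rcases lt_or_ge r₀ 1 with h | h
    · have h2 : IntervalIntegrable (fun t : ℝ => t ^ s) volume (1 - r₀) (1 - 1) :=
        intervalIntegral.intervalIntegrable_rpow' hs
      have h3 := h2.comp_sub_left 1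
      simp only [sub_sub_cancel] at h3
      rw [intervalIntegrable_iff_integrableOn_Ioo_of_le h.le] at h3
      exact h3
    · rw [Ioo_eq_empty (not_lt.2 h)]; exact integrableOn_empty
  have h4 : IntegrableOn (fun t : ℝ => t ^ (n - 1) * (1 - t) ^ s) (Ioo r₀ 1) := by
    refine h1.bdd_mul (c := 1) (by fun_prop) ?_
    filter_upwards [ae_restrict_mem measurableSet_Ioo] with t ht
    have : 0 ≤ t := hr₀.trans ht.1.le
    rw [norm_pow, Real.norm_eq_abs, abs_of_nonneg this]
    exact pow_le_one₀ this ht.2.le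
  have h5 := (integrable_indicator_iff measurableSet_Ioo).2 h4
  refine (h5.integrableOn (s := Ioi 0)).congr_fun (fun t _ => ?_) measurableSet_Ioi
  simp only [finrank_euclideanSpace, Fintype.card_fin, smul_eq_mul]
  by_cases ht : t ∈ Ioo r₀ 1
  · simp only [indicator_of_mem ht]
  · simp only [indicator_of_notMem ht, mul_zero]

theorem Asy.exists_integrableOn (hn : 1 ≤ n) {h : Euc n → ℝ} {s : ℝ} (hs : -1 < s)
    (hh : Asy α 0 s h) : ∃ r, 0 < r ∧ r < 1 ∧ ∀ r', r ≤ r' → IntegrableOn h (shell n r') := by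
  -- With a nonpositive exponent, the bound `ρ ≥ (1 - |x|)/2` gives an upper bound for `ρ^{s'}`;
  -- lowering the exponent to at most `0` is harmless.
  set s' := min s 0 with hs'
  have hh' : Asy α 0 s' h := hh.mono (min_le_left _ _)
  have hs1 : -1 < s' := lt_min hs (by norm_num)
  obtain ⟨C, hC, hb⟩ := hh'.eventually_norm_le
  obtain ⟨r, h0, h1, hr⟩ := exists_shell (hb.and hh'.eventually_contDiffAt)
  refine ⟨r, h0, h1, fun r' hr' => ?_⟩
  have hsub : shell n r' ⊆ shell n r := fun x hx => ⟨hr'.trans_lt hx.1, hx.2⟩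
  have hi := (integrableOn_one_sub_norm_rpow hn hs1 (h0.le.trans hr')).const_mul (C * 2⁻¹ ^ s')
  refine Integrable.mono' hi ?_ ?_
  · exact ContinuousOn.aestronglyMeasurable
      (fun x hx => (hr x (hsub hx)).2.continuousAt.continuousWithinAt) (isOpen_shell _).measurableSet
  · filter_upwards [ae_restrict_mem (isOpen_shell r').measurableSet] with x hx
    refine (hr x (hsub hx)).1.trans ?_
    rw [mul_assoc]
    refine mul_le_mul_of_nonneg_left ?_ hC
    have hp : 0 < 1 - ‖x‖ := by linarith [hx.2]
    rw [← Real.mul_rpow (by norm_num) hp.le]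
    refine Real.rpow_le_rpow_of_nonpos (by positivity) ?_ (min_le_right _ _)
    unfold rho; nlinarith [norm_nonneg x]

variable {G : Euc n → Euc n →L[ℝ] Euc n →L[ℝ] ℝ}

/-- The divergence of `massVec` is `w * linScal`, with `w` of order `-1-n`. Replacing `linScal` by
`Scal + n(n-1)` costs a remainder of order `2τ-1-n > -1`, which is integrable. The weight
`ρ^{-(n+1)}` in `hi` is `ρ⁻¹` times the hyperbolic volume density. -/
theorem AsyHyp.exists_tendsto_sphFlux (hn : 2 ≤ n) (hG : AsyHyp α τ G) (hτ : (n : ℝ) / 2 < τ) {r₀ : ℝ}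
    (hr₁ : r₀ < 1)
    (hi : IntegrableOn (fun x => (rho x)⁻¹ ^ (n + 1) * (coordScal univ G x + n * (n - 1)))
      (shell n r₀)) {V : Euc n → ℝ} (hV : IsStatic α V) :
    ∃ L, Tendsto (sphFlux V (devComp G)) (𝓝[<] 1) (𝓝 L) := by
  have hα₀ := hG.alpha_nonneg
  have hα₁ := hG.alpha_le
  set w : Euc n → ℝ := fun x => fluxWeight n x * V x * (rho x)⁻¹ ^ 2 with hw
  have hwa : Asy α 0 (-1 - n) w :=
    (((asy_fluxWeight hn hα₀ hα₁).mul (hV.asy 0)).mul (asy_inv_rho_pow hα₀ hα₁ 0 2)).mono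
      (by push_cast; linarith)
  have hma := asy_massVec hn hα₀ hα₁ hV hG.dev
  have hda := asy_linDiv hα₀ hα₁ hG.dev
  set rem : Euc n → ℝ := fun x => w x *
    (coordScal univ G x + n * (n - 1) - linScal (devComp G) x) with hrem
  obtain ⟨r₂, h20, h21, hr₂⟩ := Asy.exists_integrableOn (by omega) (by linarith)
    (hwa.mul hG.asy_scal)
  obtain ⟨C, hC, hwb⟩ := hwa.eventually_norm_le
  have hev : ∀ᶠ x in far n, (∀ j, ContDiffAt ℝ 1 (massVec V (devComp G) j) x) ∧
      ‖w x‖ ≤ C * rho x ^ (-1 - (n : ℝ)) ∧ ContinuousAt w x ∧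
      ∑ j, pd univ j (massVec V (devComp G) j) x = w x * linScal (devComp G) x := by
    filter_upwards [eventually_all.2 fun j => (hma j).eventually_contDiffAt, hwb,
      hwa.eventually_contDiffAt, eventually_far_norm_lt, hG.eventually_devComp_symm,
      hG.eventually_differentiableAt_devComp,
      eventually_all.2 fun k => (hda k).eventually_differentiableAt] with x h1 h2 h3 h4 h5 h6 h7
    exact ⟨h1, h2, h3.continuousAt, div_massVec hn h4 hV h5 h6 h7⟩
  obtain ⟨r₁, h10, h11, hr₁'⟩ := exists_shell hev
  set r := max r₀ (max r₁ r₂) with hr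
  have hr0 : r₀ ≤ r := le_max_left _ _
  have hr1 : r₁ ≤ r := (le_max_left _ _).trans (le_max_right _ _)
  have hr2 : r₂ ≤ r := (le_max_right _ _).trans (le_max_right _ _)
  have hs1 : ∀ x ∈ shell n r, x ∈ shell n r₁ := fun x hx => ⟨hr1.trans_lt hx.1, hx.2⟩
  have hrpos : 0 < r := h10.trans_le hr1
  have hrlt : r < 1 := max_lt hr₁ (max_lt h11 h21)
  refine exists_tendsto_flux (by omega) hrpos hrlt
    (fun j x hx => ((hr₁' x (hs1 x hx)).1 j).contDiffWithinAt) ?_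
  have hms := (isOpen_shell (n := n) r).measurableSet
  -- `w ρ^{n+1}` is bounded, so the scalar curvature part is a bounded multiple of the integrable
  -- function in `hi`.
  have i1 : IntegrableOn (fun x => (w x * rho x ^ (n + 1)) *
      ((rho x)⁻¹ ^ (n + 1) * (coordScal univ G x + n * (n - 1)))) (shell n r) := by
    refine (hi.mono_set fun x hx => ⟨hr0.trans_lt hx.1, hx.2⟩).bdd_mul (c := C) ?_ ?_
    · exact ContinuousOn.aestronglyMeasurable
        (fun x hx => ((hr₁' x (hs1 x hx)).2.2.1.mul
          (rho_continuous.continuousAt.pow _)).continuousWithinAt) hms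
    · filter_upwards [ae_restrict_mem hms] with x hx
      have hρ := rho_pos hx.2
      rw [norm_mul, norm_pow, Real.norm_eq_abs (rho x), abs_of_pos hρ]
      calc _ ≤ C * rho x ^ (-1 - (n : ℝ)) * rho x ^ (n + 1) :=
            mul_le_mul_of_nonneg_right (hr₁' x (hs1 x hx)).2.1 (by positivity)
        _ = C := by
          rw [mul_assoc, ← Real.rpow_natCast, ← Real.rpow_add hρ]
          push_cast
          rw [show -1 - (n : ℝ) + (n + 1) = 0 by ring, Real.rpow_zero, mul_one]
  refine (i1.sub (hr₂ r hr2)).congr_fun (fun x hx => ?_) hms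
  have hρ := (rho_pos hx.2).ne'
  rw [(hr₁' x (hs1 x hx)).2.2.2]
  simp only [Pi.sub_apply]
  have : rho x ^ (n + 1) * (rho x)⁻¹ ^ (n + 1) = 1 := by rw [← mul_pow, mul_inv_cancel₀ hρ, one_pow]
  linear_combination (w x * (coordScal univ G x + n * (n - 1))) * this

theorem AsyHyp.massFlux_eq (hG : AsyHyp α τ G) (V : Euc n → ℝ) :
    ∀ᶠ r in 𝓝[<] (1 : ℝ), massFlux V (fun x => G x - hypMetric n x) r =
      (2 * (volume : Measure (Euc n)).toSphere.real univ * ((n : ℝ) - 1))⁻¹ *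
        sphFlux V (devComp G) r :=
  AHJang.massFlux_eq hG.eventually_devComp_symm hG.eventually_differentiableAt_devComp V

/-- For each `r` near `1` the flux is linear in `V`, and linearity passes to the limit by uniqueness
of limits. -/
theorem AsyHyp.exists_mass (hn : 2 ≤ n) (hG : AsyHyp α τ G) (hτ : (n : ℝ) / 2 < τ) {r₀ : ℝ}
    (hr₁ : r₀ < 1)
    (hi : IntegrableOn (fun x => (rho x)⁻¹ ^ (n + 1) * (coordScal univ G x + n * (n - 1)))
      (shell n r₀)) :
    ∃ m : kernelSpace n →ₗ[ℝ] ℝ, ∀ V : kernelSpace n,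
      Tendsto (massFlux (V : Euc n → ℝ) (fun x => G x - hypMetric n x)) (𝓝[<] 1) (𝓝 (m V)) := by
  have hα₀ := hG.alpha_nonneg
  have hα₁ := hG.alpha_le
  have hst : ∀ V : kernelSpace n, IsStatic α (V : Euc n → ℝ) :=
    fun V => isStatic_of_mem hα₀ hα₁ V.2
  choose L hL using fun V : kernelSpace n => hG.exists_tendsto_sphFlux hn hτ hr₁ hi (hst V)
  have hma := fun V : kernelSpace n => asy_massVec hn hα₀ hα₁ (hst V) hG.dev
  have hd : ∀ V : kernelSpace n, ∀ᶠ x in far n, DifferentiableAt ℝ (V : Euc n → ℝ) x := fun V =>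
    eventually_far_norm_lt.mono fun x hx => ((hst V).smooth x hx).differentiableAt (by norm_num)
  have hadd : ∀ V W, L (V + W) = L V + L W := fun V W => by
    refine tendsto_nhds_unique (hL (V + W)) (((hL V).add (hL W)).congr' ?_)
    filter_upwards [sphFlux_add (hma V) (hma W) (U := ((V + W : kernelSpace n) : Euc n → ℝ))
      (e'' := devComp G) (by
        filter_upwards [hd V, hd W] with x h1 h2 j
        exact massVec_add_left h1 h2 j)] with r hr
    exact hr.symm
  have hsmul : ∀ (c : ℝ) V, L (c • V) = c * L V := fun c V => by
    refine tendsto_nhds_unique (hL (c • V)) (((hL V).const_mul c).congr' ?_)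
    have h1 := sphInt_congr_far
      (F := fun x => ∑ j, massVec ((c • V : kernelSpace n) : Euc n → ℝ) (devComp G) j x * (x j / ‖x‖))
      (G := fun x => c * ∑ j, massVec (V : Euc n → ℝ) (devComp G) j x * (x j / ‖x‖)) (by
        filter_upwards [hd V] with x h1
        rw [Finset.mul_sum]
        refine Finset.sum_congr rfl fun j _ => ?_
        rw [Submodule.coe_smul, massVec_smul_left c h1 j, mul_assoc])
    filter_upwards [h1] with r hr
    unfold sphFlux
    rw [hr]
    unfold sphInt
    rw [integral_const_mul]
    ring
  set c := (2 * (volume : Measure (Euc n)).toSphere.real univ * ((n : ℝ) - 1))⁻¹ with hc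
  refine ⟨{ toFun := fun V => c * L V, map_add' := fun V W => ?_, map_smul' := fun a V => ?_ },
    fun V => ?_⟩
  · rw [hadd, mul_add]
  · rw [hsmul]; simp only [RingHom.id_apply, smul_eq_mul]; ring
  · exact ((hL V).const_mul c).congr' ((hG.massFlux_eq V).mono fun r hr => hr.symm)

variable {G' : Euc n → Euc n →L[ℝ] Euc n →L[ℝ] ℝ}

/-- A perturbation of the metric of order `ρ^σ`, `σ > n`, does not change the mass. -/
theorem AsyHyp.tendsto_massFlux_congr (hn : 2 ≤ n) (hG : AsyHyp α τ G) (hG' : AsyHyp α τ G') {σ : ℝ}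
    (hσ : n < σ) (hq : ∀ i j, Asy α 2 (σ - 2) (fun x => devComp G' i j x - devComp G i j x))
    {V : Euc n → ℝ} (hV : IsStatic α V) {L : ℝ}
    (hL : Tendsto (massFlux V (fun x => G x - hypMetric n x)) (𝓝[<] 1) (𝓝 L)) :
    Tendsto (massFlux V (fun x => G' x - hypMetric n x)) (𝓝[<] 1) (𝓝 L) := by
  have hα₀ := hG.alpha_nonneg
  have hα₁ := hG.alpha_le
  set q : Fin n → Fin n → Euc n → ℝ := fun i j x => devComp G' i j x - devComp G i j x with hqd
  have h1 := (tendsto_sphFlux_zero hn hα₀ hα₁ hV hσ hq).const_mul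
    (2 * (volume : Measure (Euc n)).toSphere.real univ * ((n : ℝ) - 1))⁻¹
  have h2 := hL.add h1
  rw [mul_zero, add_zero] at h2
  refine h2.congr' ?_
  have e : devComp G' = fun i j y => devComp G i j y + q i j y := by
    ext i j y; simp [hqd]
  filter_upwards [hG.massFlux_eq V, hG'.massFlux_eq V,
    sphFlux_add (asy_massVec hn hα₀ hα₁ hV hG.dev) (asy_massVec hn hα₀ hα₁ hV hq)
      (U := V) (e'' := devComp G') (by
        filter_upwards [hG.eventually_differentiableAt_devComp, eventually_all.2 fun i =>
          eventually_all.2 fun j => (hq i j).eventually_differentiableAt] with x h1 h2 j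
        rw [show massVec V (devComp G') j x = massVec V (fun i j y => devComp G i j y + q i j y) j x by
          rw [← e]]
        exact massVec_add_right h1 h2 j)] with r h1 h2 h3
  rw [h1, h2, h3, mul_add]

/-- A perturbation of the metric of order `ρ^{2τ}` changes the scalar curvature by `O(ρ^{2τ})`. -/
theorem AsyHyp.asy_scal_sub (hG : AsyHyp α τ G) (hG' : AsyHyp α τ G')
    (hq : ∀ i j, Asy α 2 (2 * τ - 2) (fun x => devComp G' i j x - devComp G i j x)) :
    Asy α 0 (2 * τ) (fun x => coordScal univ G' x - coordScal univ G x) := by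
  have hα₀ := hG.alpha_nonneg
  have hα₁ := hG.alpha_le
  set q : Fin n → Fin n → Euc n → ℝ := fun i j x => devComp G' i j x - devComp G i j x with hqd
  have e : devComp G' = fun i j y => devComp G i j y + q i j y := by
    ext i j y; simp [hqd]
  -- Both quadratic remainders have order `2τ`, and so does the linearization applied to the
  -- difference of the metrics.
  refine (((hG'.asy_scal.sub hG.asy_scal).add (asy_linScal hα₀ hα₁ hq))).congr ?_
  filter_upwards [eventually_far_nhds hG.eventually_differentiableAt_devComp,
    eventually_far_nhds (eventually_all.2 fun i =>
          eventually_all.2 fun j => (hq i j).eventually_differentiableAt),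
    eventually_all.2 fun k => (asy_linDiv hα₀ hα₁ hG.dev k).eventually_differentiableAt,
    eventually_all.2 fun k => (asy_linDiv hα₀ hα₁ hq k).eventually_differentiableAt]
    with x h1 h2 h3 h4
  have h5 : linScal (devComp G') x = linScal (devComp G) x + linScal q x := by
    rw [e]; exact linScal_add h1 h2 h3 h4
  rw [h5]
  ring

end MassExistence

/-! ### Coordinate invariance of the scalar curvature -/

section Invariance

theorem contDiffAt_clm_apply {E F W : Type} [NormedAddCommGroup E] [NormedSpace ℝ E]
    [NormedAddCommGroup F] [NormedSpace ℝ F] [NormedAddCommGroup W] [NormedSpace ℝ W]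
    {k : WithTop ℕ∞} {f : E → F} {z : E} (L : F →L[ℝ] W) (hf : ContDiffAt ℝ k f z) :
    ContDiffAt ℝ k (fun x => L (f x)) z :=
  L.contDiff.contDiffAt.comp z hf

theorem contDiffAt_smul_const {E F : Type} [NormedAddCommGroup E] [NormedSpace ℝ E]
    [NormedAddCommGroup F] [NormedSpace ℝ F] {k : WithTop ℕ∞} {c : E → ℝ} {z : E}
    (hc : ContDiffAt ℝ k c z) (A : F) : ContDiffAt ℝ k (fun x => c x • A) z :=
  hc.smul contDiffAt_const

theorem contDiffAt_bilinearComp {E F : Type} [NormedAddCommGroup E] [NormedSpace ℝ E]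
    [NormedAddCommGroup F] [NormedSpace ℝ F] {k : WithTop ℕ∞} {B : E → F →L[ℝ] F →L[ℝ] ℝ}
    {A : E → F →L[ℝ] F} {z : E} (hB : ContDiffAt ℝ k B z) (hA : ContDiffAt ℝ k A z) :
    ContDiffAt ℝ k (fun x => (B x).bilinearComp (A x) (A x)) z := by
  let L : (F →L[ℝ] F →L[ℝ] ℝ) →L[ℝ] (F →L[ℝ] F →L[ℝ] ℝ) :=
    (ContinuousLinearMap.flipₗᵢ ℝ F F ℝ).toContinuousLinearEquiv.toContinuousLinearMap
  have hf : ∀ {C : E → F →L[ℝ] F →L[ℝ] ℝ}, ContDiffAt ℝ k C z →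
      ContDiffAt ℝ k (fun x => (C x).flip) z := fun {C} hC => by
    have h := contDiffAt_clm_apply (F := F →L[ℝ] F →L[ℝ] ℝ) (W := F →L[ℝ] F →L[ℝ] ℝ) L hC
    exact h
  -- Precomposition in both arguments is precomposition in the first one done twice, with a flip
  -- after each.
  exact hf ((hf (hB.clm_comp hA)).clm_comp hA)

variable {n : ℕ}

/-- The elementary vector-valued bilinear form `(X, Y) ↦ X_i Y_j e_k`. -/
def elemForm (k i j : Fin n) : Euc n →L[ℝ] Euc n →L[ℝ] Euc n :=
  ((EuclideanSpace.proj i : Euc n →L[ℝ] ℝ)).smulRight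
    ((EuclideanSpace.proj j : Euc n →L[ℝ] ℝ).smulRight (EuclideanSpace.single k (1 : ℝ)))

theorem elemForm_apply (k i j : Fin n) (X Y : Euc n) :
    elemForm k i j X Y = (X i * Y j) • EuclideanSpace.single k (1 : ℝ) := by
  simp [elemForm, smul_smul]

/-- The Christoffel symbols as a vector-valued bilinear form. -/
def chrMap (G : Euc n → Euc n →L[ℝ] Euc n →L[ℝ] ℝ) (z : Euc n) : Euc n →L[ℝ] Euc n →L[ℝ] Euc n :=
  ∑ k, ∑ i, ∑ j, christoffel univ G k i j z • elemForm k i j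

theorem chrMap_apply (G : Euc n → Euc n →L[ℝ] Euc n →L[ℝ] ℝ) (z X Y : Euc n) (k : Fin n) :
    chrMap G z X Y k = ∑ i, ∑ j, christoffel univ G k i j z * (X i * Y j) := by
  simp only [chrMap, sum_apply, smul_apply, elemForm_apply]
  simp only [WithLp.ofLp_sum, WithLp.ofLp_smul, Finset.sum_apply, Pi.smul_apply, smul_eq_mul]
  rw [Finset.sum_eq_single k]
  · simp
  · intro l _ hl
    simp [hl.symm]
  · simp

theorem euc_eq_sum (X : Euc n) : X = ∑ i, X i • EuclideanSpace.single i (1 : ℝ) := by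
  ext k
  simp only [WithLp.ofLp_sum, WithLp.ofLp_smul, Finset.sum_apply, Pi.smul_apply, smul_eq_mul]
  simp

theorem eq_of_isLinearMap {V : Type*} [AddCommGroup V] [Module ℝ V] {f g : Euc n → V}
    (hf : IsLinearMap ℝ f) (hg : IsLinearMap ℝ g)
    (h : ∀ i, f (EuclideanSpace.single i 1) = g (EuclideanSpace.single i 1)) (X : Euc n) :
    f X = g X := by
  have key : ∀ {f : Euc n → V} (hf : IsLinearMap ℝ f), f X
      = ∑ i, X i • f (EuclideanSpace.single i 1) := fun {f} hf => by
    conv_lhs => rw [euc_eq_sum X]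
    change hf.mk' f _ = _
    rw [map_sum]
    simp only [map_smul]
    rfl
  rw [key hf, key hg]
  simp only [h]

theorem chrMap_single (G : Euc n → Euc n →L[ℝ] Euc n →L[ℝ] ℝ) (z : Euc n) (k i j : Fin n) :
    chrMap G z (EuclideanSpace.single i 1) (EuclideanSpace.single j 1) k
      = christoffel univ G k i j z := by
  rw [chrMap_apply]
  simp

theorem form_apply_single (B : Euc n →L[ℝ] Euc n →L[ℝ] ℝ) (v : Euc n) (l : Fin n) :
    B v (EuclideanSpace.single l 1)
      = ∑ k, v k * B (EuclideanSpace.single k 1) (EuclideanSpace.single l 1) := by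
  conv_lhs => rw [euc_eq_sum v]
  simp

variable {G : Euc n → Euc n →L[ℝ] Euc n →L[ℝ] ℝ} {z : Euc n}

theorem pd_comp_eq (hG : DifferentiableAt ℝ G z) (i j l : Fin n) :
    pd univ l (fun y => comp G y i j) z = fderiv ℝ G z (EuclideanSpace.single l 1)
      (EuclideanSpace.single i 1) (EuclideanSpace.single j 1) := by
  rw [pd_univ]
  have h := (hG.hasFDerivAt.clm_apply (hasFDerivAt_const (EuclideanSpace.single i (1 : ℝ)) z)).clm_apply
    (hasFDerivAt_const (EuclideanSpace.single j (1 : ℝ)) z)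
  have e : (fun y => comp G y i j)
      = fun y => G y (EuclideanSpace.single i 1) (EuclideanSpace.single j 1) := rfl
  rw [e, h.fderiv]
  simp

/-- The Koszul formula. -/
theorem metric_chrMap (hG : DifferentiableAt ℝ G z) (hs : ∀ X Y, G z X Y = G z Y X)
    (hdet : (comp G z).det ≠ 0) (X Y W : Euc n) :
    G z (chrMap G z X Y) W = (1 / 2) * (fderiv ℝ G z X Y W + fderiv ℝ G z Y X W
      - fderiv ℝ G z W X Y) := by
  have hc : ∀ i j l, ∑ k, christoffel univ G k i j z * comp G z k l
      = (1 / 2) * (fderiv ℝ G z (EuclideanSpace.single i 1) (EuclideanSpace.single j 1)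
          (EuclideanSpace.single l 1)
        + fderiv ℝ G z (EuclideanSpace.single j 1) (EuclideanSpace.single i 1)
          (EuclideanSpace.single l 1)
        - fderiv ℝ G z (EuclideanSpace.single l 1) (EuclideanSpace.single i 1)
          (EuclideanSpace.single j 1)) := by
    intro i j l
    simp only [christoffel, pd_comp_eq hG]
    set K : Fin n → ℝ := fun m => fderiv ℝ G z (EuclideanSpace.single i 1)
          (EuclideanSpace.single j 1) (EuclideanSpace.single m 1)
        + fderiv ℝ G z (EuclideanSpace.single j 1) (EuclideanSpace.single i 1)
          (EuclideanSpace.single m 1)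
        - fderiv ℝ G z (EuclideanSpace.single m 1) (EuclideanSpace.single i 1)
          (EuclideanSpace.single j 1) with hK
    have h1 : ∀ m, ∑ k, compInv G z k m * comp G z k l = if m = l then 1 else 0 := by
      intro m
      have h2 := congrFun (congrFun (Matrix.mul_nonsing_inv (comp G z) (isUnit_iff_ne_zero.2 hdet)) l) m
      rw [Matrix.mul_apply, Matrix.one_apply] at h2
      rw [show (if m = l then (1 : ℝ) else 0) = if l = m then 1 else 0 by simp [eq_comm], ← h2]
      refine Finset.sum_congr rfl fun k _ => ?_
      rw [show comp G z k l = comp G z l k from hs _ _, mul_comm]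
      rfl
    calc ∑ k, (1 / 2) * (∑ m, compInv G z k m * K m) * comp G z k l
        = (1 / 2) * ∑ m, K m * ∑ k, compInv G z k m * comp G z k l := by
          simp only [Finset.mul_sum, Finset.sum_mul]
          rw [Finset.sum_comm]
          refine Finset.sum_congr rfl fun k _ => Finset.sum_congr rfl fun m _ => ?_
          ring
      _ = _ := by simp only [h1, mul_ite, mul_one, mul_zero, Finset.sum_ite_eq', Finset.mem_univ,
                    if_true]; rfl
  refine eq_of_isLinearMap (f := fun X => G z (chrMap G z X Y) W) (g := fun X => (1 / 2) *
    (fderiv ℝ G z X Y W + fderiv ℝ G z Y X W - fderiv ℝ G z W X Y)) ?_ ?_ (fun i => ?_) X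
  · constructor <;> intros <;> simp
  · constructor <;> intros <;> simp <;> ring
  refine eq_of_isLinearMap (f := fun Y => G z (chrMap G z (EuclideanSpace.single i 1) Y) W)
    (g := fun Y => (1 / 2) * (fderiv ℝ G z (EuclideanSpace.single i 1) Y W
      + fderiv ℝ G z Y (EuclideanSpace.single i 1) W
      - fderiv ℝ G z W (EuclideanSpace.single i 1) Y)) ?_ ?_ (fun j => ?_) Y
  · constructor <;> intros <;> simp
  · constructor <;> intros <;> simp <;> ring
  refine eq_of_isLinearMap (f := fun W => G z (chrMap G z (EuclideanSpace.single i 1)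
      (EuclideanSpace.single j 1)) W)
    (g := fun W => (1 / 2) * (fderiv ℝ G z (EuclideanSpace.single i 1) (EuclideanSpace.single j 1) W
      + fderiv ℝ G z (EuclideanSpace.single j 1) (EuclideanSpace.single i 1) W
      - fderiv ℝ G z W (EuclideanSpace.single i 1) (EuclideanSpace.single j 1))) ?_ ?_ (fun l => ?_) W
  · constructor <;> intros <;> simp
  · constructor <;> intros <;> simp <;> ring
  rw [← hc i j l, form_apply_single]
  simp only [chrMap_single]
  rfl

theorem contDiffAt_comp {k : WithTop ℕ∞} (hG : ContDiffAt ℝ k G z) (i j : Fin n) :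
    ContDiffAt ℝ k (fun y => comp G y i j) z :=
  (hG.clm_apply contDiffAt_const).clm_apply contDiffAt_const

theorem contDiffAt_det {k : WithTop ℕ∞} {A : Euc n → Matrix (Fin n) (Fin n) ℝ}
    (hA : ∀ i j, ContDiffAt ℝ k (fun y => A y i j) z) : ContDiffAt ℝ k (fun y => (A y).det) z := by
  simp only [Matrix.det_apply]
  refine ContDiffAt.sum fun σ _ => ?_
  simp only [Units.smul_def, zsmul_eq_mul]
  exact contDiffAt_const.mul (contDiffAt_prod fun i _ => hA _ _)

theorem contDiffAt_compInv {k : WithTop ℕ∞} (hG : ContDiffAt ℝ k G z) (hdet : (comp G z).det ≠ 0)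
    (i j : Fin n) : ContDiffAt ℝ k (fun y => compInv G y i j) z := by
  have h1 : ContDiffAt ℝ k (fun y => (comp G y).adjugate i j) z := by
    simp only [Matrix.adjugate_apply]
    refine contDiffAt_det fun a b => ?_
    simp only [Matrix.updateRow_apply]
    split_ifs
    · exact contDiffAt_const
    · exact contDiffAt_comp hG a b
  have h2 := ((contDiffAt_det (contDiffAt_comp hG)).inv hdet).mul h1
  refine h2.congr_of_eventuallyEq (Eventually.of_forall fun y => ?_)
  simp [compInv, Matrix.inv_def]

theorem contDiffAt_christoffel (hG : ContDiffAt ℝ 2 G z) (hdet : (comp G z).det ≠ 0)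
    (k i j : Fin n) : ContDiffAt ℝ 1 (christoffel univ G k i j) z := by
  have h1 : ∀ l i j, ContDiffAt ℝ 1 (pd univ l (fun y => comp G y i j)) z := fun l i j => by
    have h := ((contDiffAt_comp hG i j).fderiv_right (m := 1) (by norm_num)).clm_apply
      (contDiffAt_const (c := EuclideanSpace.single l (1 : ℝ)))
    refine h.congr_of_eventuallyEq (Eventually.of_forall fun y => ?_)
    rw [pd_univ]
  unfold christoffel
  exact contDiffAt_const.mul (ContDiffAt.sum fun l _ =>
    ((contDiffAt_compInv hG hdet k l).of_le (by norm_num)).mul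
      (((h1 i j l).add (h1 j i l)).sub (h1 l i j)))

theorem contDiffAt_chrMap (hG : ContDiffAt ℝ 2 G z) (hdet : (comp G z).det ≠ 0) :
    ContDiffAt ℝ 1 (chrMap G) z := by
  unfold chrMap
  exact ContDiffAt.sum fun k _ => ContDiffAt.sum fun i _ => ContDiffAt.sum fun j _ =>
    contDiffAt_smul_const (contDiffAt_christoffel hG hdet k i j) _

/-- The curvature operator `R(Z, X) Y`. -/
def riem (G : Euc n → Euc n →L[ℝ] Euc n →L[ℝ] ℝ) (z Z X Y : Euc n) : Euc n :=
  fderiv ℝ (chrMap G) z Z X Y - fderiv ℝ (chrMap G) z X Z Y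
    + chrMap G z Z (chrMap G z X Y) - chrMap G z X (chrMap G z Z Y)

variable {G' : Euc n → Euc n →L[ℝ] Euc n →L[ℝ] ℝ} {φ : Euc n → Euc n}

theorem contDiffAt_pullback {k : WithTop ℕ∞} (hφ : ContDiffAt ℝ (k + 1) φ z)
    (hG' : ContDiffAt ℝ k G' (φ z))
    (hG : ∀ᶠ y in 𝓝 z, G y = (G' (φ y)).bilinearComp (fderiv ℝ φ y) (fderiv ℝ φ y)) :
    ContDiffAt ℝ k G z := by
  have hJ : ContDiffAt ℝ k (fderiv ℝ φ) z := hφ.fderiv_right le_rfl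
  have h1 : ContDiffAt ℝ k (fun y => G' (φ y)) z :=
    ContDiffAt.comp z hG' (hφ.of_le le_self_add)
  exact (contDiffAt_bilinearComp h1 hJ).congr_of_eventuallyEq hG

theorem fderiv_pullback (hφ : ContDiffAt ℝ 2 φ z) (hG' : DifferentiableAt ℝ G' (φ z))
    (hGd : DifferentiableAt ℝ G z)
    (hG : ∀ᶠ y in 𝓝 z, G y = (G' (φ y)).bilinearComp (fderiv ℝ φ y) (fderiv ℝ φ y)) (X Y W : Euc n) :
    fderiv ℝ G z X Y W = fderiv ℝ G' (φ z) (fderiv ℝ φ z X) (fderiv ℝ φ z Y) (fderiv ℝ φ z W)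
      + G' (φ z) (fderiv ℝ (fderiv ℝ φ) z X Y) (fderiv ℝ φ z W)
      + G' (φ z) (fderiv ℝ φ z Y) (fderiv ℝ (fderiv ℝ φ) z X W) := by
  have hφd : HasFDerivAt φ (fderiv ℝ φ z) z := (hφ.differentiableAt (by norm_num)).hasFDerivAt
  have hJd : HasFDerivAt (fderiv ℝ φ) (fderiv ℝ (fderiv ℝ φ) z) z :=
    ((hφ.fderiv_right (m := 1) (by norm_num)).differentiableAt (by norm_num)).hasFDerivAt
  have hcomp : HasFDerivAt (fun y => G' (φ y)) ((fderiv ℝ G' (φ z)).comp (fderiv ℝ φ z)) z :=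
    HasFDerivAt.comp (G := Euc n →L[ℝ] Euc n →L[ℝ] ℝ) z hG'.hasFDerivAt hφd
  have h1 := (hGd.hasFDerivAt.clm_apply (hasFDerivAt_const Y z)).clm_apply (hasFDerivAt_const W z)
  have h2 := (hcomp.clm_apply (hJd.clm_apply (hasFDerivAt_const Y z))).clm_apply
    (hJd.clm_apply (hasFDerivAt_const W z))
  have h3 := h2.congr_of_eventuallyEq (f₁ := fun y => G y Y W) (by
    filter_upwards [hG] with y hy
    rw [hy]; rfl)
  have h4 := DFunLike.congr_fun (h1.unique h3) X
  simp at h4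
  rw [h4]
  ring

/-- The transformation law of the Christoffel symbols. -/
theorem chrMap_pullback (hφ : ContDiffAt ℝ 2 φ z) (hinv : Function.Surjective (fderiv ℝ φ z))
    (hG : ∀ᶠ y in 𝓝 z, G y = (G' (φ y)).bilinearComp (fderiv ℝ φ y) (fderiv ℝ φ y))
    (hG' : ContDiffAt ℝ 1 G' (φ z)) (hs : ∀ X Y, G' (φ z) X Y = G' (φ z) Y X)
    (hdet' : (comp G' (φ z)).det ≠ 0) (hdet : (comp G z).det ≠ 0) (X Y : Euc n) :
    fderiv ℝ φ z (chrMap G z X Y) = chrMap G' (φ z) (fderiv ℝ φ z X) (fderiv ℝ φ z Y)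
      + fderiv ℝ (fderiv ℝ φ) z X Y := by
  have hGd : DifferentiableAt ℝ G z :=
    (contDiffAt_pullback (k := 1) (by norm_num; exact hφ) hG' hG).differentiableAt (by norm_num)
  have hder := fderiv_pullback hφ (hG'.differentiableAt (by norm_num)) hGd hG
  set J := fderiv ℝ φ z with hJ
  have hsym : ∀ X Y, fderiv ℝ (fderiv ℝ φ) z X Y = fderiv ℝ (fderiv ℝ φ) z Y X :=
    hφ.isSymmSndFDerivAt (by simp)
  have hGz : ∀ X Y, G z X Y = G' (φ z) (J X) (J Y) := fun X Y => by
    rw [hG.self_of_nhds]; rfl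
  -- A vector identity may be checked by pairing with `G'`. Since `dφ` is onto, vectors `J W`
  -- suffice, and both sides are then given by the Koszul formula. Of the second derivatives of `φ`,
  -- the alternating sum retains only `D²φ(X, Y)`.
  have hnd : ∀ v, (∀ w, G' (φ z) v w = 0) → v = 0 := fun v hv => by
    have h := Matrix.eq_zero_of_vecMul_eq_zero hdet' (v := fun i => v i) (by
      ext l
      have := hv (EuclideanSpace.single l 1)
      rw [form_apply_single] at this
      exact this)
    ext i; exact congrFun h i
  rw [← sub_eq_zero]
  refine hnd _ fun w => ?_
  obtain ⟨W, rfl⟩ : ∃ W, J W = w := hinv w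
  have h1 := metric_chrMap hGd (fun X Y => by rw [hGz, hGz, hs]) hdet X Y W
  have h2 := metric_chrMap (hG'.differentiableAt (by norm_num)) hs hdet' (J X) (J Y) (J W)
  rw [hGz, hder, hder, hder] at h1
  simp only [map_sub, map_add, sub_apply, add_apply]
  rw [h1, h2, hsym Y X, hsym W X, hsym W Y, hs (J Y) (fderiv ℝ (fderiv ℝ φ) z X W),
    hs (J X) (fderiv ℝ (fderiv ℝ φ) z Y W)]
  ring

/-- The curvature operator is a tensor. -/
theorem riem_pullback (hφ : ContDiffAt ℝ 3 φ z)
    (hG : ∀ᶠ y in 𝓝 z, G y = (G' (φ y)).bilinearComp (fderiv ℝ φ y) (fderiv ℝ φ y))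
    (hG' : ContDiffAt ℝ 2 G' (φ z)) (hs : ∀ᶠ y in 𝓝 z, ∀ X Y, G' (φ y) X Y = G' (φ y) Y X)
    (hdet' : ∀ᶠ y in 𝓝 z, (comp G' (φ y)).det ≠ 0) (hdet : ∀ᶠ y in 𝓝 z, (comp G y).det ≠ 0)
    (hsurj : ∀ᶠ y in 𝓝 z, Function.Surjective (fderiv ℝ φ y))
    (Z X Y : Euc n) :
    fderiv ℝ φ z (riem G z Z X Y)
      = riem G' (φ z) (fderiv ℝ φ z Z) (fderiv ℝ φ z X) (fderiv ℝ φ z Y) := by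
  have hφ2 : ContDiffAt ℝ 2 φ z := hφ.of_le (by norm_num)
  have hφd : HasFDerivAt φ (fderiv ℝ φ z) z := (hφ.differentiableAt (by norm_num)).hasFDerivAt
  have hJc : ContDiffAt ℝ 2 (fderiv ℝ φ) z := hφ.fderiv_right (by norm_num)
  have hJd : HasFDerivAt (fderiv ℝ φ) (fderiv ℝ (fderiv ℝ φ) z) z :=
    (hJc.differentiableAt (by norm_num)).hasFDerivAt
  have hHd : HasFDerivAt (fderiv ℝ (fderiv ℝ φ)) (fderiv ℝ (fderiv ℝ (fderiv ℝ φ)) z) z :=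
    ((hJc.fderiv_right (m := 1) (by norm_num)).differentiableAt (by norm_num)).hasFDerivAt
  have hsym : ∀ X Y, fderiv ℝ (fderiv ℝ φ) z X Y = fderiv ℝ (fderiv ℝ φ) z Y X :=
    hφ2.isSymmSndFDerivAt (by simp)
  have hsym3 : ∀ X Y W, fderiv ℝ (fderiv ℝ (fderiv ℝ φ)) z X Y W
      = fderiv ℝ (fderiv ℝ (fderiv ℝ φ)) z Y X W := fun X Y W => by
    rw [(hJc.isSymmSndFDerivAt (by simp)) X Y]
  have hGc : ContDiffAt ℝ 2 G z := contDiffAt_pullback (k := 2) (by norm_num; exact hφ) hG' hG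
  have hΓ : HasFDerivAt (chrMap G) (fderiv ℝ (chrMap G) z) z :=
    ((contDiffAt_chrMap hGc hdet.self_of_nhds).differentiableAt (by norm_num)).hasFDerivAt
  have hΓ' : HasFDerivAt (fun y => chrMap G' (φ y))
      ((fderiv ℝ (chrMap G') (φ z)).comp (fderiv ℝ φ z)) z :=
    HasFDerivAt.comp (G := Euc n →L[ℝ] Euc n →L[ℝ] Euc n) z ((contDiffAt_chrMap hG'
      hdet'.self_of_nhds).differentiableAt (by norm_num)).hasFDerivAt hφd
  have hlaw : ∀ᶠ y in 𝓝 z, ∀ X Y, fderiv ℝ φ y (chrMap G y X Y)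
      = chrMap G' (φ y) (fderiv ℝ φ y X) (fderiv ℝ φ y Y) + fderiv ℝ (fderiv ℝ φ) y X Y := by
    filter_upwards [hφ2.eventually (by simp), eventually_eventually_nhds.2 hG, hsurj,
      hφ.continuousAt.eventually (hG'.eventually (by simp)), hs, hdet', hdet]
      with y h1 h2 h3 h4 h5 h6 h7 X Y
    exact chrMap_pullback h1 h3 h2 (h4.of_le (by norm_num)) h5 h6 h7 X Y
  have hlz := hlaw.self_of_nhds
  -- The transformation law differentiated in direction `Z`. Antisymmetrizing in `Z` and `X` removes
  -- the third derivatives of `φ`, and the law itself removes the remaining second derivatives.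
  have hder : ∀ Z X Y, fderiv ℝ (fderiv ℝ φ) z Z (chrMap G z X Y)
        + fderiv ℝ φ z (fderiv ℝ (chrMap G) z Z X Y)
      = fderiv ℝ (chrMap G') (φ z) (fderiv ℝ φ z Z) (fderiv ℝ φ z X) (fderiv ℝ φ z Y)
        + chrMap G' (φ z) (fderiv ℝ (fderiv ℝ φ) z Z X) (fderiv ℝ φ z Y)
        + chrMap G' (φ z) (fderiv ℝ φ z X) (fderiv ℝ (fderiv ℝ φ) z Z Y)
        + fderiv ℝ (fderiv ℝ (fderiv ℝ φ)) z Z X Y := by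
    intro Z X Y
    have h1 := hJd.clm_apply ((hΓ.clm_apply (hasFDerivAt_const X z)).clm_apply (hasFDerivAt_const Y z))
    have h2 := ((hΓ'.clm_apply (hJd.clm_apply (hasFDerivAt_const X z))).clm_apply
      (hJd.clm_apply (hasFDerivAt_const Y z))).add
      ((hHd.clm_apply (hasFDerivAt_const X z)).clm_apply (hasFDerivAt_const Y z))
    have h3 := h2.congr_of_eventuallyEq (f₁ := fun y => fderiv ℝ φ y (chrMap G y X Y)) (by
      filter_upwards [hlaw] with y hy
      rw [hy]; rfl)
    have h4 := DFunLike.congr_fun (h1.unique h3) Z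
    simp at h4
    rw [add_comm, h4]
    abel
  have e1 := hder Z X Y
  have e2 := hder X Z Y
  rw [hsym3 X Z Y, hsym X Z] at e2
  unfold riem
  simp only [map_add, map_sub, hlz]
  rw [eq_sub_of_add_eq' e1, eq_sub_of_add_eq' e2]
  abel

end Invariance

/-! ### Invariance of the Ricci trace and of the scalar curvature. -/

section Invariance

variable {n : ℕ}

theorem isLinearMap_eq_sum {V : Type*} [AddCommGroup V] [Module ℝ V] {f : Euc n → V}
    (hf : IsLinearMap ℝ f) (X : Euc n) : f X = ∑ i, X i • f (EuclideanSpace.single i 1) := by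
  conv_lhs => rw [euc_eq_sum X]
  change hf.mk' f _ = _
  rw [map_sum]
  simp only [map_smul]
  rfl

/-- The matrix of a linear map of `ℝⁿ`. -/
def jacMat (A : Euc n →L[ℝ] Euc n) : Matrix (Fin n) (Fin n) ℝ :=
  LinearMap.toMatrix (EuclideanSpace.basisFun (Fin n) ℝ).toBasis
    (EuclideanSpace.basisFun (Fin n) ℝ).toBasis A.toLinearMap

theorem jacMat_apply (A : Euc n →L[ℝ] Euc n) (a i : Fin n) :
    jacMat A a i = A (EuclideanSpace.single i 1) a := by
  simp [jacMat, LinearMap.toMatrix_apply]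

theorem det_jacMat (A : Euc n →L[ℝ] Euc n) : (jacMat A).det = A.det := by
  rw [jacMat, LinearMap.det_toMatrix]

/-- The matrix of a bilinear form. -/
theorem bilinearComp_single (B : Euc n →L[ℝ] Euc n →L[ℝ] ℝ) (A : Euc n →L[ℝ] Euc n) :
    (Matrix.of fun i j => B.bilinearComp A A (EuclideanSpace.single i 1) (EuclideanSpace.single j 1))
      = (jacMat A).transpose * (Matrix.of fun i j =>
          B (EuclideanSpace.single i 1) (EuclideanSpace.single j 1)) * jacMat A := by
  ext i j
  rw [Matrix.of_apply, ContinuousLinearMap.bilinearComp_apply, Matrix.mul_apply]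
  refine (isLinearMap_eq_sum (f := fun Y => B (A (EuclideanSpace.single i 1)) Y)
    ⟨map_add _, map_smul _⟩ (A (EuclideanSpace.single j 1))).trans ?_
  refine Finset.sum_congr rfl fun b _ => ?_
  rw [jacMat_apply, Matrix.mul_apply, smul_eq_mul, mul_comm]
  congr 1
  refine (form_apply_single B _ b).trans (Finset.sum_congr rfl fun a _ => ?_)
  rw [Matrix.transpose_apply, jacMat_apply, Matrix.of_apply]

variable {G G' : Euc n → Euc n →L[ℝ] Euc n →L[ℝ] ℝ} {φ : Euc n → Euc n} {z : Euc n}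

theorem comp_pullback {A : Euc n →L[ℝ] Euc n} {y : Euc n} (hG : G z = (G' y).bilinearComp A A) :
    comp G z = (jacMat A).transpose * comp G' y * jacMat A := by
  rw [comp, hG, bilinearComp_single]; rfl

theorem det_comp_pullback {A : Euc n →L[ℝ] Euc n} {y : Euc n}
    (hG : G z = (G' y).bilinearComp A A) : (comp G z).det = A.det ^ 2 * (comp G' y).det := by
  rw [comp_pullback hG, Matrix.det_mul, Matrix.det_mul, Matrix.det_transpose, det_jacMat]; ring

theorem surjective_of_det_ne_zero {A : Euc n →L[ℝ] Euc n} (hA : A.det ≠ 0) :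
    Function.Surjective A :=
  (LinearMap.equivOfDetNeZero A.toLinearMap hA).surjective

/-- The Ricci curvature, as the trace of the curvature operator. -/
def ricTrace (G : Euc n → Euc n →L[ℝ] Euc n →L[ℝ] ℝ) (z X Y : Euc n) : ℝ :=
  ∑ k, riem G z (EuclideanSpace.single k 1) X Y k

theorem isLinearMap_riem (G : Euc n → Euc n →L[ℝ] Euc n →L[ℝ] ℝ) (z X Y : Euc n) :
    IsLinearMap ℝ (fun Z => riem G z Z X Y) := by
  constructor
  · intros; simp only [riem, map_add, add_apply]; abel
  · intros; simp only [riem, map_smul, smul_apply, smul_add, smul_sub]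

/-- The hypothesis says that `A` conjugates one endomorphism `Z ↦ R(Z, X) Y` into the other, and the
trace is invariant under conjugation. -/
theorem ricTrace_pullback {A : Euc n →L[ℝ] Euc n} (hA : A.det ≠ 0) {y X Y : Euc n}
    (h : ∀ Z, A (riem G z Z X Y) = riem G' y (A Z) (A X) (A Y)) :
    ricTrace G z X Y = ricTrace G' y (A X) (A Y) := by
  have htr : ∀ (G : Euc n → Euc n →L[ℝ] Euc n →L[ℝ] ℝ) (z X Y : Euc n), ricTrace G z X Y
      = LinearMap.trace ℝ (Euc n) ((isLinearMap_riem G z X Y).mk' _) := fun G z X Y => by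
    rw [LinearMap.trace_eq_sum_inner _ (EuclideanSpace.basisFun (Fin n) ℝ)]
    unfold ricTrace
    refine Finset.sum_congr rfl fun k _ => ?_
    simp [EuclideanSpace.inner_single_left]
  rw [htr, htr, ← LinearMap.trace_conj' _ (LinearMap.equivOfDetNeZero A.toLinearMap hA)]
  congr 1
  ext1 w
  obtain ⟨Z, rfl⟩ := surjective_of_det_ne_zero hA w
  rw [LinearEquiv.conj_apply_apply]
  have e : (LinearMap.equivOfDetNeZero A.toLinearMap hA).symm (A Z) = Z :=
    (LinearMap.equivOfDetNeZero A.toLinearMap hA).symm_apply_apply Z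
  rw [e]
  exact h Z

theorem christoffel_symm (hs : ∀ᶠ y in 𝓝 z, ∀ X Y, G y X Y = G y Y X) (k i j : Fin n) :
    christoffel univ G k i j z = christoffel univ G k j i z := by
  unfold christoffel
  congr 1
  refine Finset.sum_congr rfl fun l _ => ?_
  rw [pd_congr (i := l) (F := fun z => comp G z i j) (F' := fun z => comp G z j i)
    (hs.mono fun y hy => hy _ _)]
  ring

/-- The order `j`, `i` of the arguments matches the convention of `coordRicci`: the subtracted
derivative is in direction `j`, the slot `X` of `R(Z, X) Y`. The remaining reordering of indices is
the symmetry of the Christoffel symbols. -/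
theorem coordRicci_eq_ricTrace (hG : ContDiffAt ℝ 2 G z)
    (hs : ∀ᶠ y in 𝓝 z, ∀ X Y, G y X Y = G y Y X) (hdet : (comp G z).det ≠ 0) (i j : Fin n) :
    coordRicci univ G i j z = ricTrace G z (EuclideanSpace.single j 1) (EuclideanSpace.single i 1) := by
  have hΓ : HasFDerivAt (chrMap G) (fderiv ℝ (chrMap G) z) z :=
    ((contDiffAt_chrMap hG hdet).differentiableAt (by norm_num)).hasFDerivAt
  have hd : ∀ l k i j, fderiv ℝ (chrMap G) z (EuclideanSpace.single l 1) (EuclideanSpace.single i 1)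
      (EuclideanSpace.single j 1) k = pd univ l (christoffel univ G k i j) z := by
    intro l k i j
    have h1 := (hΓ.clm_apply (hasFDerivAt_const (EuclideanSpace.single i (1 : ℝ)) z)).clm_apply
      (hasFDerivAt_const (EuclideanSpace.single j (1 : ℝ)) z)
    have h2 := ((EuclideanSpace.proj k : Euc n →L[ℝ] ℝ).hasFDerivAt.comp z h1)
    have h3 : (⇑(EuclideanSpace.proj k : Euc n →L[ℝ] ℝ) ∘ fun y => chrMap G y
        (EuclideanSpace.single i 1) (EuclideanSpace.single j 1)) = christoffel univ G k i j := by
      ext y; exact chrMap_single G y k i j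
    rw [h3] at h2
    rw [pd_univ, h2.fderiv]
    simp
  have hsym := fun k i j => christoffel_symm hs k i j
  have hsym' : ∀ l k i j, pd univ l (christoffel univ G k i j) z
      = pd univ l (christoffel univ G k j i) z := fun l k i j =>
    pd_congr ((eventually_eventually_nhds.2 hs).mono fun y hy => christoffel_symm hy k i j)
  have hcc : ∀ k m (v : Euc n), chrMap G z (EuclideanSpace.single m 1) v k
      = ∑ l, christoffel univ G k m l z * v l := fun k m v => by
    rw [chrMap_apply]
    simp
  unfold coordRicci ricTrace riem
  refine Finset.sum_congr rfl fun k _ => ?_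
  have hsum : ∀ c : Fin n → ℝ, ∑ l, c l * (EuclideanSpace.single i (1 : ℝ) : Euc n) l = c i :=
    fun c => by simp
  simp only [PiLp.add_apply, PiLp.sub_apply, hd, hcc, hsum]
  rw [hsym' k k i j, hsym' j k i k, Finset.sum_sub_distrib]
  simp only [hsym _ i _]
  ring

theorem isLinearMap_ricTrace_left (G : Euc n → Euc n →L[ℝ] Euc n →L[ℝ] ℝ) (z Y : Euc n) :
    IsLinearMap ℝ (fun X => ricTrace G z X Y) := by
  constructor
  · intros
    simp only [ricTrace, ← Finset.sum_add_distrib]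
    refine Finset.sum_congr rfl fun k _ => ?_
    simp only [riem, map_add, add_apply, PiLp.add_apply, PiLp.sub_apply]; ring
  · intros
    simp only [ricTrace, Finset.smul_sum]
    refine Finset.sum_congr rfl fun k _ => ?_
    simp only [riem, map_smul, smul_apply, PiLp.add_apply, PiLp.sub_apply, PiLp.smul_apply,
      smul_eq_mul]; ring

theorem isLinearMap_ricTrace_right (G : Euc n → Euc n →L[ℝ] Euc n →L[ℝ] ℝ) (z X : Euc n) :
    IsLinearMap ℝ (fun Y => ricTrace G z X Y) := by
  constructor
  · intros
    simp only [ricTrace, ← Finset.sum_add_distrib]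
    refine Finset.sum_congr rfl fun k _ => ?_
    simp only [riem, map_add, PiLp.add_apply, PiLp.sub_apply]; ring
  · intros
    simp only [ricTrace, Finset.smul_sum]
    refine Finset.sum_congr rfl fun k _ => ?_
    simp only [riem, map_smul, PiLp.add_apply, PiLp.sub_apply, PiLp.smul_apply, smul_eq_mul]; ring

theorem coordScal_eq_trace (S : Set (Euc n)) (G : Euc n → Euc n →L[ℝ] Euc n →L[ℝ] ℝ) (z : Euc n) :
    coordScal S G z = (compInv G z * (Matrix.of fun i j => coordRicci S G j i z)).trace := by
  simp [coordScal, Matrix.trace, Matrix.mul_apply]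

/-- The scalar curvature is invariant under changes of coordinates. -/
theorem coordScal_pullback (hφ : ContDiffAt ℝ 3 φ z)
    (hdetφ : ∀ᶠ y in 𝓝 z, (fderiv ℝ φ y).det ≠ 0)
    (hG : ∀ᶠ y in 𝓝 z, G y = (G' (φ y)).bilinearComp (fderiv ℝ φ y) (fderiv ℝ φ y))
    (hG' : ContDiffAt ℝ 2 G' (φ z)) (hs : ∀ᶠ y in 𝓝 (φ z), ∀ X Y, G' y X Y = G' y Y X)
    (hdet' : (comp G' (φ z)).det ≠ 0) :
    coordScal univ G z = coordScal univ G' (φ z) := by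
  have hc := hφ.continuousAt
  have hs' := hc.eventually hs
  have hdc : ContinuousAt (fun y => (comp G' y).det) (φ z) :=
    (contDiffAt_det (contDiffAt_comp hG')).continuousAt
  have hd1 : ∀ᶠ y in 𝓝 z, (comp G' (φ y)).det ≠ 0 := hc.eventually (hdc.eventually_ne hdet')
  have hd2 : ∀ᶠ y in 𝓝 z, (comp G y).det ≠ 0 := by
    filter_upwards [hG, hd1, hdetφ] with y h1 h2 h3
    rw [det_comp_pullback h1]
    exact mul_ne_zero (pow_ne_zero _ h3) h2
  have hGc : ContDiffAt ℝ 2 G z := contDiffAt_pullback (k := 2) (by norm_num; exact hφ) hG' hG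
  have hsG : ∀ᶠ y in 𝓝 z, ∀ X Y, G y X Y = G y Y X := by
    filter_upwards [hG, hs'] with y h1 h2 X Y
    rw [h1]; exact h2 _ _
  have hr := riem_pullback hφ hG hG' hs' hd1 hd2
    (hdetφ.mono fun y hy => surjective_of_det_ne_zero hy)
  set A := fderiv ℝ φ z with hA
  have hAd : A.det ≠ 0 := hdetφ.self_of_nhds
  have hric : (Matrix.of fun i j => coordRicci univ G j i z)
      = (jacMat A).transpose * (Matrix.of fun i j => coordRicci univ G' j i (φ z)) * jacMat A := by
    ext i j
    rw [Matrix.of_apply, coordRicci_eq_ricTrace hGc hsG hd2.self_of_nhds,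
      ricTrace_pullback hAd (fun Z => hr Z _ _),
      isLinearMap_eq_sum (isLinearMap_ricTrace_right G' (φ z) _), Matrix.mul_apply]
    refine Finset.sum_congr rfl fun b _ => ?_
    rw [jacMat_apply, Matrix.mul_apply, smul_eq_mul, mul_comm,
      isLinearMap_eq_sum (isLinearMap_ricTrace_left G' (φ z) _)]
    congr 1
    refine Finset.sum_congr rfl fun a _ => ?_
    rw [Matrix.transpose_apply, jacMat_apply, Matrix.of_apply,
      coordRicci_eq_ricTrace hG' hs hdet', smul_eq_mul]
  have hJ : IsUnit (jacMat A).det := by rw [det_jacMat]; exact isUnit_iff_ne_zero.2 hAd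
  have hJt : IsUnit (jacMat A).transpose.det := by rwa [Matrix.det_transpose]
  -- With `J` the Jacobian, the trace of `(Jᵀ G' J)⁻¹ (Jᵀ Ric' J)` equals that of `G'⁻¹ Ric'` by
  -- cyclicity.
  rw [coordScal_eq_trace, coordScal_eq_trace, hric, compInv, comp_pullback hG.self_of_nhds,
    Matrix.mul_inv_rev, Matrix.mul_inv_rev, ← compInv]
  rw [Matrix.mul_assoc (jacMat A).transpose, Matrix.mul_assoc, Matrix.mul_assoc,
    Matrix.nonsing_inv_mul_cancel_left _ _ hJt, Matrix.trace_mul_comm, Matrix.mul_assoc,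
    Matrix.mul_assoc, Matrix.mul_nonsing_inv _ hJ, Matrix.mul_one]

end Invariance

/-! ### Parametrizations of a manifold by subsets of `ℝⁿ` -/

section Parametrization

variable {n : ℕ} {H : Type*} [TopologicalSpace H] (I : ModelWithCorners ℝ (Euc n) H)
  {M : Type*} [TopologicalSpace M] [ChartedSpace H M]

/-- A smooth coordinate system on an open set of `M`, with values in a subset of `ℝⁿ`. -/
structure IsParam (e : PartialEquiv M (Euc n)) : Prop where
  isOpen_source : IsOpen e.source
  measurableSet_target : MeasurableSet e.target
  uniqueDiffOn : UniqueDiffOn ℝ e.target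
  null_boundary : volume (e.target \ interior e.target) = 0
  smooth : ContMDiffOn I 𝓘(ℝ, Euc n) ∞ e e.source
  smooth_symm : ContMDiffOn 𝓘(ℝ, Euc n) I ∞ e.symm e.target

variable {I}

theorem isParam_extChartAt [IsManifold I ∞ M] (p : M) : IsParam I (extChartAt I p) where
  isOpen_source := isOpen_extChartAt_source p
  measurableSet_target := by
    rw [extChartAt_target]
    exact ((chartAt H p).open_target.preimage I.continuous_symm).measurableSet.inter
      I.isClosed_range.measurableSet
  uniqueDiffOn := uniqueDiffOn_extChartAt_target p
  null_boundary := by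
    -- The target is relatively open in the range of the model, which is convex, and the frontier of
    -- a convex set is a null set.
    refine measure_mono_null (t := frontier (range I)) ?_ (I.convex_range.addHaar_frontier volume)
    rw [extChartAt_target, interior_inter,
      ((chartAt H p).open_target.preimage I.continuous_symm).interior_eq, I.isClosed_range.frontier_eq]
    exact fun y hy => ⟨hy.1.2, fun h => hy.2 ⟨hy.1.1, h⟩⟩
  smooth := by rw [extChartAt_source]; exact contMDiffOn_extChartAt
  smooth_symm := contMDiffOn_extChartAt_symm p

theorem ChartAtInfinity.isParam (Φ : ChartAtInfinity I M) : IsParam I Φ.Psi.toPartialEquiv where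
  isOpen_source := Φ.Psi.open_source
  measurableSet_target := Φ.Psi.open_target.measurableSet
  uniqueDiffOn := Φ.Psi.open_target.uniqueDiffOn
  null_boundary := by simp [Φ.Psi.open_target.interior_eq]
  smooth := Φ.smooth
  smooth_symm := Φ.smooth_symm

variable {e e' : PartialEquiv M (Euc n)} {y : Euc n}

theorem IsParam.hasMFDerivWithinAt_symm (he : IsParam I e) (hy : y ∈ e.target) :
    HasMFDerivWithinAt 𝓘(ℝ, Euc n) I e.symm e.target y
      (mfderivWithin 𝓘(ℝ, Euc n) I e.symm e.target y) :=
  ((he.smooth_symm y hy).mdifferentiableWithinAt (by simp)).hasMFDerivWithinAt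

theorem IsParam.preimage_mem (he : IsParam I e) (he' : IsParam I e') (hy : y ∈ e.target)
    (hy' : e.symm y ∈ e'.source) : e.target ∩ e.symm ⁻¹' e'.source ∈ 𝓝[e.target] y :=
  inter_mem self_mem_nhdsWithin
    ((he.smooth_symm y hy).continuousWithinAt.preimage_mem_nhdsWithin
      (he'.isOpen_source.mem_nhds hy'))

/-- Coordinate changes are smooth. -/
theorem IsParam.contDiffOn_transition (he : IsParam I e) (he' : IsParam I e') :
    ContDiffOn ℝ ∞ (e' ∘ e.symm) (e.target ∩ e.symm ⁻¹' e'.source) := by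
  rw [← contMDiffOn_iff_contDiffOn]
  exact he'.smooth.comp (he.smooth_symm.mono inter_subset_left) inter_subset_right

theorem IsParam.contDiffWithinAt_transition (he : IsParam I e) (he' : IsParam I e')
    (hy : y ∈ e.target) (hy' : e.symm y ∈ e'.source) :
    ContDiffWithinAt ℝ ∞ (e' ∘ e.symm) e.target y :=
  (he.contDiffOn_transition he' y ⟨hy, hy'⟩).mono_of_mem_nhdsWithin (he.preimage_mem he' hy hy')

theorem IsParam.hasFDerivWithinAt_transition (he : IsParam I e) (he' : IsParam I e')
    (hy : y ∈ e.target) (hy' : e.symm y ∈ e'.source) :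
    HasFDerivWithinAt (e' ∘ e.symm) (fderivWithin ℝ (e' ∘ e.symm) e.target y) e.target y :=
  ((he.contDiffWithinAt_transition he' hy hy').differentiableWithinAt (by simp)).hasFDerivWithinAt

/-- Chain rule for `e.symm = e'.symm ∘ (e' ∘ e.symm)`. That factorization holds only near `y` in the
target, so derivatives are taken within the smaller set `D` and then transferred. -/
theorem IsParam.mfderivWithin_symm_eq (he : IsParam I e) (he' : IsParam I e')
    (hy : y ∈ e.target) (hy' : e.symm y ∈ e'.source) (v : Euc n) :
    (mfderivWithin 𝓘(ℝ, Euc n) I e.symm e.target y v : Euc n)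
      = (mfderivWithin 𝓘(ℝ, Euc n) I e'.symm e'.target (e' (e.symm y))
          (fderivWithin ℝ (e' ∘ e.symm) e.target y v) : Euc n) := by
  set D := e.target ∩ e.symm ⁻¹' e'.source with hD
  have hmem := he.preimage_mem he' hy hy'
  have h1 : HasMFDerivWithinAt 𝓘(ℝ, Euc n) 𝓘(ℝ, Euc n) (e' ∘ e.symm) D y
      (fderivWithin ℝ (e' ∘ e.symm) e.target y) :=
    ((he.hasFDerivWithinAt_transition he' hy hy').mono inter_subset_left).hasMFDerivWithinAt
  have h2 := he'.hasMFDerivWithinAt_symm (y := (e' ∘ e.symm) y) (e'.map_source hy')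
  have h3 := h2.comp y h1 (fun z hz => e'.map_source hz.2)
  have h4 : HasMFDerivWithinAt 𝓘(ℝ, Euc n) I e.symm D y _ :=
    h3.congr_of_eventuallyEq (f₁ := e.symm)
      (by filter_upwards [self_mem_nhdsWithin] with z hz
          exact (e'.left_inv hz.2).symm) (e'.left_inv hy').symm
  have h5 := (h4.mono_of_mem_nhdsWithin hmem).mfderivWithin
    (he.uniqueDiffOn.uniqueMDiffOn y hy)
  rw [h5]
  rfl

/-- `T p` and `T q` have different types; viewing both as forms on `ℝⁿ` allows rewriting along `p =
q`. -/
theorem tensor_congr (T : Tensor2 I M) {p q : M} (h : p = q) (v w : Euc n) :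
    (T p : Euc n →L[ℝ] Euc n →L[ℝ] ℝ) v w = (T q : Euc n →L[ℝ] Euc n →L[ℝ] ℝ) v w := by
  subst h; rfl

/-- The transformation law of tensors. -/
theorem IsParam.pullTensor_eq (he : IsParam I e) (he' : IsParam I e') (T : Tensor2 I M)
    (hy : y ∈ e.target) (hy' : e.symm y ∈ e'.source) :
    pullTensor I e.symm e.target T y
      = (pullTensor I e'.symm e'.target T (e' (e.symm y))).bilinearComp
        (fderivWithin ℝ (e' ∘ e.symm) e.target y) (fderivWithin ℝ (e' ∘ e.symm) e.target y) := by
  ext v w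
  change (T (e.symm y) : Euc n →L[ℝ] Euc n →L[ℝ] ℝ)
      (mfderivWithin 𝓘(ℝ, Euc n) I e.symm e.target y v : Euc n)
      (mfderivWithin 𝓘(ℝ, Euc n) I e.symm e.target y w : Euc n)
    = (T (e'.symm (e' (e.symm y))) : Euc n →L[ℝ] Euc n →L[ℝ] ℝ)
      (mfderivWithin 𝓘(ℝ, Euc n) I e'.symm e'.target (e' (e.symm y)) _ : Euc n)
      (mfderivWithin 𝓘(ℝ, Euc n) I e'.symm e'.target (e' (e.symm y)) _ : Euc n)
  rw [he.mfderivWithin_symm_eq he' hy hy', he.mfderivWithin_symm_eq he' hy hy']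
  exact tensor_congr T (e'.left_inv hy').symm _ _

/-- Near interior points, coordinate changes are defined on open sets. -/
theorem IsParam.eventually_mem (he : IsParam I e) (he' : IsParam I e') (hy : y ∈ interior e.target)
    (hy' : e.symm y ∈ e'.source) :
    ∀ᶠ z in 𝓝 y, z ∈ interior e.target ∧ e.symm z ∈ e'.source := by
  have h1 : ∀ᶠ z in 𝓝 y, z ∈ interior e.target := isOpen_interior.mem_nhds hy
  have h2 := he.preimage_mem he' (interior_subset hy) hy'
  rw [nhdsWithin_eq_nhds.2 (mem_interior_iff_mem_nhds.1 hy)] at h2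
  filter_upwards [h1, h2] with z hz hz'
  exact ⟨hz, hz'.2⟩

theorem IsParam.contDiffAt_transition (he : IsParam I e) (he' : IsParam I e')
    (hy : y ∈ interior e.target) (hy' : e.symm y ∈ e'.source) :
    ContDiffAt ℝ ∞ (e' ∘ e.symm) y :=
  (he.contDiffWithinAt_transition he' (interior_subset hy) hy').contDiffAt
    (mem_interior_iff_mem_nhds.1 hy)

/-- The reverse coordinate change is a left inverse near `y`. Its derivative is taken within
`e'.target`, because at this stage the image point is not known to be interior. -/
theorem IsParam.det_fderiv_transition_ne_zero (he : IsParam I e) (he' : IsParam I e')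
    (hy : y ∈ interior e.target) (hy' : e.symm y ∈ e'.source) :
    (fderiv ℝ (e' ∘ e.symm) y).det ≠ 0 := by
  have hyt := interior_subset hy
  have h1 : HasFDerivAt (e' ∘ e.symm) (fderiv ℝ (e' ∘ e.symm) y) y :=
    ((he.contDiffAt_transition he' hy hy').differentiableAt (by simp)).hasFDerivAt
  have h0 : e'.symm (e' (e.symm y)) ∈ e.source := by
    rw [e'.left_inv hy']; exact e.map_target hyt
  have h2 := he'.hasFDerivWithinAt_transition he (y := e' (e.symm y)) (e'.map_source hy') h0
  have hev := he.eventually_mem he' hy hy'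
  have h3 := HasFDerivWithinAt.comp_hasFDerivAt (g := e ∘ e'.symm) (f := e' ∘ e.symm) y h2 h1
    (hev.mono fun z hz => e'.map_source hz.2)
  have h4 : HasFDerivAt (fun z : Euc n => z) _ y := h3.congr_of_eventuallyEq (hev.mono fun z hz => by
    simp only [Function.comp_apply]
    rw [e'.left_inv hz.2, e.right_inv (interior_subset hz.1)])
  have h5 := h4.unique (hasFDerivAt_id y)
  intro hdet
  have h6 := congrArg ContinuousLinearMap.det h5
  have h7 : ((fderivWithin ℝ (e ∘ e'.symm) e'.target (e' (e.symm y))).comp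
      (fderiv ℝ (e' ∘ e.symm) y)).det
      = (fderivWithin ℝ (e ∘ e'.symm) e'.target (e' (e.symm y))).det
        * (fderiv ℝ (e' ∘ e.symm) y).det := LinearMap.det_comp _ _
  rw [h7, hdet, mul_zero] at h6
  have h8 : (ContinuousLinearMap.id ℝ (Euc n)).det = 1 := LinearMap.det_id
  rw [h8] at h6
  exact zero_ne_one h6

/-- Invariance of interior points: the coordinate change has surjective strict derivative, so it
maps neighbourhoods onto neighbourhoods, and its image lies in the other target. -/
theorem IsParam.mem_interior (he : IsParam I e) (he' : IsParam I e')
    (hy : y ∈ interior e.target) (hy' : e.symm y ∈ e'.source) :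
    e' (e.symm y) ∈ interior e'.target := by
  have hc := he.contDiffAt_transition he' hy hy'
  have h1 := (hc.hasStrictFDerivAt (by simp)).map_nhds_eq_of_surj
    (LinearMap.range_eq_top.2 (surjective_of_det_ne_zero (he.det_fderiv_transition_ne_zero he' hy hy')))
  rw [mem_interior_iff_mem_nhds]
  change e'.target ∈ 𝓝 ((e' ∘ e.symm) y)
  rw [← h1]
  exact (he.eventually_mem he' hy hy').mono fun z hz => e'.map_source hz.2

/-- The scalar curvature does not depend on the coordinates. -/
theorem IsParam.coordScal_eq (he : IsParam I e) (he' : IsParam I e') (T : Tensor2 I M)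
    {U : Set M} (hU : IsOpen U) (hs : IsSymmOn I U T) (hy : y ∈ interior e.target)
    (hy' : e.symm y ∈ e'.source) (hyU : e.symm y ∈ U)
    (hT : ContDiffAt ℝ 2 (pullTensor I e'.symm e'.target T) (e' (e.symm y)))
    (hdet : (comp (pullTensor I e'.symm e'.target T) (e' (e.symm y))).det ≠ 0) :
    coordScal univ (pullTensor I e.symm e.target T) y
      = coordScal univ (pullTensor I e'.symm e'.target T) (e' (e.symm y)) := by
  have hev := he.eventually_mem he' hy hy'
  refine coordScal_pullback (φ := e' ∘ e.symm)
    ((he.contDiffAt_transition he' hy hy').of_le (WithTop.coe_le_coe.2 (le_top : (3 : ℕ∞) ≤ ⊤))) ?_ ?_ hT ?_ hdet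
  · filter_upwards [hev] with z hz
    exact he.det_fderiv_transition_ne_zero he' hz.1 hz.2
  · filter_upwards [hev] with z hz
    rw [he.pullTensor_eq he' T (interior_subset hz.1) hz.2,
      fderivWithin_of_mem_nhds (mem_interior_iff_mem_nhds.1 hz.1)]
    rfl
  · have h1 := he.mem_interior he' hy hy'
    have h2 : ContinuousAt e'.symm (e' (e.symm y)) :=
      (he'.smooth_symm.continuousOn).continuousAt (mem_interior_iff_mem_nhds.1 h1)
    have h3 : ∀ᶠ z in 𝓝 (e' (e.symm y)), e'.symm z ∈ U := by
      refine h2.eventually (hU.mem_nhds ?_)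
      rw [e'.left_inv hy']; exact hyU
    filter_upwards [h3] with z hz X Y
    exact hs _ hz _ _

/-- The differential of a parametrization is injective. -/
theorem IsParam.eq_zero_of_mfderivWithin_symm (he : IsParam I e) (hy : y ∈ e.target) :
    ∀ v : Euc n, (mfderivWithin 𝓘(ℝ, Euc n) I e.symm e.target y v : Euc n) = 0 → v = 0 := by
  intro v hv
  have h0 := e.map_target hy
  have h1 : HasMFDerivAt I 𝓘(ℝ, Euc n) e (e.symm y) (mfderiv I 𝓘(ℝ, Euc n) e (e.symm y)) :=
    ((he.smooth.contMDiffAt (he.isOpen_source.mem_nhds h0)).mdifferentiableAt (by simp)).hasMFDerivAt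
  have h2 := h1.comp_hasMFDerivWithinAt y (he.hasMFDerivWithinAt_symm hy)
  have h3 : HasMFDerivWithinAt 𝓘(ℝ, Euc n) 𝓘(ℝ, Euc n) (id : Euc n → Euc n) e.target y _ :=
    h2.congr_of_eventuallyEq (f₁ := id)
      (by filter_upwards [self_mem_nhdsWithin] with z hz using (e.right_inv hz).symm)
      (e.right_inv hy).symm
  have h4 := h3.mfderivWithin (he.uniqueDiffOn.uniqueMDiffOn y hy)
  have h5 := (hasMFDerivAt_id (I := 𝓘(ℝ, Euc n)) y).hasMFDerivWithinAt.mfderivWithin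
    (s := e.target) (he.uniqueDiffOn.uniqueMDiffOn y hy)
  rw [h4] at h5
  have h6 := DFunLike.congr_fun h5 v
  have h7 : (mfderiv I 𝓘(ℝ, Euc n) e (e.symm y)
    (mfderivWithin 𝓘(ℝ, Euc n) I e.symm e.target y v) : Euc n) = v := h6
  rw [← h7]
  rw [show mfderivWithin 𝓘(ℝ, Euc n) I e.symm e.target y v = 0 from hv]
  exact map_zero _

/-- A positive definite tensor is positive definite in coordinates. -/
theorem IsParam.pullTensor_pos (he : IsParam I e) {T : Tensor2 I M} (hy : y ∈ e.target)
    (hT : ∀ v : TangentSpace I (e.symm y), v ≠ 0 → 0 < T (e.symm y) v v) {X : Euc n} (hX : X ≠ 0) :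
    0 < pullTensor I e.symm e.target T y X X :=
  hT _ fun h => hX (he.eq_zero_of_mfderivWithin_symm hy X h)

/-- A positive definite tensor is nondegenerate in coordinates. -/
theorem IsParam.det_ne_zero (he : IsParam I e) {T : Tensor2 I M} (hy : y ∈ e.target)
    (hT : ∀ v : TangentSpace I (e.symm y), v ≠ 0 → 0 < T (e.symm y) v v) :
    (comp (pullTensor I e.symm e.target T) y).det ≠ 0 := by
  intro hdet
  obtain ⟨v, hv, hv'⟩ := Matrix.exists_mulVec_eq_zero_iff.2 hdet
  set X : Euc n := WithLp.toLp 2 v with hX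
  have hX0 : X ≠ 0 := fun h => hv (by
    ext i; exact congrArg (fun x : Euc n => x i) h)
  have h1 : ∀ i, pullTensor I e.symm e.target T y (EuclideanSpace.single i 1) X = 0 := fun i => by
    rw [isLinearMap_eq_sum (f := fun Y => pullTensor I e.symm e.target T y
      (EuclideanSpace.single i 1) Y) ⟨map_add _, map_smul _⟩ X]
    have := congrFun hv' i
    rw [Matrix.mulVec, dotProduct] at this
    refine Eq.trans (Finset.sum_congr rfl fun j _ => ?_) this
    exact mul_comm _ _
  have h2 : pullTensor I e.symm e.target T y X X = 0 := by
    rw [isLinearMap_eq_sum (f := fun Y => pullTensor I e.symm e.target T y Y X)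
      ⟨fun a b => by simp, fun c a => by simp⟩ X]
    simp [h1]
  exact (he.pullTensor_pos hy hT hX0).ne' h2

end Parametrization

/-! ### The Riemannian measure in coordinates -/

section Volume

variable {n : ℕ} {H : Type*} [TopologicalSpace H] (I : ModelWithCorners ℝ (Euc n) H)
  {M : Type*} [TopologicalSpace M] [ChartedSpace H M] [MeasurableSpace M]

/-- The Riemannian measure in the domain of a coordinate system. -/
def chartVol (e : PartialEquiv M (Euc n)) (T : Tensor2 I M) : Measure M :=
  Measure.map e.symm ((volume.restrict e.target).withDensity
    fun y => ENNReal.ofReal (Real.sqrt (comp (pullTensor I e.symm e.target T) y).det))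

variable {I}

theorem riemVol_eq_iSup (T : Tensor2 I M) : riemVol I T = ⨆ p : M, chartVol I (extChartAt I p) T := rfl

variable {e e' : PartialEquiv M (Euc n)} [BorelSpace M]

theorem IsParam.measurableSet_preimage (he : IsParam I e) {A : Set M} (hA : MeasurableSet A) :
    MeasurableSet (e.target ∩ e.symm ⁻¹' A) := by
  have hc : Measurable (e.target.domRestrict e.symm) :=
    (continuousOn_iff_continuous_domRestrict.1 he.smooth_symm.continuousOn).measurable
  have := he.measurableSet_target.subtype_image (hc hA)
  convert this using 1
  ext y
  simp [Set.domRestrict, and_comm]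

theorem IsParam.aemeasurable_symm (he : IsParam I e) :
    AEMeasurable e.symm (volume.restrict e.target) :=
  he.smooth_symm.continuousOn.aemeasurable he.measurableSet_target

theorem IsParam.chartVol_apply (he : IsParam I e) (T : Tensor2 I M) {A : Set M}
    (hA : MeasurableSet A) : chartVol I e T A = ∫⁻ y in e.target ∩ e.symm ⁻¹' A,
      ENNReal.ofReal (Real.sqrt (comp (pullTensor I e.symm e.target T) y).det) := by
  have hac := withDensity_absolutelyContinuous (volume.restrict e.target)
    fun y => ENNReal.ofReal (Real.sqrt (comp (pullTensor I e.symm e.target T) y).det)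
  rw [chartVol, Measure.map_apply_of_aemeasurable (he.aemeasurable_symm.mono_ac hac) hA]
  have h0 : ((volume.restrict e.target).withDensity fun y =>
      ENNReal.ofReal (Real.sqrt (comp (pullTensor I e.symm e.target T) y).det)) e.targetᶜ = 0 :=
    hac (by rw [Measure.restrict_apply he.measurableSet_target.compl]; simp)
  rw [← measure_inter_add_sdiff₀ (e.symm ⁻¹' A) he.measurableSet_target.nullMeasurableSet,
    measure_mono_null (s := e.symm ⁻¹' A \ e.target) (fun y hy => hy.2) h0, add_zero, inter_comm,
    withDensity_apply _ (he.measurableSet_preimage hA),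
    Measure.restrict_restrict (he.measurableSet_preimage hA),
    inter_eq_left.2 (inter_subset_left : e.target ∩ e.symm ⁻¹' A ⊆ e.target)]

/-- The Riemannian measure does not depend on the coordinates. -/
theorem IsParam.chartVol_eq (he : IsParam I e) (he' : IsParam I e') (T : Tensor2 I M) {A : Set M}
    (hA : MeasurableSet A) (h : A ⊆ e.source) (h' : A ⊆ e'.source) :
    chartVol I e T A = chartVol I e' T A := by
  rw [he.chartVol_apply T hA, he'.chartVol_apply T hA]
  set D := e.target ∩ e.symm ⁻¹' A with hD
  have hDt : ∀ y ∈ D, y ∈ e.target ∧ e.symm y ∈ e'.source := fun y hy => ⟨hy.1, h' hy.2⟩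
  have him : e'.target ∩ e'.symm ⁻¹' A = (e' ∘ e.symm) '' D := by
    ext w
    constructor
    · intro hw
      refine ⟨e (e'.symm w), ⟨e.map_source (h hw.2), ?_⟩, ?_⟩
      · rw [mem_preimage, e.left_inv (h hw.2)]; exact hw.2
      · simp only [Function.comp_apply]
        rw [e.left_inv (h hw.2), e'.right_inv hw.1]
    · rintro ⟨y, hy, rfl⟩
      refine ⟨e'.map_source (h' hy.2), ?_⟩
      simp only [Function.comp_apply, mem_preimage]
      rw [e'.left_inv (h' hy.2)]; exact hy.2
  -- Change of variables for injective maps differentiable within a measurable set, so boundary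
  -- points need no separate treatment. The Jacobian factor cancels against that of `√det`.
  rw [him, lintegral_image_eq_lintegral_abs_det_fderiv_mul volume
    (he.measurableSet_preimage hA) (f' := fun y => fderivWithin ℝ (e' ∘ e.symm) e.target y)
    (fun y hy => (he.hasFDerivWithinAt_transition he' (hDt y hy).1 (hDt y hy).2).mono inter_subset_left)
    (fun y hy z hz hyz => by
      have h1 : e.symm y = e.symm z := e'.injOn (hDt y hy).2 (hDt z hz).2 hyz
      exact e.symm.injOn hy.1 hz.1 h1)]
  refine setLIntegral_congr_fun (he.measurableSet_preimage hA) fun y hy => ?_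
  simp only [Function.comp_apply]
  rw [det_comp_pullback (he.pullTensor_eq he' T (hDt y hy).1 (hDt y hy).2),
    Real.sqrt_mul (sq_nonneg _), Real.sqrt_sq_eq_abs, ENNReal.ofReal_mul (abs_nonneg _)]

theorem IsParam.chartVol_inter_source (he : IsParam I e) (T : Tensor2 I M) {A : Set M}
    (hA : MeasurableSet A) : chartVol I e T A = chartVol I e T (A ∩ e.source) := by
  rw [he.chartVol_apply T hA, he.chartVol_apply T (hA.inter he.isOpen_source.measurableSet)]
  congr 2
  ext y
  simp only [mem_inter_iff, mem_preimage]
  exact ⟨fun h => ⟨h.1, h.2, e.map_target h.1⟩, fun h => ⟨h.1, h.2.1⟩⟩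

variable [IsManifold I ∞ M]

/-- A supremum of measures is not evaluated setwise, so one exhibits a measure above all chart
measures: `chartVol` of `e`, with infinite mass added off `A`. At `A` the added part vanishes. -/
theorem IsParam.riemVol_apply_le (he : IsParam I e) (T : Tensor2 I M) {A : Set M}
    (hA : MeasurableSet A) (h : A ⊆ e.source) : riemVol I T A ≤ chartVol I e T A := by
  have h1 : riemVol I T ≤ chartVol I e T + (⊤ : Measure M).restrict Aᶜ := by
    rw [riemVol_eq_iSup]
    refine iSup_le fun p => Measure.le_intro fun B hB _ => ?_
    have hp := isParam_extChartAt (I := I) p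
    rw [Measure.add_apply, Measure.restrict_apply hB, ← measure_inter_add_sdiff B hA]
    refine add_le_add ?_ ((le_top : (chartVol I (extChartAt I p) T) ≤ ⊤) (B \ A))
    rw [hp.chartVol_inter_source T (hB.inter hA), hp.chartVol_eq he T
      ((hB.inter hA).inter hp.isOpen_source.measurableSet) inter_subset_right
      fun q hq => h hq.1.2]
    exact measure_mono fun q hq => hq.1.1
  have h2 := h1 A
  rwa [Measure.add_apply, Measure.restrict_apply hA, inter_compl_self, measure_empty, add_zero] at h2

/-- The lower bound is immediate only inside a single chart of the atlas. Second countability gives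
a countable cover of `A` by such pieces, and restrictions agreeing on each piece agree on the union.
-/
theorem IsParam.riemVol_restrict [SecondCountableTopology M] (he : IsParam I e) (T : Tensor2 I M)
    {A : Set M} (hA : MeasurableSet A) (h : A ⊆ e.source) :
    (riemVol I T).restrict A = (chartVol I e T).restrict A := by
  obtain ⟨s, hs, hc⟩ := TopologicalSpace.countable_cover_nhds
    (fun p : M => (isOpen_extChartAt_source (I := I) p).mem_nhds (mem_extChartAt_source p))
  have hA' : A = ⋃ p ∈ s, A ∩ (extChartAt I p).source := by
    rw [← inter_iUnion₂, hc, inter_univ]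
  rw [hA', Measure.restrict_biUnion_congr hs]
  intro p _
  have hp := isParam_extChartAt (I := I) p
  have hm := hA.inter hp.isOpen_source.measurableSet
  ext B hB
  rw [Measure.restrict_apply hB, Measure.restrict_apply hB]
  have hBm := hB.inter hm
  refine le_antisymm (he.riemVol_apply_le T hBm fun q hq => h hq.2.1) ?_
  rw [he.chartVol_eq hp T hBm (fun q hq => h hq.2.1) fun q hq => hq.2.2, riemVol_eq_iSup]
  exact (le_iSup (fun p => chartVol I (extChartAt I p) T) p) _

end Volume

/-! ### Bounds on the scalar curvature and local integrability -/

section LocalIntegrability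

variable {n : ℕ} {α : ℝ} {S : Set (Euc n)}

theorem BddHolder.det {k : ℕ} {A : Euc n → Matrix (Fin n) (Fin n) ℝ} (hS : UniqueDiffOn ℝ S)
    (h : ∀ i j, BddHolder k α S (fun x => A x i j)) : BddHolder k α S (fun x => (A x).det) := by
  simp only [Matrix.det_apply]
  refine BddHolder.sum _ hS fun σ _ => ?_
  have h1 := BddHolder.prod (α := α) (k := k) Finset.univ hS fun i _ => h (σ i) i
  refine (((BddHolder.const ((Equiv.Perm.sign σ : ℤ) : ℝ) hS).mul h1 hS)).congr fun x _ => ?_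
  simp only
  rw [Units.smul_def, zsmul_eq_mul]

theorem BddHolder.pd {k : ℕ} {f : Euc n → ℝ} (hf : BddHolder (k + 1) α S f) (hS : UniqueDiffOn ℝ S)
    (i : Fin n) : BddHolder k α S (pd S i f) :=
  (hf.fderivWithin hS).clm_comp
    (ContinuousLinearMap.apply ℝ ℝ (EuclideanSpace.single i (1 : ℝ))) hS

variable {G : Euc n → Euc n →L[ℝ] Euc n →L[ℝ] ℝ} {c : ℝ}

theorem BddHolder.comp_apply {k : ℕ} (hG : BddHolder k α S G) (hS : UniqueDiffOn ℝ S) (i j : Fin n) :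
    BddHolder k α S (fun y => comp G y i j) := by
  have h1 : BddHolder k α S (fun y => G y (EuclideanSpace.single i 1)) :=
    hG.clm_comp (ContinuousLinearMap.apply ℝ (Euc n →L[ℝ] ℝ) (EuclideanSpace.single i (1 : ℝ))) hS
  exact h1.clm_comp (ContinuousLinearMap.apply ℝ ℝ (EuclideanSpace.single j (1 : ℝ))) hS

theorem BddHolder.compInv_apply {k : ℕ} (hG : BddHolder k α S G) (hS : UniqueDiffOn ℝ S)
    (hc : 0 < c) (hdet : ∀ y ∈ S, c ≤ |(comp G y).det|) (i j : Fin n) :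
    BddHolder k α S (fun y => compInv G y i j) := by
  have hadj : BddHolder k α S (fun y => (comp G y).adjugate i j) := by
    simp only [Matrix.adjugate_apply]
    refine BddHolder.det hS fun a b => ?_
    simp only [Matrix.updateRow_apply]
    split_ifs
    · exact BddHolder.const _ hS
    · exact hG.comp_apply hS a b
  refine (((BddHolder.det hS (hG.comp_apply hS)).inv hS hc hdet).mul hadj hS).congr fun y _ => ?_
  simp [compInv, Matrix.inv_def]

theorem BddHolder.coordScal (hG : BddHolder 2 α S G) (hS : UniqueDiffOn ℝ S)
    (hc : 0 < c) (hdet : ∀ y ∈ S, c ≤ |(comp G y).det|) : BddHolder 0 α S (coordScal S G) := by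
  have h1 := hG.compInv_apply hS hc hdet
  have h2 : ∀ l i j, BddHolder 1 α S (AHJang.pd S l (fun y => comp G y i j)) := fun l i j =>
    (hG.comp_apply hS i j).pd hS l
  have h3 : ∀ k i j, BddHolder 1 α S (christoffel S G k i j) := fun k i j =>
    (BddHolder.const (1 / 2 : ℝ) hS).mul (BddHolder.sum _ hS fun l _ =>
      ((h1 k l).of_le (by norm_num)).mul (((h2 i j l).add (h2 j i l) hS).sub (h2 l i j) hS) hS) hS
  have h4 : ∀ k i j, BddHolder 0 α S (christoffel S G k i j) := fun k i j =>
    (h3 k i j).of_le (by norm_num)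
  have h5 : ∀ i j, BddHolder 0 α S (coordRicci S G i j) := fun i j =>
    BddHolder.sum _ hS fun k _ => (((h3 k i j).pd hS k).sub ((h3 k i k).pd hS j) hS).add
      (BddHolder.sum _ hS fun l _ => ((h4 k k l).mul (h4 l i j) hS).sub
        ((h4 k j l).mul (h4 l i k) hS) hS) hS
  exact BddHolder.sum _ hS fun i _ => BddHolder.sum _ hS fun j _ =>
    ((h1 i j).of_le (by norm_num)).mul (h5 i j) hS

theorem pd_eq_of_mem_interior {y : Euc n} (hy : y ∈ interior S) (i : Fin n) (f : Euc n → ℝ) :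
    pd S i f y = pd univ i f y := by
  rw [pd_univ, pd, fderivWithin_of_mem_nhds (mem_interior_iff_mem_nhds.1 hy)]

theorem coordScal_eq_of_mem_interior {y : Euc n} (hy : y ∈ interior S)
    (G : Euc n → Euc n →L[ℝ] Euc n →L[ℝ] ℝ) : coordScal S G y = coordScal univ G y := by
  have h1 : ∀ z ∈ interior S, ∀ k i j, christoffel S G k i j z = christoffel univ G k i j z :=
    fun z hz k i j => by simp only [christoffel, pd_eq_of_mem_interior hz]
  have h2 : ∀ l k i j, pd S l (christoffel S G k i j) y = pd univ l (christoffel univ G k i j) y :=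
    fun l k i j => by
      rw [pd_eq_of_mem_interior hy]
      exact pd_congr (mem_of_superset (isOpen_interior.mem_nhds hy) fun z hz => h1 z hz k i j)
  simp only [AHJang.coordScal, coordRicci, h1 y hy, h2]

variable {H : Type*} [TopologicalSpace H] {I : ModelWithCorners ℝ (Euc n) H}
  {M : Type*} [TopologicalSpace M] [ChartedSpace H M]

/-- Relative openness in the target of the chart transfers unique differentiability, and leaves
derivatives within the piece equal to those within the target. -/
theorem exists_isOpen_chartPiece {U : Set M} (hU : IsOpen U) (p : M) (r : ℝ) :
    ∃ O, IsOpen O ∧ chartPiece I U p r = (extChartAt I p).target ∩ O := by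
  obtain ⟨u, hu, hu'⟩ := (continuousOn_iff'.1 (continuousOn_extChartAt_symm (I := I) p)) U hU
  refine ⟨u ∩ Metric.ball (extChartAt I p p) r, hu.inter Metric.isOpen_ball, ?_⟩
  rw [chartPiece, inter_comm (extChartAt I p).target, hu', inter_assoc]
  ext y; simp only [mem_inter_iff]; tauto

theorem uniqueDiffOn_chartPiece {U : Set M} (hU : IsOpen U) (p : M) (r : ℝ) :
    UniqueDiffOn ℝ (chartPiece I U p r) := by
  obtain ⟨O, hO, h⟩ := exists_isOpen_chartPiece (I := I) hU p r
  rw [h]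
  exact (uniqueDiffOn_extChartAt_target p).inter hO

variable [IsManifold I ∞ M]

/-- In coordinates around a point, at interior points, the scalar curvature is given by the
coordinate formula. -/
theorem IsParam.scal_eq {e : PartialEquiv M (Euc n)} (he : IsParam I e) {T : Tensor2 I M}
    {U : Set M} (hU : IsOpen U) (hs : IsSymmOn I U T) (hp : IsPosDefOn I U T) {y : Euc n}
    (hy : y ∈ interior e.target) (hyU : e.symm y ∈ U)
    (hT : ContDiffAt ℝ 2 (pullTensor I e.symm e.target T) y) :
    scal I T (e.symm y) = coordScal univ (pullTensor I e.symm e.target T) y := by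
  set q := e.symm y with hq
  have hyt := interior_subset hy
  have hqs : q ∈ e.source := e.map_target hyt
  have hc := isParam_extChartAt (I := I) q
  have hqc : q ∈ (extChartAt I q).source := mem_extChartAt_source q
  have h1 : extChartAt I q q ∈ interior (extChartAt I q).target := he.mem_interior hc hy hqc
  have h2 : (extChartAt I q).symm (extChartAt I q q) = q := (extChartAt I q).left_inv hqc
  have h3 : e q = y := e.right_inv hyt
  have h4 := hc.coordScal_eq he T hU hs h1 (by rw [h2]; exact hqs) (by rw [h2]; exact hyU)
    (by rw [h2, h3]; exact hT) (by rw [h2, h3]; exact he.det_ne_zero hyt (hp _ hyU))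
  rw [h2, h3] at h4
  rw [scal, coordScal_eq_of_mem_interior h1]
  exact h4

variable [MeasurableSpace M] [BorelSpace M]

/-- The scalar curvature is integrable over the part of `U` near a point at which the metric is
regular. -/
theorem integrableOn_scal_chart {T : Tensor2 I M} {U : Set M} (hU : IsOpen U)
    (hs : IsSymmOn I U T) (hp : IsPosDefOn I U T) {p : M} {r : ℝ}
    (hG : BddHolder 2 α (chartPiece I U p r) (chartTensor I T p)) (hc : 0 < c)
    (hdet : ∀ y ∈ chartPiece I U p r, c ≤ |(comp (chartTensor I T p) y).det|) (d : ℝ) :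
    IntegrableOn (fun q => scal I T q + d)
      ((extChartAt I p).source ∩ extChartAt I p ⁻¹' chartPiece I U p r) (riemVol I T) := by
  set e := extChartAt I p with he
  have hep : IsParam I e := isParam_extChartAt p
  set S := chartPiece I U p r with hSdef
  obtain ⟨O, hO, hSO⟩ := exists_isOpen_chartPiece (I := I) hU p r
  have hS : UniqueDiffOn ℝ S := uniqueDiffOn_chartPiece hU p r
  have hSi : interior S = interior e.target ∩ O := by
    rw [hSdef, hSO, interior_inter, hO.interior_eq]
  have hcont : ContinuousOn e e.source := hep.smooth.continuousOn
  set N := e.source ∩ e ⁻¹' S with hN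
  -- `scal` at `q` uses the chart at `q`. Coordinate invariance, available at interior points,
  -- identifies it on `N'` with the formula in the fixed chart at `p`; the difference `N \ N'` is a
  -- null set.
  set N' := e.source ∩ e ⁻¹' interior S with hN'
  have hNO : N = e.source ∩ e ⁻¹' O := by
    ext q
    simp only [hN, mem_inter_iff, mem_preimage, hSdef, hSO]
    exact ⟨fun h => ⟨h.1, h.2.2⟩, fun h => ⟨h.1, e.map_source h.1, h.2⟩⟩
  have hNm : MeasurableSet N := by
    rw [hNO]; exact (hcont.isOpen_inter_preimage hep.isOpen_source hO).measurableSet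
  have hN'o : IsOpen N' := hcont.isOpen_inter_preimage hep.isOpen_source isOpen_interior
  have hN'N : N' ⊆ N := fun q hq => ⟨hq.1, interior_subset (s := S) hq.2⟩
  have hb := hG.coordScal hS hc hdet
  obtain ⟨B, hB⟩ := hb.exists_bound
  have hscal : ∀ q ∈ N', scal I T q = coordScal S (chartTensor I T p) (e q) := by
    intro q hq
    have hqi : e q ∈ interior e.target := (hSi ▸ hq.2 : e q ∈ interior e.target ∩ O).1
    have hqS : e q ∈ S := interior_subset hq.2
    have h1 := hep.scal_eq hU hs hp hqi hqS.1.2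
      ((hG.contDiffOn _ hqS).contDiffAt (mem_interior_iff_mem_nhds.1 hq.2))
    rw [e.left_inv hq.1] at h1
    rw [h1, coordScal_eq_of_mem_interior hq.2]
    rfl
  have hnull : riemVol I T (N \ N') = 0 := by
    have hm := hNm.diff hN'o.measurableSet
    refine le_antisymm ((hep.riemVol_apply_le T hm fun q hq => hq.1.1).trans ?_) zero_le
    rw [hep.chartVol_apply T hm]
    refine (setLIntegral_measure_zero _ _ (measure_mono_null (fun y hy => ?_) hep.null_boundary)).le
    refine ⟨hy.1, fun hyi => hy.2.2 ⟨hy.2.1.1, ?_⟩⟩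
    have h1 : e (e.symm y) = y := e.right_inv hy.1
    have h2 := hy.2.1.2
    rw [mem_preimage, h1] at h2 ⊢
    rw [hSi]
    rw [hSdef, hSO] at h2
    exact ⟨hyi, h2.2⟩
  have hfin : riemVol I T N ≠ ⊤ := by
    refine ((hep.riemVol_apply_le T hNm fun q hq => hq.1).trans_lt ?_).ne
    rw [hep.chartVol_apply T hNm]
    obtain ⟨D, hD⟩ := (BddHolder.det hS (hG.comp_apply hS)).exists_bound
    have hsub : e.target ∩ e.symm ⁻¹' N ⊆ S := fun y hy => by
      have h2 := hy.2.2
      rwa [mem_preimage, e.right_inv hy.1] at h2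
    refine setLIntegral_lt_top_of_le_nnreal
      (((measure_mono (hsub.trans fun y hy => hy.2)).trans_lt measure_ball_lt_top).ne)
      ⟨Real.toNNReal (Real.sqrt D), fun y hy => ?_⟩
    exact ENNReal.ofReal_le_ofReal (Real.sqrt_le_sqrt ((le_abs_self _).trans (hD y (hsub hy))))
  have hae : N =ᵐ[riemVol I T] N' :=
    ae_eq_set.2 ⟨hnull, by rw [sdiff_eq_empty.2 hN'N, measure_empty]⟩
  rw [integrableOn_congr_set_ae hae]
  have : IsFiniteMeasure ((riemVol I T).restrict N') :=
    ⟨by rw [Measure.restrict_apply_univ]; exact (measure_mono hN'N).trans_lt hfin.lt_top⟩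
  refine Integrable.of_bound ?_ (B + |d|) ?_
  · refine ContinuousOn.aestronglyMeasurable ?_ hN'o.measurableSet
    have h1 : ContinuousOn (fun q => coordScal S (chartTensor I T p) (e q)) N' :=
      hb.contDiffOn.continuousOn.comp (hcont.mono inter_subset_left)
        fun q hq => interior_subset hq.2
    exact (h1.congr hscal).add continuousOn_const
  · filter_upwards [ae_restrict_mem hN'o.measurableSet] with q hq
    rw [hscal q hq]
    exact (norm_add_le _ _).trans (add_le_add (hB _ (interior_subset hq.2)) le_rfl)

end LocalIntegrability

/-! ### The end of an asymptotically hyperbolic manifold -/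

section End

variable {n : ℕ} {H : Type*} [TopologicalSpace H] {I : ModelWithCorners ℝ (Euc n) H}
  {M : Type*} [TopologicalSpace M] [ChartedSpace H M]

/-- The end of `M` outside the ball of radius `R`. -/
def ChartAtInfinity.endSet (Φ : ChartAtInfinity I M) (R : ℝ) : Set M :=
  {p | p ∈ Φ.Psi.source ∧ R < hypDist 0 (Φ.Psi p)}

theorem ChartAtInfinity.endSet_eq (Φ : ChartAtInfinity I M) (R : ℝ) :
    Φ.endSet R = Φ.Psi.source ∩ Φ.Psi ⁻¹' hypExterior n R := by
  ext p
  refine ⟨fun h => ⟨h.1, ?_, h.2⟩, fun h => ⟨h.1, h.2.2⟩⟩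
  have := Φ.Psi.map_source h.1
  rw [Φ.target_eq] at this
  exact this.1

theorem ChartAtInfinity.isOpen_endSet (Φ : ChartAtInfinity I M) (R : ℝ) : IsOpen (Φ.endSet R) := by
  rw [Φ.endSet_eq]
  exact Φ.Psi.isOpen_inter_preimage (isOpen_hypExterior R)

theorem ChartAtInfinity.target_inter_preimage_endSet (Φ : ChartAtInfinity I M) {R : ℝ} (hR : Φ.R₀ ≤ R) :
    Φ.Psi.target ∩ Φ.Psi.symm ⁻¹' Φ.endSet R = hypExterior n R := by
  ext x
  constructor
  · rintro ⟨h1, h2⟩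
    rw [Φ.endSet_eq] at h2
    have := h2.2
    rwa [mem_preimage, Φ.Psi.right_inv h1] at this
  · intro hx
    have h1 : x ∈ Φ.Psi.target := by rw [Φ.target_eq]; exact hypExterior_anti hR hx
    refine ⟨h1, ?_⟩
    rw [mem_preimage, Φ.endSet_eq]
    refine ⟨Φ.Psi.map_target h1, ?_⟩
    rwa [mem_preimage, Φ.Psi.right_inv h1]

theorem ChartAtInfinity.eventually_target (Φ : ChartAtInfinity I M) :
    ∀ᶠ x in far n, x ∈ Φ.Psi.target := by
  rw [Φ.target_eq]; exact eventually_far_mem _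

theorem contDiffAt_hypMetric {k : ℕ∞} {x : Euc n} (hx : ‖x‖ < 1) : ContDiffAt ℝ k (hypMetric n) x := by
  have h : ContDiffAt ℝ k (fun y : Euc n => (rho y ^ 2)⁻¹) x := by
    have := (contDiffAt_inv_rho (k := k) hx).pow 2
    simpa only [inv_pow] using this
  exact contDiffAt_smul_const h (euclideanForm n)

variable {Φ : ChartAtInfinity I M} {T : Tensor2 I M} {U : Set M} {α τ : ℝ}

theorem AsyHyp.of_asy (hα₀ : 0 ≤ α) (hα₁ : α ≤ 1) (hτ : 0 < τ) (hU : Φ.Psi.source ⊆ U)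
    (hs : IsSymmOn I U T) (h : Asy α 2 (τ - 2) (fun x => Φ.push T x - hypMetric n x)) :
    AsyHyp α τ (Φ.push T) where
  alpha_nonneg := hα₀
  alpha_le := hα₁
  tau_pos := hτ
  symm := by
    filter_upwards [Φ.eventually_target] with x hx i j
    exact hs _ (hU (Φ.Psi.map_target hx)) _ _
  dev i j := by
    have h1 := h.clm_comp
      (ContinuousLinearMap.apply ℝ (Euc n →L[ℝ] ℝ) (EuclideanSpace.single i (1 : ℝ)))
    exact h1.clm_comp (ContinuousLinearMap.apply ℝ ℝ (EuclideanSpace.single j (1 : ℝ)))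

theorem ChartAtInfinity.eventually_contDiffAt_push
    (h : Asy α 2 (τ - 2) (fun x => Φ.push T x - hypMetric n x)) :
    ∀ᶠ x in far n, ContDiffAt ℝ 2 (Φ.push T) x := by
  filter_upwards [h.eventually_contDiffAt, eventually_far_norm_lt] with x h1 h2
  have h3 := ContDiffAt.add (F := Euc n →L[ℝ] Euc n →L[ℝ] ℝ) h1
    (contDiffAt_hypMetric (k := 2) h2)
  refine h3.congr_of_eventuallyEq (Eventually.of_forall fun y => ?_)
  exact (sub_add_cancel (Φ.push T y) (hypMetric n y)).symm

theorem AsyHyp.asy_coordScal {G : Euc n → Euc n →L[ℝ] Euc n →L[ℝ] ℝ} (hG : AsyHyp α τ G) :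
    Asy α 0 τ (fun x => coordScal univ G x + n * (n - 1)) := by
  have h1 := (hG.asy_scal.mono (s' := τ) (by linarith [hG.tau_pos])).add
    (asy_linScal hG.alpha_nonneg hG.alpha_le hG.dev)
  exact h1.congr (Eventually.of_forall fun x => by ring)

variable [IsManifold I ∞ M]

/-- On the end, the scalar curvature is given by the coordinate formula in the ball model. -/
theorem ChartAtInfinity.eventually_scal_eq (hUo : IsOpen U) (hU : Φ.Psi.source ⊆ U)
    (hs : IsSymmOn I U T) (hp : IsPosDefOn I U T)
    (h : Asy α 2 (τ - 2) (fun x => Φ.push T x - hypMetric n x)) :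
    ∀ᶠ x in far n, scal I T (Φ.Psi.symm x) = coordScal univ (Φ.push T) x := by
  filter_upwards [Φ.eventually_target, Φ.eventually_contDiffAt_push h] with x hx hc
  refine Φ.isParam.scal_eq hUo hs hp (y := x) ?_ (hU (Φ.Psi.map_target hx)) hc
  rwa [Φ.Psi.open_target.interior_eq]

end End

/-! ### Integrals over the end -/

section EndIntegrability

variable {n : ℕ} {H : Type*} [TopologicalSpace H] {I : ModelWithCorners ℝ (Euc n) H}
  {M : Type*} [TopologicalSpace M] [ChartedSpace H M] [IsManifold I ∞ M]
  [SecondCountableTopology M] [MeasurableSpace M] [BorelSpace M]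

/-- Over `A` the Riemannian measure is the pushforward under `e.symm` of Lebesgue measure with
density `√det`. -/
theorem IsParam.integrableOn_riemVol_iff {e : PartialEquiv M (Euc n)} (he : IsParam I e)
    (T : Tensor2 I M) {A : Set M} (hA : MeasurableSet A) (h : A ⊆ e.source)
    (hd : AEMeasurable (fun y => Real.sqrt (comp (pullTensor I e.symm e.target T) y).det)
      (volume.restrict (e.target ∩ e.symm ⁻¹' A)))
    {F : M → ℝ} (hF : AEStronglyMeasurable F ((riemVol I T).restrict A)) :
    IntegrableOn F A (riemVol I T) ↔ IntegrableOn (fun y =>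
      Real.sqrt (comp (pullTensor I e.symm e.target T) y).det * F (e.symm y))
      (e.target ∩ e.symm ⁻¹' A) := by
  set D := e.target ∩ e.symm ⁻¹' A with hD
  have hDm : MeasurableSet D := he.measurableSet_preimage hA
  set w : Euc n → ℝ := fun y => Real.sqrt (comp (pullTensor I e.symm e.target T) y).det with hw
  set ν : Measure (Euc n) := (volume.restrict D).withDensity fun y => ENNReal.ofReal (w y) with hν
  have hae : AEMeasurable e.symm ν :=
    (he.aemeasurable_symm.mono_measure (Measure.restrict_mono inter_subset_left le_rfl)).mono_ac
      (withDensity_absolutelyContinuous _ _)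
  have hνD : ν Dᶜ = 0 := withDensity_absolutelyContinuous (volume.restrict D) _
    (by rw [Measure.restrict_apply hDm.compl]; simp)
  have hmap : (riemVol I T).restrict A = Measure.map e.symm ν := by
    rw [he.riemVol_restrict T hA h]
    ext B hB
    rw [Measure.restrict_apply hB, he.chartVol_apply T (hB.inter hA),
      Measure.map_apply_of_aemeasurable hae hB,
      ← measure_inter_add_sdiff₀ (e.symm ⁻¹' B) hDm.nullMeasurableSet,
      measure_mono_null (s := e.symm ⁻¹' B \ D) (fun y hy => hy.2) hνD, add_zero]
    have hs : e.symm ⁻¹' B ∩ D = e.target ∩ e.symm ⁻¹' (B ∩ A) := by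
      ext y; simp only [hD, mem_inter_iff, mem_preimage]; tauto
    have hm := he.measurableSet_preimage (hB.inter hA)
    rw [hs, hν, withDensity_apply _ hm, Measure.restrict_restrict hm,
      inter_eq_left.2 (show e.target ∩ e.symm ⁻¹' (B ∩ A) ⊆ D from fun y hy => ⟨hy.1, hy.2.2⟩)]
  rw [IntegrableOn, hmap]
  rw [hmap] at hF
  rw [integrable_map_measure hF hae, hν,
    integrable_withDensity_iff_integrable_smul₀' hd.ennreal_ofReal
      (Eventually.of_forall fun _ => ENNReal.ofReal_lt_top), IntegrableOn]
  refine integrable_congr (Eventually.of_forall fun y => ?_)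
  simp only [Function.comp_apply, smul_eq_mul]
  rw [ENNReal.toReal_ofReal (Real.sqrt_nonneg _)]

variable {Φ : ChartAtInfinity I M} {T : Tensor2 I M} {U : Set M} {α τ : ℝ}

/-- Integrability of the scalar curvature over the end, in terms of the ball model. -/
theorem ChartAtInfinity.exists_integrableOn_end_iff (hUo : IsOpen U) (hU : Φ.Psi.source ⊆ U)
    (hα₀ : 0 ≤ α) (hα₁ : α ≤ 1) (hτ : 0 < τ)
    (hs : IsSymmOn I U T) (hp : IsPosDefOn I U T)
    (h : Asy α 2 (τ - 2) (fun x => Φ.push T x - hypMetric n x)) :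
    ∃ R₁, ∀ R, R₁ ≤ R → (IntegrableOn (Φ.scalDefect T) (Φ.endSet R) (riemVol I T) ↔
      IntegrableOn (fun x => (rho x)⁻¹ ^ (n + 1) * (coordScal univ (Φ.push T) x + n * (n - 1)))
        (hypExterior n R)) := by
  have hG := AsyHyp.of_asy hα₀ hα₁ hτ hU hs h
  have hev : ∀ᶠ x in far n, scal I T (Φ.Psi.symm x) = coordScal univ (Φ.push T) x ∧
      ContDiffAt ℝ 2 (Φ.push T) x ∧
      ContinuousAt (fun x => coordScal univ (Φ.push T) x + n * (n - 1)) x ∧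
      1 / 4 ≤ (rho x ^ 2 • comp (Φ.push T) x).det ∧ (rho x ^ 2 • comp (Φ.push T) x).det ≤ 4 := by
    filter_upwards [Φ.eventually_scal_eq hUo hU hs hp h, Φ.eventually_contDiffAt_push h,
      hG.asy_coordScal.eventually_contDiffAt, hG.eventually_det] with x h1 h2 h3 h4
    exact ⟨h1, h2, h3.continuousAt, h4⟩
  obtain ⟨R₂, -, hR₂⟩ := eventually_far_iff.1 hev
  refine ⟨max Φ.R₀ R₂, fun R hR => ?_⟩
  have hR0 : Φ.R₀ ≤ R := (le_max_left _ _).trans hR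
  have hx : ∀ x ∈ hypExterior n R, _ := fun x hx =>
    hR₂ x (hypExterior_anti ((le_max_right _ _).trans hR) hx)
  have hDm := (isOpen_hypExterior (n := n) R).measurableSet
  have htgt := Φ.target_inter_preimage_endSet hR0
  have hAm := (Φ.isOpen_endSet R).measurableSet
  have hAs : Φ.endSet R ⊆ Φ.Psi.source := fun p hp => hp.1
  have hdc : ContinuousOn (fun x => (comp (Φ.push T) x).det) (hypExterior n R) := fun x hx' =>
    (contDiffAt_det (contDiffAt_comp (hx x hx').2.1)).continuousAt.continuousWithinAt
  have hrc : ContinuousOn (fun x : Euc n => (rho x)⁻¹) (hypExterior n R) :=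
    rho_continuous.continuousOn.inv₀ fun x hx => (rho_pos hx.1).ne'
  have hHc : ContinuousOn (fun x => coordScal univ (Φ.push T) x + n * (n - 1)) (hypExterior n R) :=
    fun x hx' => (hx x hx').2.2.1.continuousWithinAt
  have hFe : ∀ x ∈ hypExterior n R, Φ.scalDefect T (Φ.Psi.symm x)
      = (coordScal univ (Φ.push T) x + n * (n - 1)) * (rho x)⁻¹ := by
    intro x hx'
    have ht : x ∈ Φ.Psi.target := by rw [Φ.target_eq]; exact hypExterior_anti hR0 hx'
    rw [ChartAtInfinity.scalDefect, ChartAtInfinity.weight, if_pos (Φ.Psi.map_target ht),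
      Φ.Psi.right_inv ht, (hx x hx').1, div_eq_mul_inv]
  have hFm : AEStronglyMeasurable (Φ.scalDefect T) ((riemVol I T).restrict (Φ.endSet R)) := by
    refine ContinuousOn.aestronglyMeasurable ?_ hAm
    have h1 : ContinuousOn (fun q => (coordScal univ (Φ.push T) (Φ.Psi q) + n * (n - 1))
        * (rho (Φ.Psi q))⁻¹) (Φ.endSet R) :=
      (hHc.mul hrc).comp (Φ.Psi.continuousOn.mono hAs) fun q hq => by
        rw [Φ.endSet_eq] at hq; exact hq.2
    refine h1.congr fun q hq => ?_
    have h2 := hFe (Φ.Psi q) (by rw [Φ.endSet_eq] at hq; exact hq.2)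
    rwa [Φ.Psi.left_inv hq.1] at h2
  have h1 := Φ.isParam.integrableOn_riemVol_iff T hAm hAs (F := Φ.scalDefect T)
    (by
      change AEMeasurable _ (volume.restrict (Φ.Psi.target ∩ Φ.Psi.symm ⁻¹' Φ.endSet R))
      rw [htgt]
      exact (hdc.sqrt).aemeasurable hDm) hFm
  rw [h1]
  change IntegrableOn _ (Φ.Psi.target ∩ Φ.Psi.symm ⁻¹' Φ.endSet R) ↔ _
  rw [htgt]
  -- `w = ρ^n √det G` is bounded above and below, so the volume density is comparable to `ρ^{-n}`.
  -- With the `ρ⁻¹` of `scalDefect` this produces the weight `ρ^{-(n+1)}`.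
  set w : Euc n → ℝ := fun x => Real.sqrt ((rho x ^ 2 • comp (Φ.push T) x).det) with hw
  have hwc : ContinuousOn w (hypExterior n R) := by
    refine ContinuousOn.sqrt ?_
    simp only [Matrix.det_smul]
    exact ((rho_continuous.pow 2).pow _).continuousOn.mul hdc
  have hw1 : ∀ x ∈ hypExterior n R, 1 / 2 ≤ w x ∧ w x ≤ 2 := fun x hx' => by
    have := (hx x hx').2.2.2
    constructor
    · exact Real.le_sqrt_of_sq_le (le_trans (by norm_num) this.1)
    · exact Real.sqrt_le_iff.2 ⟨by norm_num, this.2.trans (by norm_num)⟩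
  have key : ∀ x ∈ hypExterior n R,
      Real.sqrt (comp (Φ.push T) x).det * Φ.scalDefect T (Φ.Psi.symm x)
      = w x * ((rho x)⁻¹ ^ (n + 1) * (coordScal univ (Φ.push T) x + n * (n - 1))) := by
    intro x hx'
    have hρ := rho_pos hx'.1
    have h2 : w x = rho x ^ n * Real.sqrt (comp (Φ.push T) x).det := by
      simp only [hw]
      rw [Matrix.det_smul, Fintype.card_fin, ← pow_mul, mul_comm 2 n, pow_mul,
        Real.sqrt_mul (sq_nonneg _), Real.sqrt_sq (by positivity)]
    rw [hFe x hx', h2, pow_succ, inv_pow]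
    field_simp
  refine ⟨fun hi => ?_, fun hi => ?_⟩
  · have h2 : IntegrableOn (fun x => (w x)⁻¹ * (Real.sqrt (comp (Φ.push T) x).det *
        Φ.scalDefect T (Φ.Psi.symm x))) (hypExterior n R) := by
      refine hi.bdd_mul (c := 2) ((hwc.inv₀ fun x hx' => by
        linarith [(hw1 x hx').1]).aestronglyMeasurable hDm) ?_
      filter_upwards [ae_restrict_mem hDm] with x hx'
      have := (hw1 x hx').1
      rw [norm_inv, Real.norm_eq_abs, abs_of_pos (by linarith)]
      exact inv_le_of_inv_le₀ (by norm_num) (by linarith)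
    refine h2.congr_fun (fun x hx' => ?_) hDm
    simp only
    rw [key x hx', inv_mul_cancel_left₀ (by linarith [(hw1 x hx').1])]
  · have h2 : IntegrableOn (fun x => w x * ((rho x)⁻¹ ^ (n + 1) *
        (coordScal univ (Φ.push T) x + n * (n - 1)))) (hypExterior n R) := hi.bdd_mul (c := 2) (hwc.aestronglyMeasurable hDm) (by
      filter_upwards [ae_restrict_mem hDm] with x hx'
      rw [Real.norm_eq_abs, abs_of_nonneg (Real.sqrt_nonneg _)]
      exact (hw1 x hx').2)
    exact h2.congr_fun (fun x hx' => (key x hx').symm) hDm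

end EndIntegrability

/-! ### The metric of a graph -/

section RankOne

variable {n : ℕ}

theorem euc_eq_zero_of_ofLp {v : Fin n → ℝ} (h : (WithLp.toLp 2 v : Euc n) = 0) : v = 0 := by
  ext i; exact congrArg (fun x : Euc n => x i) h

/-- The matrix of an inner product is positive definite. -/
theorem posDef_of_form {B : Euc n →L[ℝ] Euc n →L[ℝ] ℝ} (hs : ∀ v w, B v w = B w v)
    (hp : ∀ v, v ≠ 0 → 0 < B v v) :
    (Matrix.of fun i j => B (EuclideanSpace.single i 1) (EuclideanSpace.single j 1) :
      Matrix (Fin n) (Fin n) ℝ).PosDef := by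
  refine Matrix.PosDef.of_dotProduct_mulVec_pos ?_ fun v hv => ?_
  · ext i j; simp [Matrix.conjTranspose_apply, hs]
  · have h1 := hp (WithLp.toLp 2 v) fun h => hv (euc_eq_zero_of_ofLp h)
    refine h1.trans_eq ?_
    rw [isLinearMap_eq_sum (f := fun Y => B (WithLp.toLp 2 v) Y) ⟨map_add _, map_smul _⟩]
    simp only [form_apply_single B (WithLp.toLp 2 v), dotProduct, Matrix.mulVec, Matrix.of_apply,
      Finset.mul_sum, star_trivial, smul_eq_mul]
    rw [Finset.sum_comm]
    refine Finset.sum_congr rfl fun i _ => Finset.sum_congr rfl fun j _ => ?_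
    ring

/-- Adding a nonnegative form of rank one does not decrease the determinant. -/
theorem det_le_det_add_smulRight {B : Euc n →L[ℝ] Euc n →L[ℝ] ℝ} (hs : ∀ v w, B v w = B w v)
    (hp : ∀ v, v ≠ 0 → 0 < B v v) {a : ℝ} (ha : 0 ≤ a) (l : Euc n →L[ℝ] ℝ) :
    0 < (Matrix.of fun i j => B (EuclideanSpace.single i 1) (EuclideanSpace.single j 1) :
      Matrix (Fin n) (Fin n) ℝ).det ∧
    (Matrix.of fun i j => B (EuclideanSpace.single i 1) (EuclideanSpace.single j 1) :
      Matrix (Fin n) (Fin n) ℝ).det ≤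
    (Matrix.of fun i j => (B + a • l.smulRight l) (EuclideanSpace.single i 1)
      (EuclideanSpace.single j 1) : Matrix (Fin n) (Fin n) ℝ).det := by
  have hA := posDef_of_form hs hp
  set A : Matrix (Fin n) (Fin n) ℝ :=
    Matrix.of fun i j => B (EuclideanSpace.single i 1) (EuclideanSpace.single j 1) with hAdef
  set v : Fin n → ℝ := fun i => l (EuclideanSpace.single i 1) with hv
  have h1 : (Matrix.of fun i j => (B + a • l.smulRight l) (EuclideanSpace.single i 1)
      (EuclideanSpace.single j 1) : Matrix (Fin n) (Fin n) ℝ)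
      = A + Matrix.replicateCol Unit (a • v) * Matrix.replicateRow Unit v := by
    ext i j
    simp [hAdef, Matrix.mul_apply, hv]
  -- Matrix determinant lemma: `det(A + a v vᵀ) = det A (1 + a vᵀ A⁻¹ v)`, and `A⁻¹` is positive.
  have h2 : (1 + Matrix.replicateRow Unit v * A⁻¹ * Matrix.replicateCol Unit (a • v)).det
      = 1 + a * dotProduct v (A⁻¹.mulVec v) := by
    rw [Matrix.det_unique]
    simp [Matrix.mul_assoc, Matrix.mul_apply, dotProduct, Matrix.mulVec, Finset.mul_sum]
  have hpos := hA.det_pos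
  refine ⟨hpos, ?_⟩
  rw [h1, Matrix.det_add_replicateCol_mul_replicateRow hpos.ne'.isUnit, h2]
  have h3 : 0 ≤ dotProduct v (A⁻¹.mulVec v) := by
    simpa using hA.inv.posSemidef.dotProduct_mulVec_nonneg v
  exact le_mul_of_one_le_right hpos.le (by linarith [mul_nonneg ha h3])

end RankOne

/-! ### The metric `g + u² df²` in coordinates and its local regularity. -/

section Graph

variable {n : ℕ} {H : Type*} [TopologicalSpace H] {I : ModelWithCorners ℝ (Euc n) H}
  {M : Type*} [TopologicalSpace M] [ChartedSpace H M]
  {g : Tensor2 I M} {u f : M → ℝ} {U : Set M} {α τ : ℝ}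

theorem graphMetric_apply (p : M) (v w : TangentSpace I p) :
    graphMetric I g u f p v w = g p v w + u p ^ 2 * (diff I f p v * diff I f p w) := rfl

theorem isSymmOn_graphMetric (hg : IsSymmOn I U g) : IsSymmOn I U (graphMetric I g u f) := by
  intro p hp v w
  rw [graphMetric_apply, graphMetric_apply, hg p hp v w, mul_comm (diff I f p v)]

theorem isPosDefOn_graphMetric (hg : IsPosDefOn I U g) : IsPosDefOn I U (graphMetric I g u f) := by
  intro p hp v hv
  rw [graphMetric_apply]
  have := mul_nonneg (sq_nonneg (u p)) (mul_self_nonneg (diff I f p v))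
  linarith [hg p hp v hv]

theorem chartPiece_mono {V : Set M} (h : U ⊆ V) (p : M) {r s : ℝ} (hr : r ≤ s) :
    chartPiece I U p r ⊆ chartPiece I V p s :=
  fun _ hy => ⟨⟨hy.1.1, h hy.1.2⟩, Metric.ball_subset_ball hr hy.2⟩

theorem IsParam.pullTensor_graphMetric {e : PartialEquiv M (Euc n)} (he : IsParam I e) {y : Euc n}
    (hy : y ∈ e.target) (hf : MDifferentiableAt I 𝓘(ℝ, ℝ) f (e.symm y)) :
    pullTensor I e.symm e.target (graphMetric I g u f) y = pullTensor I e.symm e.target g y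
      + (u (e.symm y)) ^ 2 • (fderivWithin ℝ (f ∘ e.symm) e.target y).smulRight
        (fderivWithin ℝ (f ∘ e.symm) e.target y) := by
  have h1 := (hf.hasMFDerivAt.comp_hasMFDerivWithinAt y (he.hasMFDerivWithinAt_symm hy)).mfderivWithin
    (he.uniqueDiffOn.uniqueMDiffOn y hy)
  rw [mfderivWithin_eq_fderivWithin] at h1
  have h2 : ∀ v : Euc n, fderivWithin ℝ (f ∘ e.symm) e.target y v
      = diff I f (e.symm y) (mfderivWithin 𝓘(ℝ, Euc n) I e.symm e.target y v) := fun v => by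
    have h3 := DFunLike.congr_fun h1 v
    exact h3
  ext v w
  change graphMetric I g u f (e.symm y) _ _ = pullTensor I e.symm e.target g y v w
    + (u (e.symm y)) ^ 2 * (fderivWithin ℝ (f ∘ e.symm) e.target y v *
      fderivWithin ℝ (f ∘ e.symm) e.target y w)
  rw [h2, h2]
  rfl

variable [IsManifold I ∞ M]

theorem LocHolderFun.mdifferentiableAt {k : ℕ} (hk : 1 ≤ k) (hU : IsOpen U)
    (hf : LocHolderFun I k α U U f) {p : M} (hp : p ∈ U) : MDifferentiableAt I 𝓘(ℝ, ℝ) f p := by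
  obtain ⟨r, hr, C, hC⟩ := hf p hp
  obtain ⟨O, hO, hSO⟩ := exists_isOpen_chartPiece (I := I) hU p r
  have hep : IsParam I (extChartAt I p) := isParam_extChartAt p
  set e := extChartAt I p with he
  have hps : p ∈ e.source := mem_extChartAt_source p
  have hpS : e p ∈ chartPiece I U p r :=
    ⟨⟨mem_extChartAt_target p, by rw [mem_preimage, ← he, e.left_inv hps]; exact hp⟩,
      Metric.mem_ball_self hr⟩
  have hpO : e p ∈ O := (hSO ▸ hpS : e p ∈ e.target ∩ O).2
  have h1 : ContMDiffOn 𝓘(ℝ, Euc n) 𝓘(ℝ, ℝ) 1 (f ∘ e.symm) (chartPiece I U p r) :=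
    (hC.1.of_le (by exact_mod_cast hk)).contMDiffOn
  have h2 : ContMDiffOn I 𝓘(ℝ, ℝ) 1 ((f ∘ e.symm) ∘ e) (e.source ∩ e ⁻¹' O) :=
    h1.comp ((hep.smooth.of_le (by simp)).mono inter_subset_left) fun q hq => by
      rw [mem_preimage, hSO]; exact ⟨e.map_source hq.1, hq.2⟩
  have hN : e.source ∩ e ⁻¹' O ∈ 𝓝 p :=
    (hep.smooth.continuousOn.isOpen_inter_preimage hep.isOpen_source hO).mem_nhds ⟨hps, hpO⟩
  have h3 := ((h2 p ⟨hps, hpO⟩).contMDiffAt hN).mdifferentiableAt (by simp)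
  refine h3.congr_of_eventuallyEq ?_
  filter_upwards [hN] with q hq
  simp only [Function.comp_apply]
  rw [e.left_inv hq.1]

/-- Regularity and nondegeneracy of the metric of a graph near points at which the function is
regular. -/
theorem exists_bddHolder_graphMetric (hU : IsOpen U) (hs : IsSymmOn I univ g)
    (hp : IsPosDefOn I univ g) (hg : LocHolderTensor I 2 α univ univ g)
    (hu : LocHolderFun I 2 α univ univ u) (hf : LocHolderFun I 3 α U U f) {p : M} {r C : ℝ}
    (hr : 0 < r) (hfp : HolderNormLE 3 α (chartPiece I U p r) (f ∘ (extChartAt I p).symm) C) :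
    ∃ s > 0, BddHolder 2 α (chartPiece I U p s) (chartTensor I (graphMetric I g u f) p) ∧
      ∃ c > 0, ∀ y ∈ chartPiece I U p s, c ≤ |(comp (chartTensor I (graphMetric I g u f) p) y).det| := by
  obtain ⟨r₁, hr₁, C₁, hC₁⟩ := hg p (mem_univ p)
  obtain ⟨r₂, hr₂, C₂, hC₂⟩ := hu p (mem_univ p)
  have hep : IsParam I (extChartAt I p) := isParam_extChartAt p
  set e := extChartAt I p with he
  have hps : p ∈ e.source := mem_extChartAt_source p
  set S₁ := chartPiece I univ p r₁ with hS₁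
  have hpS : e p ∈ S₁ :=
    ⟨⟨mem_extChartAt_target p, mem_univ _⟩, Metric.mem_ball_self hr₁⟩
  have hS₁u : UniqueDiffOn ℝ S₁ := uniqueDiffOn_chartPiece isOpen_univ p r₁
  have hS₂u : UniqueDiffOn ℝ (chartPiece I univ p r₂) := uniqueDiffOn_chartPiece isOpen_univ p r₂
  have hgB : BddHolder 2 α S₁ (chartTensor I g p) := ⟨C₁, hC₁⟩
  have hsym : ∀ y, ∀ v w, pullTensor I e.symm e.target g y v w
      = pullTensor I e.symm e.target g y w v := fun y v w => hs _ (mem_univ _) _ _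
  have hpos : ∀ y ∈ e.target, ∀ v, v ≠ 0 → 0 < pullTensor I e.symm e.target g y v v :=
    fun y hy v hv => hep.pullTensor_pos hy (hp _ (mem_univ _)) hv
  have hdpos : ∀ y ∈ e.target, 0 < (comp (chartTensor I g p) y).det := fun y hy =>
    (posDef_of_form (hsym y) (hpos y hy)).det_pos
  have hd0 := hdpos _ (mem_extChartAt_target p)
  have hdc : ContinuousOn (fun y => (comp (chartTensor I g p) y).det) S₁ :=
    (BddHolder.det hS₁u (hgB.comp_apply hS₁u)).contDiffOn.continuousOn
  -- The point `p` may lie on the boundary of `U`, where the graph metric is not controlled at `p`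
  -- itself. The lower bound is therefore taken from `det g`, continuous at `p`, and passed to the
  -- graph metric by `det_le_det_add_smulRight`.
  have hev := (hdc _ hpS).eventually (lt_mem_nhds (half_lt_self hd0))
  obtain ⟨δ, hδ, hδ'⟩ := Metric.mem_nhdsWithin_iff.1 hev
  set s := min (min r r₁) (min r₂ δ) with hsdef
  have hs0 : 0 < s := lt_min (lt_min hr hr₁) (lt_min hr₂ hδ)
  set S := chartPiece I U p s with hS
  obtain ⟨O, hO, hSO⟩ := exists_isOpen_chartPiece (I := I) hU p s
  have hSu : UniqueDiffOn ℝ S := uniqueDiffOn_chartPiece hU p s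
  have hsub : S ⊆ chartPiece I U p r :=
    chartPiece_mono Subset.rfl p ((min_le_left _ _).trans (min_le_left _ _))
  have hsub₁ : S ⊆ S₁ := chartPiece_mono (subset_univ _) p ((min_le_left _ _).trans (min_le_right _ _))
  have hsub₂ : S ⊆ chartPiece I univ p r₂ :=
    chartPiece_mono (subset_univ _) p ((min_le_right _ _).trans (min_le_left _ _))
  have hfB : BddHolder 3 α S (f ∘ e.symm) :=
    BddHolder.mono_set ⟨C, hfp⟩ hsub hSu (uniqueDiffOn_chartPiece hU p r)
  have huB : BddHolder 2 α S (u ∘ e.symm) := BddHolder.mono_set ⟨C₂, hC₂⟩ hsub₂ hSu hS₂u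
  have hgS : BddHolder 2 α S (chartTensor I g p) := hgB.mono_set hsub₁ hSu hS₁u
  have heq : ∀ y ∈ S, chartTensor I (graphMetric I g u f) p y = chartTensor I g p y
      + (u (e.symm y)) ^ 2 • (fderivWithin ℝ (f ∘ e.symm) S y).smulRight
        (fderivWithin ℝ (f ∘ e.symm) S y) := fun y hy => by
    have hyO : O ∈ 𝓝 y := hO.mem_nhds (hSO ▸ hy : y ∈ e.target ∩ O).2
    have h1 : fderivWithin ℝ (f ∘ e.symm) S y = fderivWithin ℝ (f ∘ e.symm) e.target y := by
      rw [hS, hSO, ← he]; exact fderivWithin_inter hyO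
    rw [h1]
    exact hep.pullTensor_graphMetric hy.1.1 (hf.mdifferentiableAt (by norm_num) hU hy.1.2)
  refine ⟨s, hs0, ?_, _, half_pos hd0, fun y hy => ?_⟩
  · have h1 : BddHolder 2 α S (fderivWithin ℝ (f ∘ e.symm) S) := hfB.fderivWithin hSu
    have h2 : BddHolder 2 α S (fun y => (u (e.symm y)) ^ 2) :=
      (huB.mul huB hSu).congr fun y _ => by simp only [Function.comp_apply]; ring
    have h3 := BddHolder.bilin (W := Euc n →L[ℝ] Euc n →L[ℝ] ℝ) (ContinuousLinearMap.smulRightL ℝ (Euc n) (Euc n →L[ℝ] ℝ)) h1 h1 hSu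
    exact (hgS.add (h2.smul h3 hSu) hSu).congr fun y hy => heq y hy
  · have h1 := det_le_det_add_smulRight (hsym y) (hpos y hy.1.1) (sq_nonneg (u (e.symm y)))
      (fderivWithin ℝ (f ∘ e.symm) S y)
    have h2 : (comp (chartTensor I (graphMetric I g u f) p) y).det = (Matrix.of fun i j =>
        (pullTensor I e.symm e.target g y + (u (e.symm y)) ^ 2 •
          (fderivWithin ℝ (f ∘ e.symm) S y).smulRight (fderivWithin ℝ (f ∘ e.symm) S y))
        (EuclideanSpace.single i 1) (EuclideanSpace.single j 1) : Matrix (Fin n) (Fin n) ℝ).det := by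
      rw [comp, heq y hy]; rfl
    rw [h2]
    have h3 : (comp (chartTensor I g p) (e p)).det / 2 < (comp (chartTensor I g p) y).det :=
      hδ' ⟨Metric.ball_subset_ball ((min_le_right _ _).trans (min_le_right _ _)) hy.2, hsub₁ hy⟩
    exact h3.le.trans (h1.2.trans (le_abs_self _))

theorem locHolderTensor_graphMetric (hU : IsOpen U) (hs : IsSymmOn I univ g)
    (hp : IsPosDefOn I univ g) (hg : LocHolderTensor I 2 α univ univ g)
    (hu : LocHolderFun I 2 α univ univ u) (hf : LocHolderFun I 3 α U U f) {A : Set M}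
    (hA : LocHolderFun I 3 α U A f) : LocHolderTensor I 2 α U A (graphMetric I g u f) := by
  intro p hpA
  obtain ⟨r, hr, C, hC⟩ := hA p hpA
  obtain ⟨s, hs0, hB, -⟩ := exists_bddHolder_graphMetric hU hs hp hg hu hf hr hC
  exact ⟨s, hs0, hB⟩

end Graph

/-! ### Restriction of the chart at infinity -/

section Restriction

variable {n : ℕ} {H : Type*} [TopologicalSpace H] {I : ModelWithCorners ℝ (Euc n) H}
  {M : Type*} [TopologicalSpace M] [ChartedSpace H M]

/-- The restriction of a chart at infinity to a smaller end. -/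
def ChartAtInfinity.restrict (Φ : ChartAtInfinity I M) (R : ℝ) (hR : Φ.R₀ ≤ R) :
    ChartAtInfinity I M where
  Psi := Φ.Psi.restrOpen (Φ.endSet R) (Φ.isOpen_endSet R)
  R₀ := R
  R₀_pos := Φ.R₀_pos.trans_le hR
  target_eq := Φ.target_inter_preimage_endSet hR
  smooth := Φ.smooth.mono inter_subset_left
  smooth_symm := Φ.smooth_symm.mono inter_subset_left
  isCompact_core R' hR' := by
    have h : {p | p ∈ (Φ.Psi.restrOpen (Φ.endSet R) (Φ.isOpen_endSet R)).source ∧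
        R' < hypDist 0 (Φ.Psi.restrOpen (Φ.endSet R) (Φ.isOpen_endSet R) p)}
        = {p | p ∈ Φ.Psi.source ∧ R' < hypDist 0 (Φ.Psi p)} := by
      ext p
      exact ⟨fun hp => ⟨hp.1.1, hp.2⟩, fun hp => ⟨⟨hp.1, hp.1, hR'.trans_lt hp.2⟩, hp.2⟩⟩
    rw [h]
    exact Φ.isCompact_core R' (hR.trans hR')

variable {Φ : ChartAtInfinity I M} {R : ℝ} {hR : Φ.R₀ ≤ R}

theorem ChartAtInfinity.restrict_source : (Φ.restrict R hR).Psi.source = Φ.endSet R :=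
  inter_eq_right.2 fun _ hp => hp.1

theorem ChartAtInfinity.restrict_push (T : Tensor2 I M) {x : Euc n} (hx : x ∈ hypExterior n R) :
    (Φ.restrict R hR).push T x = Φ.push T x := by
  have h1 : x ∈ (Φ.restrict R hR).Psi.target := by
    rw [(Φ.restrict R hR).target_eq]; exact hx
  have h2 : x ∈ Φ.Psi.target := by rw [Φ.target_eq]; exact hypExterior_anti hR hx
  have h3 : mfderivWithin 𝓘(ℝ, Euc n) I Φ.Psi.symm (Φ.restrict R hR).Psi.target x
      = mfderivWithin 𝓘(ℝ, Euc n) I Φ.Psi.symm Φ.Psi.target x := by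
    rw [mfderivWithin_of_isOpen (Φ.restrict R hR).Psi.open_target h1,
      mfderivWithin_of_isOpen Φ.Psi.open_target h2]
  change pullTensor I Φ.Psi.symm _ T x = pullTensor I Φ.Psi.symm _ T x
  rw [pullTensor, pullTensor, h3]

/-- The core of `M`. -/
theorem ChartAtInfinity.isCompact_compl_endSet (Φ : ChartAtInfinity I M) {R : ℝ} (hR : Φ.R₀ ≤ R) :
    IsCompact (Φ.endSet R)ᶜ := Φ.isCompact_core R hR

/-- Off the end the weight is either `1` or `ρ` at a point with `|x| ≤ tanh (R / 2)`. Hence dividing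
by it does not affect integrability there. -/
theorem ChartAtInfinity.exists_le_weight (Φ : ChartAtInfinity I M) (R : ℝ) :
    ∃ c > 0, ∀ p ∉ Φ.endSet R, c ≤ Φ.weight p := by
  have ht : Real.tanh (R / 2) ^ 2 < 1 := Real.tanh_sq_lt_one _
  refine ⟨min 1 ((1 - Real.tanh (R / 2) ^ 2) / 2), lt_min one_pos (by linarith), fun p hp => ?_⟩
  rw [ChartAtInfinity.weight]
  split_ifs with h
  · refine (min_le_right _ _).trans ?_
    have h1 : Φ.Psi p ∉ hypExterior n R := fun h1 => hp ⟨h, h1.2⟩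
    have h2 := Φ.Psi.map_source h
    rw [Φ.target_eq] at h2
    rw [mem_hypExterior] at h1
    have h3 : ‖Φ.Psi p‖ ≤ Real.tanh (R / 2) := not_lt.1 fun h3 => h1 ⟨h3, h2.1⟩
    have h4 := pow_le_pow_left₀ (norm_nonneg _) h3 2
    rw [rho]; linarith
  · exact min_le_left _ _

variable [MeasurableSpace M] [BorelSpace M]

theorem ChartAtInfinity.measurable_weight (Φ : ChartAtInfinity I M) : Measurable Φ.weight := by
  classical
  have h : Φ.weight = Φ.Psi.source.piecewise (fun p => rho (Φ.Psi p)) fun _ => 1 := by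
    ext p
    simp only [ChartAtInfinity.weight, Set.piecewise]
  rw [h]
  exact ContinuousOn.measurable_piecewise (rho_continuous.comp_continuousOn Φ.Psi.continuousOn)
    continuousOn_const Φ.Psi.open_source.measurableSet

/-- Local integrability of a function on `B` yields integrability on compact sets. -/
theorem integrableOn_inter_of_isCompact {X : Type*} [TopologicalSpace X] [MeasurableSpace X]
    {μ : Measure X} {F : X → ℝ} {K B : Set X} (hK : IsCompact K)
    (h : ∀ p ∈ K, ∃ V ∈ 𝓝 p, IntegrableOn F (V ∩ B) μ) : IntegrableOn F (K ∩ B) μ := by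
  refine hK.induction_on (p := fun s => IntegrableOn F (s ∩ B) μ) (by simp) ?_ ?_ ?_
  · exact fun s t hst ht => ht.mono_set (inter_subset_inter_left _ hst)
  · intro s t hs ht
    rw [union_inter_distrib_right]
    exact hs.union ht
  · intro p hp
    obtain ⟨V, hV, hi⟩ := h p hp
    exact ⟨V, mem_nhdsWithin_of_mem_nhds hV, hi⟩

theorem ChartAtInfinity.integrableOn_scalDefect_of_notMem (Φ : ChartAtInfinity I M) {T : Tensor2 I M}
    {B : Set M} {R : ℝ} (hB : ∀ p ∈ B, p ∉ Φ.endSet R)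
    (hBm : MeasurableSet B) (hi : IntegrableOn (fun p => scal I T p + n * (n - 1)) B (riemVol I T)) :
    IntegrableOn (Φ.scalDefect T) B (riemVol I T) := by
  obtain ⟨c, hc, h⟩ := Φ.exists_le_weight R
  have h1 : IntegrableOn (fun p => (Φ.weight p)⁻¹ * (scal I T p + n * (n - 1))) B (riemVol I T) := by
    refine hi.bdd_mul (c := c⁻¹) Φ.measurable_weight.inv.aestronglyMeasurable ?_
    filter_upwards [ae_restrict_mem hBm] with p hp
    have h2 := h p (hB p hp)
    rw [norm_inv, Real.norm_eq_abs, abs_of_pos (hc.trans_le h2)]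
    exact inv_anti₀ hc h2
  refine h1.congr_fun (fun p _ => ?_) hBm
  simp only [ChartAtInfinity.scalDefect]
  rw [div_eq_inv_mul]

end Restriction

/-! ### Decay of the graph term on the end. -/

section Asymptotics

variable {n : ℕ} {H : Type*} [TopologicalSpace H] {I : ModelWithCorners ℝ (Euc n) H}
  {M : Type*} [TopologicalSpace M] [ChartedSpace H M]
  {Φ : ChartAtInfinity I M} {g : Tensor2 I M} {u f : M → ℝ} {U : Set M} {α τ : ℝ}

/-- The graph metric is asymptotic to the metric of `M` to twice the order. -/
theorem ChartAtInfinity.asy_push_graphMetric (hα₀ : 0 ≤ α) (hα₁ : α ≤ 1)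
    (hu : Asy α 2 0 (fun x => u (Φ.Psi.symm x) - (rho x)⁻¹))
    (hf : Asy α 3 (τ + 1) (f ∘ Φ.Psi.symm))
    (hfd : ∀ᶠ x in far n, MDifferentiableAt I 𝓘(ℝ, ℝ) f (Φ.Psi.symm x)) :
    Asy α 2 (2 * τ - 2) (fun x => Φ.push (graphMetric I g u f) x - Φ.push g x) := by
  have h1 : Asy α 2 (-1) (fun x => u (Φ.Psi.symm x)) := by
    refine ((hu.mono (s' := -1) (by norm_num)).add (asy_inv_rho hα₀ hα₁)).congr
      (Eventually.of_forall fun x => ?_)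
    ring
  have h2 : Asy α 2 τ (fderiv ℝ (f ∘ Φ.Psi.symm)) := hf.fderiv.mono (by linarith)
  -- Orders add up to `-1 - 1 + τ + τ`. For components of a 2-tensor, `2τ - 2` means order `2τ` in
  -- the metric `b`.
  have h3 := (h1.mul h1).smul (Asy.bilin (W := Euc n →L[ℝ] Euc n →L[ℝ] ℝ)
    (ContinuousLinearMap.smulRightL ℝ (Euc n) (Euc n →L[ℝ] ℝ)) h2 h2)
  refine (h3.mono (s' := 2 * τ - 2) (by linarith)).congr ?_
  filter_upwards [hfd, eventually_far_mem Φ.R₀] with x hx hx'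
  have ht : x ∈ Φ.Psi.target := by rw [Φ.target_eq]; exact hx'
  have h4 := Φ.isParam.pullTensor_graphMetric (g := g) (u := u) ht hx
  have h5 : fderivWithin ℝ (f ∘ Φ.Psi.symm) Φ.Psi.target x = fderiv ℝ (f ∘ Φ.Psi.symm) x :=
    fderivWithin_of_isOpen Φ.Psi.open_target ht
  change pullTensor I Φ.Psi.toPartialEquiv.symm Φ.Psi.toPartialEquiv.target _ x
    - pullTensor I Φ.Psi.toPartialEquiv.symm Φ.Psi.toPartialEquiv.target _ x = _
  rw [h4]
  change _ + u (Φ.Psi.symm x) ^ 2 • (fderivWithin ℝ (f ∘ Φ.Psi.symm) Φ.Psi.target x).smulRight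
    (fderivWithin ℝ (f ∘ Φ.Psi.symm) Φ.Psi.target x) - _ = _
  rw [h5, pow_two]
  exact add_sub_cancel_left _ _

end Asymptotics

/-! ### Scalar curvature of the graph -/

section GraphScal

theorem WeightedHolder.congr {n : ℕ} {F : Type} [NormedAddCommGroup F] [NormedSpace ℝ F]
    {m k : ℕ} {α s R : ℝ} {T T' : Euc n → F} (h : WeightedHolder m k α s R T)
    (hT : ∀ x ∈ hypExterior n R, T' x = T x) : WeightedHolder m k α s R T' := by
  obtain ⟨C, h⟩ := h
  refine ⟨C, fun x hx => (h x hx).congr fun z hz => ?_⟩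
  simp only
  rw [hT _ (mem_hypExterior_of_mem_hypPiece hx hz)]

theorem exists_hypExterior_subset_shell {n : ℕ} {r : ℝ} (h0 : 0 < r) (h1 : r < 1) :
    ∃ R, ∀ R', R ≤ R' → hypExterior n R' ⊆ shell n r := by
  have h : ∀ᶠ x in far n, x ∈ shell n r := eventually_far_iff_norm.2 ⟨r, h0, h1, fun x h h' => ⟨h, h'⟩⟩
  obtain ⟨R, -, hR⟩ := eventually_far_iff.1 h
  exact ⟨R, fun R' hR' x hx => hR x (hypExterior_anti hR' hx)⟩

theorem hypExterior_eq_shell {n : ℕ} (R : ℝ) : hypExterior n R = shell n (Real.tanh (R / 2)) := by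
  ext x; exact mem_hypExterior

variable {n : ℕ} {H : Type*} [TopologicalSpace H] {I : ModelWithCorners ℝ (Euc n) H}
  {M : Type*} [TopologicalSpace M] [ChartedSpace H M] [IsManifold I ∞ M]
  [MeasurableSpace M] [BorelSpace M]
  {Φ : ChartAtInfinity I M} {g : Tensor2 I M} {u f : M → ℝ} {U : Set M} {α τ : ℝ}

/-- The scalar curvature of the graph is integrable over bounded regions near which the function is
regular. -/
theorem integrableOn_scal_graphMetric (hU : IsOpen U) (hs : IsSymmOn I univ g)
    (hp : IsPosDefOn I univ g) (hg : LocHolderTensor I 2 α univ univ g)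
    (hu : LocHolderFun I 2 α univ univ u) (hf : LocHolderFun I 3 α U U f) {A K : Set M}
    (hA : LocHolderFun I 3 α U A f) (hK : IsCompact K) (hKA : K ⊆ A) (d : ℝ) :
    IntegrableOn (fun q => scal I (graphMetric I g u f) q + d) (K ∩ U)
      (riemVol I (graphMetric I g u f)) := by
  refine integrableOn_inter_of_isCompact hK fun p hpK => ?_
  obtain ⟨r, hr, C, hC⟩ := hA p (hKA hpK)
  obtain ⟨s, hs0, hB, c, hc, hdet⟩ := exists_bddHolder_graphMetric hU hs hp hg hu hf hr hC
  have h1 := integrableOn_scal_chart hU (isSymmOn_graphMetric fun q _ => hs q (mem_univ q))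
    (isPosDefOn_graphMetric fun q _ => hp q (mem_univ q)) hB hc hdet d
  have hep : IsParam I (extChartAt I p) := isParam_extChartAt p
  refine ⟨(extChartAt I p).source ∩ extChartAt I p ⁻¹' Metric.ball (extChartAt I p p) s,
    (hep.smooth.continuousOn.isOpen_inter_preimage hep.isOpen_source Metric.isOpen_ball).mem_nhds
      ⟨mem_extChartAt_source p, Metric.mem_ball_self hs0⟩, h1.mono_set ?_⟩
  rintro q ⟨⟨hq1, hq2⟩, hq3⟩
  refine ⟨hq1, ⟨(extChartAt I p).map_source hq1, ?_⟩, hq2⟩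
  rwa [mem_preimage, (extChartAt I p).left_inv hq1]

/-- If the metric components agree to order `2 τ > n`, then integrability of the scalar curvature
over the end is inherited. -/
theorem AsyHyp.exists_integrableOn_congr (hn : 2 ≤ n) (hτ : (n : ℝ) / 2 < τ)
    {G G' : Euc n → Euc n →L[ℝ] Euc n →L[ℝ] ℝ} (hG : AsyHyp α τ G) (hG' : AsyHyp α τ G')
    (hq : ∀ i j, Asy α 2 (2 * τ - 2) (fun x => devComp G' i j x - devComp G i j x)) :
    ∃ R₁, ∀ R, R₁ ≤ R →
      IntegrableOn (fun x => (rho x)⁻¹ ^ (n + 1) * (coordScal univ G x + n * (n - 1)))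
        (hypExterior n R) →
      IntegrableOn (fun x => (rho x)⁻¹ ^ (n + 1) * (coordScal univ G' x + n * (n - 1)))
        (hypExterior n R) := by
  have h1 := (asy_inv_rho_pow hG.alpha_nonneg hG.alpha_le 0 (n + 1)).mul (hG.asy_scal_sub hG' hq)
  -- The weighted difference has order `2τ - (n + 1)`, which exceeds `-1` because `τ > n/2`.
  obtain ⟨r, h0, hr1, hr⟩ := h1.exists_integrableOn (by omega) (by push_cast; linarith)
  obtain ⟨R, hR⟩ := exists_hypExterior_subset_shell (n := n) h0 hr1
  refine ⟨R, fun R' hR' hi => ?_⟩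
  have h2 := hi.add ((hr r le_rfl).mono_set (hR R' hR'))
  refine h2.congr_fun (fun x _ => ?_) (isOpen_hypExterior R').measurableSet
  simp only [Pi.add_apply]
  ring

theorem devComp_sub {G G' : Euc n → Euc n →L[ℝ] Euc n →L[ℝ] ℝ} {s : ℝ}
    (h : Asy α 2 s (fun x => G' x - G x)) (i j : Fin n) :
    Asy α 2 s (fun x => devComp G' i j x - devComp G i j x) := by
  have h1 := h.clm_comp
    (ContinuousLinearMap.apply ℝ (Euc n →L[ℝ] ℝ) (EuclideanSpace.single i (1 : ℝ)))
  refine (h1.clm_comp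
    (ContinuousLinearMap.apply ℝ ℝ (EuclideanSpace.single j (1 : ℝ)))).congr
    (Eventually.of_forall fun x => ?_)
  simp [devComp, comp]

end GraphScal

end

end AHJang

open AHJang

theorem mainTheorem6 {n : ℕ} (hn : 2 ≤ n)
    {H : Type*} [TopologicalSpace H] (I : ModelWithCorners ℝ (AHJang.Euc n) H)
    {M : Type*} [TopologicalSpace M] [ChartedSpace H M] [IsManifold I ∞ M]
    [T2Space M] [SecondCountableTopology M] [MeasurableSpace M] [BorelSpace M]
    (α τ : ℝ) (hα₀ : 0 < α) (hα₁ : α < 1) (hτ : (n : ℝ) / 2 < τ)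
    (Φ : AHJang.ChartAtInfinity I M) (g K : AHJang.Tensor2 I M)
    (hgK : Φ.IsAsympAdS g K 2 α τ)
    (hscal : Integrable (Φ.scalDefect g) (AHJang.riemVol I g))
    (u : M → ℝ) (hu : Φ.IsWarpingFactor u 2 α)
    (U : Set M) (hU : IsOpen U) (hUc : IsCompact Uᶜ)
    (f : M → ℝ) (hf : Φ.IsWeightedFun U f 3 α (τ + 1))
    (hjang : ∀ p ∈ U, AHJang.jang I g K u f p = 0) :
    ∃ Φ' : AHJang.ChartAtInfinity I M,
      -- `Φ'` is a restriction of the chart at infinity of `M` to a smaller neighbourhood of infinity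
      (∀ p ∈ Φ'.Psi.source, p ∈ Φ.Psi.source ∧ Φ'.Psi p = Φ.Psi p) ∧
      -- the graph is asymptotically hyperbolic
      Φ'.IsAsympHyp U (AHJang.graphMetric I g u f) 2 α τ ∧
      -- its scalar curvature condition holds away from the boundary of `U`
      (∀ W ⊆ U, IsClosed W →
        IntegrableOn (Φ'.scalDefect (AHJang.graphMetric I g u f)) W
          (AHJang.riemVol I (AHJang.graphMetric I g u f))) ∧
      -- and on all of `U` if `f` is regular up to the boundary of `U`
      (AHJang.LocHolderFun I 3 α U (closure U) f →
        AHJang.LocHolderTensor I 2 α U (closure U) (AHJang.graphMetric I g u f) ∧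
        IntegrableOn (Φ'.scalDefect (AHJang.graphMetric I g u f)) U
          (AHJang.riemVol I (AHJang.graphMetric I g u f))) ∧
      -- the mass functionals of `M` and of the graph are well defined and agree
      ∃ m : AHJang.kernelSpace n →ₗ[ℝ] ℝ,
        Φ.HasMass g m ∧ Φ'.HasMass (AHJang.graphMetric I g u f) m := by
  obtain ⟨hA, -, -, -⟩ := hgK
  have hα₀' := hα₀.le
  have hα₁' := hα₁.le
  have hn2 : (2 : ℝ) ≤ n := by exact_mod_cast hn
  have hτ0 : 0 < τ := by linarith
  obtain ⟨Rf, hRf, hRfU, hfd⟩ := hf.decay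
  have haf : Asy α 3 (τ + 1) (f ∘ Φ.Psi.symm) := by simpa using hfd.asy
  have hau : Asy α 2 0 (fun x => u (Φ.Psi.symm x) - (rho x)⁻¹) := by simpa using hu.decay.asy
  have hag : Asy α 2 (τ - 2) (fun x => Φ.push g x - hypMetric n x) := hA.decay.asy
  have hfdiff : ∀ᶠ x in far n, MDifferentiableAt I 𝓘(ℝ, ℝ) f (Φ.Psi.symm x) := by
    filter_upwards [eventually_far_mem Rf] with x hx
    have ht : x ∈ Φ.Psi.target := by rw [Φ.target_eq]; exact hypExterior_anti hRf hx
    refine hf.regular.mdifferentiableAt (by norm_num) hU (hRfU _ (Φ.Psi.map_target ht) ?_)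
    rw [Φ.Psi.right_inv ht]; exact hx.2
  set gbar : Tensor2 I M := graphMetric I g u f with hgbar
  have hD : Asy α 2 (2 * τ - 2) (fun x => Φ.push gbar x - Φ.push g x) :=
    Φ.asy_push_graphMetric hα₀' hα₁' hau haf hfdiff
  have hab : Asy α 2 (τ - 2) (fun x => Φ.push gbar x - hypMetric n x) :=
    ((hD.mono (by linarith)).add hag).congr
      (Eventually.of_forall fun x =>
        (sub_add_sub_cancel (Φ.push gbar x) (Φ.push g x) (hypMetric n x)).symm)
  obtain ⟨R₁, -, hR₁⟩ := hab.weightedHolder 2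
  -- Beyond `Rf` the end lies in `U` and `f` has its decay; beyond `R₁` the weighted bound for the
  -- graph metric holds.
  set R := max Rf R₁ with hRdef
  have hR : Φ.R₀ ≤ R := hRf.trans (le_max_left _ _)
  set Φ' := Φ.restrict R hR with hΦ'
  have hpush : ∀ᶠ x in far n, Φ'.push gbar x = Φ.push gbar x := by
    filter_upwards [eventually_far_mem R] with x hx
    exact ChartAtInfinity.restrict_push gbar hx
  have hab' : Asy α 2 (τ - 2) (fun x => Φ'.push gbar x - hypMetric n x) :=
    hab.congr (hpush.mono fun x hx => by rw [hx])
  have hD' : Asy α 2 (2 * τ - 2) (fun x => Φ'.push gbar x - Φ.push g x) :=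
    hD.congr (hpush.mono fun x hx => by rw [hx])
  have hsrc : Φ'.Psi.source ⊆ U := by
    rw [hΦ', ChartAtInfinity.restrict_source]
    exact fun p hp => hRfU p hp.1 ((le_max_left _ _).trans_lt hp.2)
  have hs : IsSymmOn I U gbar := isSymmOn_graphMetric fun q _ => hA.symm q (mem_univ q)
  have hp : IsPosDefOn I U gbar := isPosDefOn_graphMetric fun q _ => hA.posDef q (mem_univ q)
  have hG : AsyHyp α τ (Φ.push g) :=
    AsyHyp.of_asy hα₀' hα₁' hτ0 (subset_univ _) hA.symm hag
  have hG' : AsyHyp α τ (Φ'.push gbar) := AsyHyp.of_asy hα₀' hα₁' hτ0 hsrc hs hab'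
  have hq := devComp_sub hD'
  obtain ⟨Ra, hRa⟩ := ChartAtInfinity.exists_integrableOn_end_iff isOpen_univ (subset_univ _)
    hα₀' hα₁' hτ0 hA.symm hA.posDef hag
  obtain ⟨Rb, hRb⟩ := ChartAtInfinity.exists_integrableOn_end_iff hU hsrc hα₀' hα₁' hτ0 hs hp hab'
  obtain ⟨Rc, hRc⟩ := AsyHyp.exists_integrableOn_congr hn hτ hG hG' hq
  -- Past this radius integrability is passed from `(M, g)` to the ball, from one metric to the
  -- other there, and back to the graph.
  set S := max (max Ra Rb) (max Rc R) with hS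
  have hSR : R ≤ S := (le_max_right _ _).trans (le_max_right _ _)
  have hig := (hRa S ((le_max_left _ _).trans (le_max_left _ _))).1 hscal.integrableOn
  have hend : IntegrableOn (Φ'.scalDefect gbar) (Φ'.endSet S) (riemVol I gbar) :=
    (hRb S ((le_max_right _ _).trans (le_max_left _ _))).2
      (hRc S ((le_max_left _ _).trans (le_max_right _ _)) hig)
  have hcore : IsCompact (Φ'.endSet S)ᶜ := Φ'.isCompact_compl_endSet hSR
  -- `A` is the set of points near which `f` is regular: `U` for closed `W ⊆ U`, whose part off the
  -- end is compact in `U`, and `closure U` for integrability on all of `U`.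
  have hcoreint : ∀ A K : Set M, LocHolderFun I 3 α U A f → IsCompact K → K ⊆ A →
      (∀ p ∈ K, p ∉ Φ'.endSet S) →
      IntegrableOn (Φ'.scalDefect gbar) (K ∩ U) (riemVol I gbar) := fun A K hfA hK hKA hKe =>
    Φ'.integrableOn_scalDefect_of_notMem (fun q hq => hKe q hq.1)
      (hK.measurableSet.inter hU.measurableSet)
      (integrableOn_scal_graphMetric hU hA.symm hA.posDef hA.regular hu.regular hf.regular hfA hK
        hKA _)
  obtain ⟨m, hm⟩ := hG.exists_mass hn hτ (Real.tanh_lt_one (S / 2))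
    (by rw [← hypExterior_eq_shell]; exact hig)
  refine ⟨Φ', fun q hq => ⟨hq.1, rfl⟩, ⟨hsrc, hs, hp, ?_, ?_⟩, fun W hWU hW => ?_, fun hfc => ⟨?_, ?_⟩,
    m, hm, fun V => ?_⟩
  · exact locHolderTensor_graphMetric hU hA.symm hA.posDef hA.regular hu.regular hf.regular hf.regular
  · have h1 := hR₁ R (le_max_right _ _)
    rw [show τ - 2 + ((2 : ℕ) : ℝ) = τ by push_cast; ring] at h1
    refine WeightedHolder.congr h1 fun x hx => ?_
    rw [hΦ', ChartAtInfinity.restrict_push (Φ := Φ) (hR := hR) gbar hx]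
  · have h1 := hcoreint U ((Φ'.endSet S)ᶜ ∩ W) hf.regular (hcore.inter_right hW)
      (fun q hq => hWU hq.2) fun q hq => hq.1
    refine (h1.union hend).mono_set fun q hq => ?_
    by_cases hqe : q ∈ Φ'.endSet S
    · exact Or.inr hqe
    · exact Or.inl ⟨⟨hqe, hq⟩, hWU hq⟩
  · exact locHolderTensor_graphMetric hU hA.symm hA.posDef hA.regular hu.regular hf.regular hfc
  · have h1 := hcoreint (closure U) ((Φ'.endSet S)ᶜ ∩ closure U) hfc
      (hcore.inter_right isClosed_closure) (fun q hq => hq.2) fun q hq => hq.1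
    refine (h1.union hend).mono_set fun q hq => ?_
    by_cases hqe : q ∈ Φ'.endSet S
    · exact Or.inr hqe
    · exact Or.inl ⟨⟨hqe, subset_closure hq⟩, hq⟩
  -- The limit functional of `g` is also that of the graph, because `2τ > n`.
  · exact AsyHyp.tendsto_massFlux_congr hn hG hG' (σ := 2 * τ) (by linarith) hq
      (isStatic_of_mem hα₀' hα₁' V.2) (hm V)
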